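/- Let $F$ be a number field with adele ring $\mathbb A$, let $w_N$ be the $N\times N$ permutation matrix with ones on the non-principal diagonal, $J_N=\begin{pmatrix}0&w_N\\-w_N&0\end{pmatrix}$, $\mathrm{Sp}_N=\{g\in \mathrm{GL}_{2N}: {}^tgJ_Ng=J_N\}$ and $g^*=w_N\,{}^tg^{-1}w_N$ for $g\in\mathrm{GL}_N$. Fix $n$ and let $G=\mathrm{Sp}_{2n}$ (of rank $2n$). Let $T$ be the diagonal torus of $G$ and let $X\subset G(F)$ be the $G(F)$-conjugacy class of $\epsilon=\mathrm{diag}(\delta,\delta^*)$, where $\delta=\mathrm{diag}(1,-1,1,\dots,(-1)^{2n-1})$. For positive integers $n_1,\dots,n_a$ and $r\ge 0$ with $n_1+\dots+n_a+r=2n$, let $P_{(n_1,\dots,n_a;r)}=M_{(n_1,\dots,n_a;r)}\ltimes U$ be the standard parabolic subgroup of block upper triangular matrices in $G$, with Levi subgroup $M=M_{(n_1,\dots,n_a;r)}=\{\mathrm{diag}(g_1,\dots,g_a,h,g_a^*,\dots,g_1^*): g_i\in \mathrm{GL}_{n_i},\,h\in\mathrm{Sp}_r\}$. Identify $\mathfrak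 a_M^*$ with $\mathbb R^a$ and define $H_M$ on $M(\mathbb A)$ by $e^{\langle\lambda,H_M(m)\rangle}=\prod_i|\det g_i|_{\mathbb A}^{\lambda_i}$. Let $A_M\subset M(\mathbb A)$ be the image of the identity component of the real points of the maximal split central torus of $M$, under $\mathbb R\hookrightarrow F\otimes_{\mathbb Q}\mathbb R\hookrightarrow\mathbb A$. For $x\in N_G(M)(F)\cap X$, the element $x$ acts as an involution on $\mathfrak a_M^*$ with $\pm1$-eigenspaces $(\mathfrak a_M^*)_x^\pm$. Let $P_x$, $M_x$ be the centralizers of $x$ in $P$, $M$, let $\delta_P,\delta_{P_x}$ be the modulus functions of $P(\mathbb A)$, $P_x(\mathbb A)$, and let $\rho_x$ be the unique element of $(\mathfrak a_M^*)_x^+$ such that $$e^{\langle\rho_x,H_M(a)\rangle}=\delta_{P_x}(a)\,\delta_P(a)^{-1/2},\qquad a\in A_M\cap M_x(\mathbb A).$$ Let $L(x)$ be the intersection of all semistandard Levi subgroups of $G$ (i.e. Levi subgroups, containing $T$, of parabolic subgroups defined over $F$) which contain $M$ and $x$. Suppose that $x$ is $M$-standard cuspidal. This means that $M=M_{(r_1,r_1,\dots,r_k,r_k,s_1,\dots,s_l;0)}$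 and $L(x)=M_{(2r_1,\dots,2r_k,s_1,\dots,s_l;0)}$, where, for some $0\le l_1\le l$, the integers $s_1,\dots,s_{l_1}$ are even and $s_i=1$ for $l_1<i\le l$, and that for $i\le l_1$ the component of $x$ in the factor $\mathrm{GL}_{s_i}$ of $L(x)$ is conjugate to $\mathrm{diag}(I_{s_i/2},-I_{s_i/2})$. Put $l_2=l-l_1$, and for $l_1<j\le l$ let $h_j=\pm1$ be the component of $x$ in the factor $\mathrm{GL}_{s_j}=\mathrm{GL}_1$ of $L(x)$. Then $$\rho_x=(\underbrace{\tfrac12,\dots,\tfrac12}_{2k+l_1},\lambda_1,\dots,\lambda_{l_2}),\qquad \lambda_i=2\,\#\{j: i\le j\le l_2,\ h_{l_1+i}=h_{l_1+j}\}-(l_2+1-i).$$ Consequently, $\rho_x+(\mathfrak a_M^*)_x^-$ is the set of all $(\mu_1,\dots,\mu_{2k+l})\in\mathbb R^{2k+l}$ which satisfy: $\mu_{2i-1}+\mu_{2i}=1$ for $1\le i\le k$; $\mu_i=\frac12$ for $2k<i\le 2k+l_1$; $\mu_{2k+j}-h_jh_{j+1}\,\mu_{2k+j+1}=1$ for $l_1<j<l$;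 and, if $l_2>0$, $\mu_{2k+l}=1$. -/

import Mathlib

namespace AdelicSp

open NumberField IsDedekindDomain IsDedekindDomain.HeightOneSpectrum Matrix MeasureTheory

noncomputable section

/-! ## Local compactness of the adeles, so that modulus functions of adelic groups make sense -/

section LocallyCompact

variable (F : Type*) [Field F] [NumberField F]

theorem finite_residueField (v : HeightOneSpectrum (𝓞 F)) :
    Finite (Valued.ResidueField (v.adicCompletion F)) := by
  have : Finite (𝓞 F ⧸ v.asIdeal) := Ideal.finiteQuotientOfFreeOfNeBot _ v.ne_bot
  let f : 𝓞 F →+* Valued.integer (v.adicCompletion F) :=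
    (algebraMap (𝓞 F) (v.adicCompletionIntegers F))
  let g : 𝓞 F →+* Valued.ResidueField (v.adicCompletion F) :=
    (IsLocalRing.residue (Valued.integer (v.adicCompletion F))).comp f
  have hf : ∀ a, ((f a : Valued.integer (v.adicCompletion F)) : v.adicCompletion F)
      = algebraMap F (v.adicCompletion F) (algebraMap (𝓞 F) F a) := fun a => rfl
  have hval : ∀ k : F, Valued.v (algebraMap F (v.adicCompletion F) k) = v.valuation F k :=
    fun k => valuedAdicCompletion_eq_valuation' v k
  have hlt : ∀ z : Valued.integer (v.adicCompletion F),
      Valued.v (z : v.adicCompletion F) < 1 → IsLocalRing.residue _ z = 0 := by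
    intro z hz
    rw [IsLocalRing.residue_eq_zero_iff, IsLocalRing.mem_maximalIdeal, mem_nonunits_iff,
      Valuation.Integer.not_isUnit_iff_valuation_lt_one]
    exact hz
  have hker : ∀ a ∈ v.asIdeal, g a = 0 := by
    intro a ha
    refine hlt _ ?_
    rw [hf, hval, valuation_lt_one_iff_mem]
    exact ha
  have hsurj : Function.Surjective g := by
    intro y
    obtain ⟨z, rfl⟩ := IsLocalRing.residue_surjective y
    have hopen : IsOpen {w : v.adicCompletion F | Valued.v (w - z) < 1} := by
      have h1 := Valued.isOpen_ball (v.adicCompletion F) 1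
      simp only [Valuation.restrict_lt_one_iff] at h1
      exact h1.preimage (continuous_id.sub continuous_const)
    obtain ⟨k, hk⟩ := (denseRange_algebraMap F v).exists_mem_open hopen ⟨z, by simp⟩
    have hk1 : v.valuation F k ≤ 1 := by
      rw [← hval, ← sub_add_cancel (algebraMap F (v.adicCompletion F) k) z]
      exact (Valued.v.map_add _ _).trans (max_le (le_of_lt hk) z.2)
    obtain ⟨a, ha⟩ := exists_valuation_sub_lt_of_integer v hk1 1
    refine ⟨a, ?_⟩
    rw [← sub_eq_zero]
    change IsLocalRing.residue _ (f a) - IsLocalRing.residue _ z = 0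
    rw [← map_sub]
    refine hlt _ ?_
    have : ((f a - z : Valued.integer (v.adicCompletion F)) : v.adicCompletion F) =
        algebraMap F (v.adicCompletion F) (algebraMap (𝓞 F) F a - k) +
          (algebraMap F (v.adicCompletion F) k - z) := by
      rw [map_sub]; push_cast; rw [hf]; ring
    rw [this]
    refine (Valued.v.map_add _ _).trans_lt (max_lt ?_ hk)
    rw [hval]; simpa using ha
  exact Finite.of_surjective (Ideal.Quotient.lift v.asIdeal g hker)
    (Ideal.Quotient.lift_surjective_of_surjective _ _ hsurj)

instance instCompactSpaceIntegers (v : HeightOneSpectrum (𝓞 F)) :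
    CompactSpace (v.adicCompletionIntegers F) := by
  have h : CompactSpace (Valued.integer (v.adicCompletion F)) := by
    rw [Valued.integer.compactSpace_iff_completeSpace_and_isDiscreteValuationRing_and_finite_residueField]
    refine ⟨?_, inferInstanceAs (IsDiscreteValuationRing (v.adicCompletionIntegers F)),
      finite_residueField F v⟩
    exact (Valued.isClosed_integer (v.adicCompletion F)).completeSpace_coe
  exact h

instance instLocallyCompactFiniteAdele : LocallyCompactSpace (FiniteAdeleRing (𝓞 F) F) := by
  have : Fact (∀ v : HeightOneSpectrum (𝓞 F),
      IsOpen (v.adicCompletionIntegers F : Set (v.adicCompletion F))) :=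
    ⟨fun v => Valued.isOpen_integer (v.adicCompletion F)⟩
  exact inferInstanceAs (LocallyCompactSpace
    (RestrictedProduct (fun v : HeightOneSpectrum (𝓞 F) => v.adicCompletion F)
      (fun v => (v.adicCompletionIntegers F : Set (v.adicCompletion F))) Filter.cofinite))

instance instT2FiniteAdele : T2Space (FiniteAdeleRing (𝓞 F) F) :=
  inferInstanceAs (T2Space
    (RestrictedProduct (fun v : HeightOneSpectrum (𝓞 F) => v.adicCompletion F)
      (fun v => (v.adicCompletionIntegers F : Set (v.adicCompletion F))) Filter.cofinite))

instance instT2InfiniteAdele : T2Space (InfiniteAdeleRing F) :=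
  inferInstanceAs (T2Space ((v : InfinitePlace F) → v.Completion))

instance instT2Adele : T2Space (AdeleRing (𝓞 F) F) :=
  inferInstanceAs (T2Space (InfiniteAdeleRing F × FiniteAdeleRing (𝓞 F) F))

instance instLocallyCompactAdele : LocallyCompactSpace (AdeleRing (𝓞 F) F) :=
  inferInstanceAs (LocallyCompactSpace (InfiniteAdeleRing F × FiniteAdeleRing (𝓞 F) F))

instance instLocallyCompactGL (m : ℕ) :
    LocallyCompactSpace (GL (Fin m) (AdeleRing (𝓞 F) F)) := by
  have : LocallyCompactSpace (Matrix (Fin m) (Fin m) (AdeleRing (𝓞 F) F)) :=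
    inferInstanceAs (LocallyCompactSpace (Fin m → Fin m → AdeleRing (𝓞 F) F))
  have : LocallyCompactSpace (Matrix (Fin m) (Fin m) (AdeleRing (𝓞 F) F))ᵐᵒᵖ :=
    MulOpposite.opHomeomorph.symm.isClosedEmbedding.locallyCompactSpace
  exact Units.isClosedEmbedding_embedProduct.locallyCompactSpace

end LocallyCompact

/-! ## Symplectic groups, standard parabolic and Levi subgroups -/

section Groups

/-- The matrix `J_N = (0, w_N; -w_N, 0)`, where `w_N` has ones on the non-principal diagonal. -/
def J (N : ℕ) (R : Type*) [CommRing R] : Matrix (Fin (2 * N)) (Fin (2 * N)) R :=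
  Matrix.of fun i j =>
    if i.val + j.val + 1 = 2 * N then (if i.val < N then 1 else -1) else 0

/-- The group `Sp_N(R)` of rank `N`, consisting of `2N × 2N` matrices. -/
def Sp (N : ℕ) (R : Type*) [CommRing R] : Subgroup (GL (Fin (2 * N)) R) where
  carrier := {g | (g : Matrix _ _ R)ᵀ * J N R * (g : Matrix _ _ R) = J N R}
  one_mem' := by simp
  mul_mem' := by
    intro a b ha hb
    simp only [Set.mem_ofPred_eq, Units.val_mul, transpose_mul] at *
    calc _ = (b : Matrix _ _ R)ᵀ * ((a : Matrix _ _ R)ᵀ * J N R * (a : Matrix _ _ R)) *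
          (b : Matrix _ _ R) := by simp only [Matrix.mul_assoc]
      _ = _ := by rw [ha, hb]
  inv_mem' := by
    intro a ha
    simp only [Set.mem_ofPred_eq] at *
    have h1 : (a : Matrix _ _ R) * (a⁻¹).val = 1 := by
      rw [← Units.val_mul, mul_inv_cancel, Units.val_one]
    have h2 : (a⁻¹).valᵀ * (a : Matrix _ _ R)ᵀ = 1 := by
      rw [← transpose_mul, h1, transpose_one]
    calc _ = (a⁻¹).valᵀ *
          ((a : Matrix _ _ R)ᵀ * J N R * (a : Matrix _ _ R)) *
          (a⁻¹).val := by rw [ha]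
      _ = ((a⁻¹).valᵀ * (a : Matrix _ _ R)ᵀ) * J N R *
          ((a : Matrix _ _ R) * (a⁻¹).val) := by
            simp only [Matrix.mul_assoc]
      _ = J N R := by rw [h1, h2, Matrix.one_mul, Matrix.mul_one]

/-- A tuple `γ = (n_1, …, n_k; r)` with `n_i > 0` and `n_1 + ⋯ + n_k + r = N`; such tuples
parameterize the standard parabolic (and Levi) subgroups of `Sp_N`. -/
structure LeviType (N : ℕ) where
  k : ℕ
  size : Fin k → ℕ
  rk : ℕ
  size_pos : ∀ i, 0 < size i
  sum_eq : ∑ i, size i + rk = N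

/-- The (zero-based) index of the block containing the position `i` (also zero-based), when the
positions are cut into consecutive blocks of the given sizes. -/
def blockIndex : List ℕ → ℕ → ℕ
  | [], _ => 0
  | a :: l, i => if i < a then 0 else blockIndex l (i - a) + 1

/-- The block containing a row (or column) `i`, for the block sizes
`n_1, …, n_k, 2r, n_k, …, n_1`. -/
def LeviType.block {N : ℕ} (γ : LeviType N) (i : Fin (2 * N)) : ℕ :=
  blockIndex (List.ofFn γ.size ++ [2 * γ.rk] ++ (List.ofFn γ.size).reverse) i.val

theorem blockTriangular_inv {m : ℕ} {R : Type*} [CommRing R] {α : Type*} [LinearOrder α]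
    {b : Fin m → α} (g : GL (Fin m) R) (h : (g : Matrix _ _ R).BlockTriangular b) :
    ((g⁻¹ : GL (Fin m) R) : Matrix _ _ R).BlockTriangular b := by
  let := g.invertible
  rw [GeneralLinearGroup.coe_inv]
  exact blockTriangular_inv_of_blockTriangular h

/-- The `R`-points of the standard parabolic subgroup `P_γ`: the block upper triangular matrices
in `Sp_N`. -/
def parabolic {N : ℕ} (γ : LeviType N) (R : Type*) [CommRing R] :
    Subgroup (GL (Fin (2 * N)) R) where
  carrier := {g | g ∈ Sp N R ∧ ∀ i j, γ.block j < γ.block i → (g : Matrix _ _ R) i j = 0}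
  one_mem' := ⟨one_mem _, fun i j h => Matrix.one_apply_ne (by rintro rfl; exact lt_irrefl _ h)⟩
  mul_mem' := by
    intro a b ha hb
    refine ⟨mul_mem ha.1 hb.1, ?_⟩
    have h1 : (a : Matrix _ _ R).BlockTriangular γ.block := fun i j => ha.2 i j
    have h2 : (b : Matrix _ _ R).BlockTriangular γ.block := fun i j => hb.2 i j
    exact fun i j h => (h1.mul h2) h
  inv_mem' := by
    intro a ha
    refine ⟨inv_mem ha.1, ?_⟩
    have h1 : (a : Matrix _ _ R).BlockTriangular γ.block := fun i j => ha.2 i j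
    exact fun i j h => blockTriangular_inv a h1 h

/-- The `R`-points of the standard Levi subgroup `M_γ`: the block diagonal matrices in `Sp_N`,
that is, the matrices `diag(g_1, …, g_k, h, g_k^*, …, g_1^*)` with `g_i ∈ GL_{n_i}`,
`h ∈ Sp_r`. -/
def levi {N : ℕ} (γ : LeviType N) (R : Type*) [CommRing R] :
    Subgroup (GL (Fin (2 * N)) R) where
  carrier := {g | g ∈ Sp N R ∧ ∀ i j, γ.block i ≠ γ.block j → (g : Matrix _ _ R) i j = 0}
  one_mem' := ⟨one_mem _, fun i j h => Matrix.one_apply_ne (by rintro rfl; exact h rfl)⟩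
  mul_mem' := by
    intro a b ha hb
    refine ⟨mul_mem ha.1 hb.1, ?_⟩
    intro i j h
    rw [Units.val_mul, Matrix.mul_apply]
    refine Finset.sum_eq_zero fun l _ => ?_
    by_cases hl : γ.block i = γ.block l
    · rw [hb.2 l j (fun h' => h (hl.trans h')), mul_zero]
    · rw [ha.2 i l hl, zero_mul]
  inv_mem' := by
    intro a ha
    refine ⟨inv_mem ha.1, ?_⟩
    have h1 : (a : Matrix _ _ R).BlockTriangular γ.block :=
      fun i j hij => ha.2 i j (ne_of_gt hij)
    have h2 : (a : Matrix _ _ R).BlockTriangular (fun i => OrderDual.toDual (γ.block i)) :=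
      fun i j hij => ha.2 i j (ne_of_lt (OrderDual.toDual_lt_toDual.1 hij))
    intro i j h
    rcases lt_or_gt_of_ne h with h | h
    · exact blockTriangular_inv a h2 (OrderDual.toDual_lt_toDual.2 h)
    · exact blockTriangular_inv a h1 h

theorem levi_le_parabolic {N : ℕ} (γ : LeviType N) (R : Type*) [CommRing R] :
    levi γ R ≤ parabolic γ R :=
  fun _ hg => ⟨hg.1, fun i j h => hg.2 i j (ne_of_gt h)⟩

/-- The `t`-th diagonal block of a matrix: the component `g_{t+1} ∈ GL_{n_{t+1}}` when
`t < k` and the matrix lies in `M_γ`. -/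
def diagBlock {N : ℕ} (γ : LeviType N) {R : Type*} [CommRing R]
    (g : GL (Fin (2 * N)) R) (t : ℕ) :
    Matrix {i : Fin (2 * N) // γ.block i = t} {i : Fin (2 * N) // γ.block i = t} R :=
  (g : Matrix _ _ R).submatrix Subtype.val Subtype.val

/-- Semistandard Levi subgroups of `Sp_N`, as groups of `F`-points: the conjugates of standard
Levi subgroups which contain the diagonal torus `T`. -/
def IsSemistandardLevi {N : ℕ} {F : Type*} [Field F] (L : Subgroup (GL (Fin (2 * N)) F)) : Prop :=
  (∃ γ : LeviType N, ∃ g ∈ Sp N F, L = (levi γ F).map (MulAut.conj g).toMonoidHom) ∧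
    ∀ t ∈ Sp N F, (∀ i j, i ≠ j → t.val i j = 0) → t ∈ L

/-- `L(x)`: the intersection of all semistandard Levi subgroups containing `M` and `x`. -/
def leviHull {N : ℕ} {F : Type*} [Field F] (γ : LeviType N) (x : GL (Fin (2 * N)) F) :
    Subgroup (GL (Fin (2 * N)) F) :=
  sInf {L | IsSemistandardLevi L ∧ levi γ F ≤ L ∧ x ∈ L}

/-- The diagonal entries of `ε_N = diag(δ_N, δ_N^*)`, `δ_N = diag(1, -1, …, (-1)^(N-1))`. -/
def epsEntry (N : ℕ) (F : Type*) [Field F] (i : Fin (2 * N)) : F :=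
  if i.val < N then (-1) ^ i.val else (-1) ^ (2 * N - 1 - i.val)

theorem epsEntry_sq (N : ℕ) (F : Type*) [Field F] :
    diagonal (epsEntry N F) * diagonal (epsEntry N F) = 1 := by
  rw [diagonal_mul_diagonal, ← diagonal_one]
  congr 1
  funext i
  unfold epsEntry
  split_ifs <;> rw [← mul_pow] <;> simp

/-- The element `ε_N`. -/
def eps (N : ℕ) (F : Type*) [Field F] : GL (Fin (2 * N)) F :=
  ⟨diagonal (epsEntry N F), diagonal (epsEntry N F), epsEntry_sq N F, epsEntry_sq N F⟩

/-- The space `X` (its `F`-points): the conjugacy class of `ε_N` in `Sp_N(F)`. -/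
def X (N : ℕ) (F : Type*) [Field F] : Set (GL (Fin (2 * N)) F) :=
  {x | ∃ g ∈ Sp N F, x = g * eps N F * g⁻¹}

end Groups

/-! ## Adelic points, the map `H_M`, the group `A_M`, and modulus functions -/

section Adelic

variable (F : Type*) [Field F] [NumberField F]

/-- The ring of adeles of `F`. -/
abbrev Adele : Type _ := AdeleRing (𝓞 F) F

/-- The adelic absolute value: the product of the normalized absolute values over all places. -/
def adelicAbs {F : Type*} [Field F] [NumberField F] (a : Adele F) : ℝ :=
  (∏ v : InfinitePlace F, ‖a.1 v‖ ^ v.mult) * ∏ᶠ v : HeightOneSpectrum (𝓞 F), ‖a.2 v‖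

/-- The embedding `y ↦ 1 ⊗ y` of `ℝ` into `F_∞ = F ⊗ ℝ ≅ ℝ^{r₁} × ℂ^{r₂}`. -/
def realToInfiniteAdele : ℝ →+* InfiniteAdeleRing F :=
  ((InfiniteAdeleRing.ringEquiv_mixedSpace F).symm : _ →+* InfiniteAdeleRing F).comp
    (algebraMap ℝ (mixedEmbedding.mixedSpace F))

/-- For real `y ≠ 0`, the idele which is `y` at every infinite place and `1` at every finite
place. -/
def realToAdele (y : ℝ) : Adele F := (realToInfiniteAdele F y, 1)

variable {F}
variable {N : ℕ}

/-- `H_M(m) ∈ 𝔞_M`, in the coordinates for which the pairing with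
`𝔞_M^* ≅ ℝ^k` (spanned by the characters `m ↦ det g_i`) is the standard one:
`H_M(m)_i = log |det g_i|_𝔸`. -/
def HM (γ : LeviType N) (m : GL (Fin (2 * N)) (Adele F)) : Fin γ.k → ℝ :=
  fun i => Real.log (adelicAbs (diagBlock γ m i.val).det)

/-- The pairing `⟨lam, H_M(m)⟩`. -/
def pairing (γ : LeviType N) (lam : Fin γ.k → ℝ) (m : GL (Fin (2 * N)) (Adele F)) : ℝ :=
  ∑ i, lam i * HM γ m i

/-- The real number by which the element of `A_M` with parameters `y_1, …, y_k` acts on the block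
with index `t`: the blocks are acted upon by `y_1, …, y_k, 1, y_k⁻¹, …, y_1⁻¹`. -/
def AMEntry (γ : LeviType N) (y : Fin γ.k → ℝ) (t : ℕ) : ℝ :=
  if h : t < γ.k then y ⟨t, h⟩
  else if h' : γ.k < t ∧ t ≤ 2 * γ.k then (y ⟨2 * γ.k - t, by omega⟩)⁻¹
  else 1

/-- The group `A_M`: the image in `M(𝔸)` of the identity component of the real points of the
split part of the centre of `M`. -/
def AM (F : Type*) [Field F] [NumberField F] (γ : LeviType N) :
    Set (GL (Fin (2 * N)) (Adele F)) :=
  {a | ∃ y : Fin γ.k → ℝ, (∀ i, 0 < y i) ∧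
    (a : Matrix _ _ (Adele F)) =
      diagonal fun j => realToAdele F (AMEntry γ y (γ.block j))}

/-- The image in the adelic group of an `F`-point. -/
def toAdelic (x : GL (Fin (2 * N)) F) : GL (Fin (2 * N)) (Adele F) :=
  GeneralLinearGroup.map (algebraMap F (Adele F)) x

/-- `P_x(𝔸)`: the centralizer of `x` in `P(𝔸)`. -/
def parabolicStab (γ : LeviType N) (x : GL (Fin (2 * N)) F) :
    Subgroup (GL (Fin (2 * N)) (Adele F)) :=
  parabolic γ (Adele F) ⊓ Subgroup.centralizer {toAdelic x}

/-- `M_x(𝔸)`: the centralizer of `x` in `M(𝔸)`. -/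
def leviStab (γ : LeviType N) (x : GL (Fin (2 * N)) F) :
    Subgroup (GL (Fin (2 * N)) (Adele F)) :=
  levi γ (Adele F) ⊓ Subgroup.centralizer {toAdelic x}

theorem leviStab_le_parabolicStab (γ : LeviType N) (x : GL (Fin (2 * N)) F) :
    leviStab γ x ≤ parabolicStab γ x :=
  inf_le_inf_right _ (levi_le_parabolic γ _)

theorem leviStab_le_parabolic (γ : LeviType N) (x : GL (Fin (2 * N)) F) :
    leviStab γ x ≤ parabolic γ (Adele F) :=
  inf_le_left.trans (levi_le_parabolic γ _)

theorem isClosed_parabolic (γ : LeviType N) :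
    IsClosed (parabolic γ (Adele F) : Set (GL (Fin (2 * N)) (Adele F))) := by
  have hc : Continuous fun g : GL (Fin (2 * N)) (Adele F) => g.val :=
    Units.continuous_val
  have h : (parabolic γ (Adele F) : Set (GL (Fin (2 * N)) (Adele F))) =
      {g | g.valᵀ * J N (Adele F) * g.val = J N (Adele F)} ∩
      ⋂ i, ⋂ j, {g | γ.block j < γ.block i → g.val i j = 0} := by
    ext g
    simp only [Set.mem_inter_iff, Set.mem_iInter]
    rfl
  rw [h]
  refine IsClosed.inter ?_ (isClosed_iInter fun i => isClosed_iInter fun j => ?_)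
  · exact isClosed_eq ((hc.matrix_transpose.matrix_mul continuous_const).matrix_mul hc)
      continuous_const
  · by_cases hij : γ.block j < γ.block i
    · simp only [hij, true_imp_iff]
      exact isClosed_eq (hc.matrix_elem i j) continuous_const
    · simp [hij]

instance instLocallyCompactParabolic (γ : LeviType N) :
    LocallyCompactSpace (parabolic γ (Adele F)) :=
  (isClosed_parabolic γ).isClosedEmbedding_subtypeVal.locallyCompactSpace

instance instLocallyCompactParabolicStab (γ : LeviType N) (x : GL (Fin (2 * N)) F) :
    LocallyCompactSpace (parabolicStab γ x) := by
  have h : IsClosed (parabolicStab γ x : Set (GL (Fin (2 * N)) (Adele F))) :=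
    (isClosed_parabolic γ).inter (Set.isClosed_centralizer _)
  exact h.isClosedEmbedding_subtypeVal.locallyCompactSpace

/-- The modulus function of `P(𝔸)`. -/
def deltaP (F : Type*) [Field F] [NumberField F] (γ : LeviType N)
    (p : parabolic γ (Adele F)) : ℝ :=
  (Measure.modularCharacter p : ℝ)

/-- The modulus function of `P_x(𝔸)`. -/
def deltaPx (γ : LeviType N) (x : GL (Fin (2 * N)) F) (p : parabolicStab γ x) : ℝ :=
  (Measure.modularCharacter p : ℝ)

/-- For `x ∈ N_G(M)` and a sign `e = ±1`, the `e`-eigenspace of the action of `x` on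
`𝔞_M^* ≅ ℝ^k`. (The action is given by
`⟨x • lam, H_M(x m x⁻¹)⟩ = ⟨lam, H_M(m)⟩`, and `x` acts as an involution when `x ∈ X`.) -/
def eigenspace (γ : LeviType N) (x : GL (Fin (2 * N)) F) (e : ℝ) : Submodule ℝ (Fin γ.k → ℝ) where
  carrier := {lam | ∀ m ∈ levi γ (Adele F),
    pairing γ lam (toAdelic x * m * (toAdelic x)⁻¹) = e * pairing γ lam m}
  zero_mem' := by intro m _; simp [pairing]
  add_mem' := by
    intro a b ha hb m hm
    have h : ∀ g : GL (Fin (2 * N)) (Adele F),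
        pairing γ (a + b) g = pairing γ a g + pairing γ b g := by
      intro g; simp [pairing, add_mul, Finset.sum_add_distrib]
    rw [h, h, ha m hm, hb m hm, mul_add]
  smul_mem' := by
    intro c a ha m hm
    have h : ∀ g : GL (Fin (2 * N)) (Adele F), pairing γ (c • a) g = c * pairing γ a g := by
      intro g; simp [pairing, mul_assoc, Finset.mul_sum]
    rw [h, h, ha m hm]; ring

/-- The property defining the vector `ρ_x`: it lies in `(𝔞_M^*)_x^+` and
`e^{⟨ρ_x, H_M(a)⟩} = δ_{P_x}(a) δ_P(a)^{-1/2}` for all `a ∈ A_M ∩ M_x(𝔸)`. -/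
def IsRho (γ : LeviType N) (x : GL (Fin (2 * N)) F) (rho : Fin γ.k → ℝ) : Prop :=
  rho ∈ eigenspace γ x 1 ∧
    ∀ a : leviStab γ x, (a : GL (Fin (2 * N)) (Adele F)) ∈ AM F γ →
      Real.exp (pairing γ rho (a : GL (Fin (2 * N)) (Adele F))) =
        deltaPx γ x (Subgroup.inclusion (leviStab_le_parabolicStab γ x) a) *
          (deltaP F γ (Subgroup.inclusion (leviStab_le_parabolic γ x) a)) ^ (-(1 / 2 : ℝ))

end Adelic

/-! ## Standard cuspidal elements, and the explicit vector -/

section Cuspidal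

/-- The numerical data `(r_1, …, r_k, s_1, …, s_l)`, `l = l₁ + l₂`, of a standard cuspidal element
of `Sp_{2n}`: `s_1, …, s_{l₁}` are even, the other `s_i` are equal to `1`, and
`2 (r_1 + ⋯ + r_k) + s_1 + ⋯ + s_l = 2n`. -/
structure CuspidalType (n : ℕ) where
  k : ℕ
  l₁ : ℕ
  l₂ : ℕ
  r : Fin k → ℕ
  s : Fin (l₁ + l₂) → ℕ
  r_pos : ∀ i, 0 < r i
  s_pos : ∀ i, 0 < s i
  s_even : ∀ i, i.val < l₁ → Even (s i)
  s_one : ∀ i, l₁ ≤ i.val → s i = 1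
  total : 2 * ∑ i, r i + ∑ i, s i = 2 * n

theorem sum_pairs {k : ℕ} (r : Fin k → ℕ) :
    ∑ i : Fin (2 * k), r ⟨i.val / 2, by omega⟩ = 2 * ∑ i, r i := by
  induction k with
  | zero => simp
  | succ k ih =>
    conv_rhs => rw [Fin.sum_univ_castSucc, mul_add, ← ih (fun i => r i.castSucc)]
    change ∑ i : Fin (2 * k + 1 + 1), r ⟨i.val / 2, by omega⟩ = _
    rw [Fin.sum_univ_castSucc, Fin.sum_univ_castSucc, add_assoc, two_mul (r (Fin.last k))]
    congr 1
    congr 1 <;> congr 1 <;> apply Fin.ext <;> (simp; try omega)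

variable {n : ℕ}

/-- `M = M_{(r_1, r_1, …, r_k, r_k, s_1, …, s_l; 0)}`. -/
@[reducible]
def CuspidalType.M (D : CuspidalType n) : LeviType (2 * n) where
  k := 2 * D.k + (D.l₁ + D.l₂)
  size := Fin.append (fun i : Fin (2 * D.k) => D.r ⟨i.val / 2, by omega⟩) D.s
  rk := 0
  size_pos := by
    intro i
    refine Fin.addCases (fun i => ?_) (fun i => ?_) i
    · rw [Fin.append_left]; exact D.r_pos _
    · rw [Fin.append_right]; exact D.s_pos _
  sum_eq := by
    rw [Fin.sum_univ_add]
    simp only [Fin.append_left, Fin.append_right]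
    rw [sum_pairs, D.total, add_zero]

/-- `L = M_{(2r_1, …, 2r_k, s_1, …, s_l; 0)}`. -/
@[reducible]
def CuspidalType.L (D : CuspidalType n) : LeviType (2 * n) where
  k := D.k + (D.l₁ + D.l₂)
  size := Fin.append (fun i : Fin D.k => 2 * D.r i) D.s
  rk := 0
  size_pos := by
    intro i
    refine Fin.addCases (fun i => ?_) (fun i => ?_) i
    · rw [Fin.append_left]; exact Nat.mul_pos two_pos (D.r_pos _)
    · rw [Fin.append_right]; exact D.s_pos _
  sum_eq := by
    rw [Fin.sum_univ_add]
    simp only [Fin.append_left, Fin.append_right]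
    rw [← Finset.mul_sum, D.total, add_zero]

variable {F : Type*} [Field F]

/-- The square matrix `z` is conjugate over `F` to `diag(I_p, -I_q)`. -/
def HasSignature {ι : Type*} [Fintype ι] [DecidableEq ι] (z : Matrix ι ι F) (p q : ℕ) : Prop :=
  ∃ (g : GL ι F) (e : ι → ℤˣ),
    Nat.card {i // e i = 1} = p ∧ Nat.card {i // e i = -1} = q ∧
    z = (g : Matrix ι ι F) * diagonal (fun i => ((e i : ℤ) : F)) *
      ((g⁻¹ : GL ι F) : Matrix ι ι F)

/-- The element `x ∈ N_G(M) ∩ X` is `M`-standard cuspidal, of the given type. Here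
`x = diag(x_1, …)` lies in `L = L(x)`, and its component in the factor `GL_{s_i}` of `L` has
signature `(p_i, q_i)` with `p_i = q_i` for all `i ≤ l₁`. -/
def IsStandardCuspidal (D : CuspidalType n) (x : GL (Fin (2 * (2 * n))) F) : Prop :=
  x ∈ X (2 * n) F ∧
  x ∈ Subgroup.normalizer (levi D.M F : Set (GL (Fin (2 * (2 * n))) F)) ∧
  leviHull D.M x = levi D.L F ∧
  ∀ i : Fin (D.l₁ + D.l₂), i.val < D.l₁ →
    ∃ p q : ℕ, HasSignature (diagBlock D.L x (D.k + i.val)) p q ∧ p = q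

/-- For `l₁ < j ≤ l₁ + l₂` (one-based), the component `h_j = ±1` of `x` in the factor
`GL_{s_j} = GL_1` of `L`. -/
def hSign (D : CuspidalType n) (x : GL (Fin (2 * (2 * n))) F) (j : ℕ) : F :=
  (diagBlock D.L x (D.k + (j - 1))).det

open Classical in
/-- `λ_i = 2 #{j ≥ i : h_{l₁+i} = h_{l₁+j}} - (l₂ + 1 - i)`, for `1 ≤ i ≤ l₂`. -/
def lamEntry (D : CuspidalType n) (x : GL (Fin (2 * (2 * n))) F) (i : ℕ) : ℝ :=
  2 * (((Finset.Icc i D.l₂).filter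
      fun j => hSign D x (D.l₁ + i) = hSign D x (D.l₁ + j)).card : ℝ) -
    ((D.l₂ : ℝ) + 1 - (i : ℝ))

/-- The vector `(1/2, …, 1/2, λ_1, …, λ_{l₂})`, with `2k + l₁` entries `1/2`. -/
def rhoVector (D : CuspidalType n) (x : GL (Fin (2 * (2 * n))) F) : Fin D.M.k → ℝ :=
  fun c => if c.val < 2 * D.k + D.l₁ then 1 / 2
    else lamEntry D x (c.val - (2 * D.k + D.l₁) + 1)

/-- The `i`-th coordinate (`1 ≤ i ≤ d`, one-based) of a vector. -/
def coord {d : ℕ} (mu : Fin d → ℝ) (i : ℕ) : ℝ :=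
  if h : i - 1 < d then mu ⟨i - 1, h⟩ else 0

/-- The hyperplane `ℋ_i : μ_i = 1/2`. -/
def hypHalf (d : ℕ) (i : ℕ) : Set (Fin d → ℝ) := {mu | coord mu i = 1 / 2}

/-- The hyperplanes `ℋ_i^± : μ_i ∓ μ_{i+1} = 1`. -/
def hypPair (d : ℕ) (e : ℝ) (i : ℕ) : Set (Fin d → ℝ) :=
  {mu | coord mu i - e * coord mu (i + 1) = 1}

/-- The hyperplane `ℋ_i^+ : μ_i = 1`, for the last index `i`. -/
def hypLast (d : ℕ) (i : ℕ) : Set (Fin d → ℝ) := {mu | coord mu i = 1}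

open Classical in
/-- The sign `h_j h_{j+1} ∈ {1, -1}`, as a real number. -/
def signProd (D : CuspidalType n) (x : GL (Fin (2 * (2 * n))) F) (j : ℕ) : ℝ :=
  if hSign D x j = hSign D x (j + 1) then 1 else -1

/-- The explicit intersection of hyperplanes in `ℝ^{2k+l}`: `ℋ_{2i-1}^-` for `1 ≤ i ≤ k`, `ℋ_i` for
`2k < i ≤ 2k + l₁`, `ℋ_{2k+j}^{h_j h_{j+1}}` for `l₁ < j < l₁ + l₂`, and, if `l₂ > 0`,
`ℋ_{2k+l}^+`. -/
def hypIntersection (D : CuspidalType n) (x : GL (Fin (2 * (2 * n))) F) :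
    Set (Fin D.M.k → ℝ) :=
  (⋂ i ∈ Finset.Icc 1 D.k, hypPair D.M.k (-1) (2 * i - 1)) ∩
  (⋂ i ∈ Finset.Icc (2 * D.k + 1) (2 * D.k + D.l₁), hypHalf D.M.k i) ∩
  (⋂ j ∈ Finset.Ico (D.l₁ + 1) (D.l₁ + D.l₂), hypPair D.M.k (signProd D x j) (2 * D.k + j)) ∩
  (⋂ _ : 0 < D.l₂, hypLast D.M.k (2 * D.k + (D.l₁ + D.l₂)))

end Cuspidal

end

end AdelicSp

namespace AdelicSp

open NumberField IsDedekindDomain IsDedekindDomain.HeightOneSpectrum Matrix MeasureTheory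

noncomputable section

/-! ## Modular characters -/

section Modular

open Measure ENNReal NNReal

/-! Structure of `P_x`. As `M` has no symplectic factor (`rk = 0`), `P` lies in the Siegel parabolic
subgroup. With the second half of the basis listed backwards, its elements are `siegel a s = (1, s;
0, 1) diag(a, a^{-T})` with `a` block triangular and `s` symmetric. A standard cuspidal `x` lies in
`L`, so `x = siegel ξ 0` with `ξ² = 1`, and the minimality of `L = L(x)` forces `ξ` to exchange the
two members of each pair of blocks (`IsStandardCuspidal.blk_eq_swap`). The group `P_x` is cut out by
the linear conditions `a ξ = ξ a` and `ξ s ξᵀ = s`.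

Modulus functions. Elements of `A_M` are trivial at the finite places, so by
`modularCharacter_of_prod` only the archimedean group, over `K = F ⊗ ℝ`, matters. There `(a, s)`
identifies the group with an open subset of a real vector space on which left translations are
affine. Hence the modulus of a torus element is the determinant of `b ↦ d b d⁻¹`, `s ↦ d s dᵀ`, that
is, the exponential of a trace of weights (`modularCharacter_of_chart`, `det_scale_exp`). The trace
is found by averaging over conjugation by `ξ` and over transposition, and depends on `ξ` only
through the traces of its blocks in `L` (`modExponent`, `algebraMap_modExponent`). These traces are
zero on a pair, zero on an even block by the signature condition, and `h_j` on a block of size one.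
The group `P` is the case `ξ = 1`.

The vector. In `log (δ_{P_x} δ_P^{-1/2})` the coefficient of the weight at position `i` is `1/2 +
t_i (∑ t_j over later blocks + 1/2 ∑ t_j over the same block)` (`modExponent_sub`). This is `1/2`
when `t_i = 0`, and `∑_{j ≥ i} h_i h_j = λ_i` on the blocks of size one (`rhoVector_blk`). The
elements of `A_M` fixed by `x` separate the vectors of the `+1`-eigenspace, whence uniqueness
(`isRho_iff`).

The affine space. The element `x` permutes the coordinates of `𝔞_M^*` by `CuspidalType.swap`, so the
affine space fixes the sum of the two coordinates of each pair and the value of every other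
coordinate. Since `λ_i - h_i h_{i+1} λ_{i+1} = 1` and the last `λ` is `1`, the hyperplanes determine
the last coordinates by downward recursion (`mem_hypIntersection_iff`). -/

theorem haarScalarFactor_congr {G : Type*} [TopologicalSpace G] [Group G] [IsTopologicalGroup G]
    [MeasurableSpace G] [BorelSpace G] {ν ν' μ : Measure G} [IsHaarMeasure μ]
    [IsFiniteMeasureOnCompacts ν] [IsMulLeftInvariant ν]
    [IsFiniteMeasureOnCompacts ν'] [IsMulLeftInvariant ν'] (h : ν = ν') :
    haarScalarFactor ν μ = haarScalarFactor ν' μ := by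
  subst h
  rfl

/-- Uniqueness of Haar measure for regular measures gives an equality of measures on all sets. This
is the convention in use: the modular character is the factor by which right translation pushes a
left Haar measure forward. -/
theorem map_mul_right_eq_modularCharacter_smul {G : Type*} [TopologicalSpace G] [Group G]
    [IsTopologicalGroup G] [LocallyCompactSpace G] [MeasurableSpace G] [BorelSpace G]
    (μ : Measure G) [IsHaarMeasure μ] [Regular μ] (g : G) :
    Measure.map (fun x => x * g) μ = modularCharacter g • μ := by
  change _ = modularCharacterFun g • μ
  rw [modularCharacterFun_eq_haarScalarFactor μ]
  have : Regular (Measure.map (fun x => x * g) μ) := Regular.map (Homeomorph.mulRight g)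
  exact isMulLeftInvariant_eq_smul_of_regular _ _

/-- The converse needs no regularity, because the scalar factor of `c • μ` relative to `μ` is `c`
for every Haar measure. It thus applies to Haar measures built by hand. -/
theorem modularCharacter_eq_of_map {G : Type*} [TopologicalSpace G] [Group G]
    [IsTopologicalGroup G] [LocallyCompactSpace G] [MeasurableSpace G] [BorelSpace G]
    (μ : Measure G) [IsHaarMeasure μ] {g : G} {c : ℝ≥0}
    (h : Measure.map (fun x => x * g) μ = c • μ) : modularCharacter g = c := by
  change modularCharacterFun g = c
  rw [modularCharacterFun_eq_haarScalarFactor μ, haarScalarFactor_congr h, haarScalarFactor_smul,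
    haarScalarFactor_self, smul_eq_mul, mul_one]

/-- The modular character of a product of two groups, on the first factor. -/
theorem modularCharacter_of_prod {G G₁ G₂ : Type*} [TopologicalSpace G] [Group G]
    [IsTopologicalGroup G] [LocallyCompactSpace G]
    [TopologicalSpace G₁] [Group G₁] [IsTopologicalGroup G₁] [LocallyCompactSpace G₁] [T2Space G₁]
    [TopologicalSpace G₂] [Group G₂] [IsTopologicalGroup G₂] [LocallyCompactSpace G₂] [T2Space G₂]
    (e : G ≃ₜ* G₁ × G₂) (g : G₁) :
    modularCharacter (e.symm (g, 1)) = modularCharacter g := by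
  borelize G
  borelize G₁
  borelize G₂
  obtain ⟨C, hC, hC1⟩ := exists_compact_mem_nhds (1 : G₂)
  let μ : Measure G := haar
  have c1 : Continuous fun x => (e x).1 := continuous_fst.comp e.continuous
  have c2 : Continuous fun x => (e x).2 := continuous_snd.comp e.continuous
  let S : Set G := (fun x => (e x).2) ⁻¹' C
  have hS : MeasurableSet S := c2.measurable hC.isClosed.measurableSet
  -- The slice `ν(E) = μ(E × C)` is a Haar measure on the first factor. This replaces a product
  -- decomposition of `μ`, which would need countability assumptions.
  let ν : Measure G₁ := map (fun x => (e x).1) (μ.restrict S)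
  have hν : ∀ E, MeasurableSet E → ν E = μ ((fun x => (e x).1) ⁻¹' E ∩ S) := fun E hE => by
    rw [map_apply c1.measurable hE, restrict_apply (c1.measurable hE)]
  have hfin : IsFiniteMeasureOnCompacts ν := ⟨fun K hK => by
    rw [hν K hK.isClosed.measurableSet]
    have : (fun x => (e x).1) ⁻¹' K ∩ S = e.symm '' (K ×ˢ C) := by
      ext x
      simp only [Set.mem_inter_iff, Set.mem_preimage, Set.mem_image, S, Set.mem_prod]
      exact ⟨fun h => ⟨e x, h, by simp⟩, by rintro ⟨y, hy, rfl⟩; simpa using hy⟩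
    rw [this]
    exact ((hK.prod hC).image e.symm.continuous).measure_lt_top⟩
  have hpos : IsOpenPosMeasure ν := ⟨fun U hU hne => by
    rw [hν U hU.measurableSet]
    obtain ⟨u, hu⟩ := hne
    have hO : IsOpen ((fun x => (e x).1) ⁻¹' U ∩ (fun x => (e x).2) ⁻¹' interior C) :=
      (hU.preimage c1).inter (isOpen_interior.preimage c2)
    have hn : ((fun x => (e x).1) ⁻¹' U ∩ (fun x => (e x).2) ⁻¹' interior C).Nonempty :=
      ⟨e.symm (u, 1), by simpa using ⟨hu, mem_interior_iff_mem_nhds.2 hC1⟩⟩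
    refine ne_of_gt (lt_of_lt_of_le (hO.measure_pos μ hn) (measure_mono ?_))
    exact Set.inter_subset_inter_right _ (Set.preimage_mono interior_subset)⟩
  have hinv : IsMulLeftInvariant ν := ⟨fun h => by
    ext E hE
    have hm : Measurable fun x : G₁ => h * x := measurable_const_mul h
    rw [map_apply hm hE, hν _ (hm hE), hν _ hE]
    -- Translation by `(h, 1)` leaves the second coordinate alone, so it preserves the strip `S`.
    rw [← measure_preimage_mul μ (e.symm (h, 1)) ((fun x => (e x).1) ⁻¹' E ∩ S)]
    congr 1
    ext x
    simp [S]⟩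
  have hH : IsHaarMeasure ν := { hfin, hpos, hinv with }
  symm
  refine modularCharacter_eq_of_map ν ?_
  have hr := map_mul_right_eq_modularCharacter_smul μ (e.symm (g, 1))
  ext E hE
  have hm : Measurable fun x : G₁ => x * g := measurable_mul_const g
  rw [map_apply hm hE, hν _ (hm hE), Measure.smul_apply, hν _ hE, ← Measure.smul_apply, ← hr,
    map_apply (measurable_mul_const _) ((c1.measurable hE).inter hS)]
  congr 1
  ext x
  simp [S]

/-- The modular character, computed from a relatively invariant measure. -/
theorem modularCharacter_eq_of_relatively_invariant {G : Type*} [TopologicalSpace G] [Group G]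
    [IsTopologicalGroup G] [LocallyCompactSpace G] [MeasurableSpace G] [BorelSpace G]
    (lam : Measure G) [IsLocallyFiniteMeasure lam] [IsOpenPosMeasure lam]
    (χ : G → ℝ≥0) (hχ : Continuous χ) (hχ0 : ∀ g, χ g ≠ 0) (hmul : ∀ g h, χ (g * h) = χ g * χ h)
    (hl : ∀ g, χ g • map (fun x => g * x) lam = lam) (a : G) (r : ℝ≥0)
    (hr : map (fun x => x * a) lam = r • lam) :
    modularCharacter a = χ a * r := by
  let f : G → ℝ≥0 := fun g => (χ g)⁻¹
  have hf : Continuous f := hχ.inv₀ hχ0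
  have hfm : Measurable fun x => (f x : ℝ≥0∞) := hf.measurable.coe_nnreal_ennreal
  -- Dividing `lam` by its own left multiplier makes it left invariant; right translation by `a`
  -- then picks up the extra factor `χ a`.
  let μ : Measure G := lam.withDensity fun x => f x
  have h1 : IsLocallyFiniteMeasure μ := IsLocallyFiniteMeasure.withDensity_coe hf
  have h2 : IsOpenPosMeasure μ := by
    refine AbsolutelyContinuous.isOpenPosMeasure (μ := lam) ?_
    refine withDensity_absolutelyContinuous' hfm.aemeasurable (Filter.Eventually.of_forall ?_)
    intro x
    simp [f, hχ0]
  have hμ : ∀ E, MeasurableSet E → μ E = ∫⁻ x, E.indicator (fun x => (f x : ℝ≥0∞)) x ∂lam := by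
    intro E hE
    rw [withDensity_apply _ hE, lintegral_indicator hE]
  have h3 : IsMulLeftInvariant μ := ⟨fun g => by
    ext E hE
    have hm : Measurable fun x : G => g * x := measurable_const_mul g
    rw [map_apply hm hE, hμ _ (hm hE), hμ _ hE]
    nth_rw 2 [← hl g]
    rw [lintegral_smul_measure, lintegral_map (hfm.indicator hE) hm, ENNReal.smul_def, smul_eq_mul,
      ← lintegral_const_mul' _ _ ENNReal.coe_ne_top]
    refine lintegral_congr fun x => ?_
    by_cases hx : g * x ∈ E
    · rw [Set.indicator_of_mem hx, Set.indicator_of_mem (by exact hx), ← ENNReal.coe_mul]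
      congr 1
      simp only [f, hmul]
      rw [mul_inv, mul_inv_cancel_left₀ (hχ0 g)]
    · rw [Set.indicator_of_notMem hx, Set.indicator_of_notMem (by exact hx), mul_zero]⟩
  have hH : IsHaarMeasure μ :=
    { h2, h3 with lt_top_of_isCompact := fun K hK => hK.measure_lt_top }
  refine modularCharacter_eq_of_map μ ?_
  ext E hE
  have hm : Measurable fun x : G => x * a := measurable_mul_const a
  rw [map_apply hm hE, hμ _ (hm hE), Measure.smul_apply, hμ _ hE, mul_smul, ← lintegral_smul_measure,
    ← hr, lintegral_map (hfm.indicator hE) hm, ENNReal.smul_def, smul_eq_mul,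
    ← lintegral_const_mul' _ _ ENNReal.coe_ne_top]
  refine lintegral_congr fun x => ?_
  by_cases hx : x * a ∈ E
  · rw [Set.indicator_of_mem hx, Set.indicator_of_mem (by exact hx), ← ENNReal.coe_mul]
    congr 1
    simp only [f, hmul]
    rw [mul_inv, mul_comm, mul_assoc, inv_mul_cancel₀ (hχ0 a), mul_one]
  · rw [Set.indicator_of_notMem hx, Set.indicator_of_notMem (by exact hx), mul_zero]

end Modular

/-! ## Determinants of diagonalizable maps on spaces of matrices -/

section LinearAlgebra

/-- A basis of eigenvectors of `E` also diagonalizes `T`, with exponentiated eigenvalues. It is used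
on invariant subspaces of a matrix space, for which no explicit basis is available. -/
theorem det_eq_exp_trace {V : Type*} [AddCommGroup V] [Module ℝ V] [FiniteDimensional ℝ V]
    (E T : V →ₗ[ℝ] V) (hE : ⨆ μ, Module.End.eigenspace E μ = ⊤)
    (hT : ∀ (μ : ℝ) (v : V), E v = μ • v → T v = Real.exp μ • v) :
    LinearMap.det T = Real.exp (LinearMap.trace ℝ V E) := by
  classical
  have hI := DirectSum.isInternal_submodule_of_iSupIndep_of_iSup_eq_top
    (Module.End.eigenspaces_iSupIndep E) hE
  let b := hI.collectedBasis fun μ => Module.finBasis ℝ (Module.End.eigenspace E μ)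
  have hb : ∀ i, E (b i) = i.1 • b i := fun i =>
    Module.End.mem_eigenspace_iff.1 (hI.collectedBasis_mem _ i)
  have : Finite (Σ μ : ℝ, Fin (Module.finrank ℝ (Module.End.eigenspace E μ))) :=
    Module.Finite.finite_basis b
  have := Fintype.ofFinite (Σ μ : ℝ, Fin (Module.finrank ℝ (Module.End.eigenspace E μ)))
  have h1 : LinearMap.toMatrix b b E = Matrix.diagonal fun i => i.1 := by
    ext i j
    rw [LinearMap.toMatrix_apply, hb, map_smul, Module.Basis.repr_self, Matrix.diagonal_apply]
    by_cases h : i = j <;> simp [h]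
  have h2 : LinearMap.toMatrix b b T = Matrix.diagonal fun i => Real.exp i.1 := by
    ext i j
    rw [LinearMap.toMatrix_apply, hT _ _ (hb j), map_smul, Module.Basis.repr_self,
      Matrix.diagonal_apply]
    by_cases h : i = j <;> simp [h]
  rw [← LinearMap.det_toMatrix b, h2, Matrix.det_diagonal, LinearMap.trace_eq_matrix_trace ℝ b, h1,
    Matrix.trace_diagonal, Real.exp_sum]

variable {ι : Type*} {K : Type*} [CommRing K] [Algebra ℝ K]

/-- Multiplication of the entries of a matrix by real weights. -/
def scale (w : ι → ι → ℝ) : Matrix ι ι K →ₗ[ℝ] Matrix ι ι K where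
  toFun x := Matrix.of fun i j => w i j • x i j
  map_add' x y := by ext; simp
  map_smul' c x := by ext i j; exact smul_comm _ _ _

@[simp]
theorem scale_apply (w : ι → ι → ℝ) (x : Matrix ι ι K) (i j : ι) :
    scale w x i j = w i j • x i j := rfl

variable [Fintype ι] [DecidableEq ι]

theorem iSup_eigenspace_scale (w : ι → ι → ℝ) :
    ⨆ μ, Module.End.eigenspace (scale w : Matrix ι ι K →ₗ[ℝ] Matrix ι ι K) μ = ⊤ := by
  rw [eq_top_iff]
  intro x _
  rw [matrix_eq_sum_single x]
  refine Submodule.sum_mem _ fun i _ => Submodule.sum_mem _ fun j _ => ?_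
  refine Submodule.mem_iSup_of_mem (w i j) ?_
  rw [Module.End.mem_eigenspace_iff]
  ext k l
  rw [scale_apply, Matrix.smul_apply]
  by_cases h : i = k ∧ j = l
  · obtain ⟨rfl, rfl⟩ := h
    rfl
  · rw [Matrix.single_apply_of_ne _ _ _ _ _ h, smul_zero, smul_zero]

variable [FiniteDimensional ℝ K]

theorem det_scale_exp (V : Submodule ℝ (Matrix ι ι K)) (w : ι → ι → ℝ)
    (hV : ∀ x ∈ V, scale w x ∈ V) (T : V →ₗ[ℝ] V)
    (hT : ∀ v i j, (T v : Matrix ι ι K) i j = Real.exp (w i j) • (v : Matrix ι ι K) i j) :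
    LinearMap.det T = Real.exp (LinearMap.trace ℝ V ((scale w).restrict hV)) := by
  refine det_eq_exp_trace _ _
    (Module.End.genEigenspace_restrict_eq_top hV (iSup_eigenspace_scale w)) ?_
  intro μ v hv
  ext i j
  -- On a `μ`-eigenvector every entry either vanishes or has weight exactly `μ`; in both cases the
  -- two exponentials agree on it.
  have h1 : w i j • (v : Matrix ι ι K) i j = μ • (v : Matrix ι ι K) i j :=
    congrFun (congrFun (congrArg Subtype.val hv) i) j
  rw [hT, Submodule.coe_smul, Matrix.smul_apply]
  rw [← sub_eq_zero, ← sub_smul, smul_eq_zero, sub_eq_zero] at h1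
  rcases h1 with h1 | h1 <;> simp [h1]

/-- Only the component of `f` from a position to itself contributes, and there `f` is multiplication
by an element of `K`. By cyclicity the trace on matrices becomes a sum of traces of multiplications
on `K`. -/
theorem trace_matrix_eq (f : Matrix ι ι K →ₗ[ℝ] Matrix ι ι K) (c : ι → ι → K)
    (h : ∀ i j k, f (Matrix.single i j k) i j = c i j * k) :
    LinearMap.trace ℝ _ f = Algebra.trace ℝ K (∑ i, ∑ j, c i j) := by
  have h1 : f = ∑ i, ∑ j, (f ∘ₗ Matrix.singleLinearMap ℝ i j) ∘ₗ Matrix.entryLinearMap ℝ K i j := by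
    ext x : 1
    conv_lhs => rw [matrix_eq_sum_single x]
    simp [LinearMap.sum_apply]
  rw [h1]
  simp only [map_sum]
  refine Finset.sum_congr rfl fun i _ => Finset.sum_congr rfl fun j _ => ?_
  rw [LinearMap.trace_comp_comm', Algebra.trace_apply]
  congr 1
  ext k
  simp [h]

end LinearAlgebra

/-! ## Blocks -/

section Blocks

theorem blockIndex_lt_length (l : List ℕ) (i : ℕ) (h : i < l.sum) :
    blockIndex l i < l.length := by
  induction l generalizing i with
  | nil => simp at h
  | cons a l ih =>
    simp only [blockIndex, List.length_cons, List.sum_cons] at *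
    split_ifs with h1
    · omega
    · have := ih (i - a) (by omega)
      omega

theorem blockIndex_append (l l' : List ℕ) (i : ℕ) :
    blockIndex (l ++ l') i =
      if i < l.sum then blockIndex l i else l.length + blockIndex l' (i - l.sum) := by
  induction l generalizing i with
  | nil => simp
  | cons a l ih =>
    simp only [List.cons_append, blockIndex, List.length_cons, List.sum_cons, ih]
    by_cases h1 : i < a
    · simp [h1, Nat.lt_add_right _ h1]
    · by_cases h2 : i - a < l.sum
      · have : i < a + l.sum := by omega
        simp [h1, h2, this]
      · have h3 : ¬ i < a + l.sum := by omega
        simp only [h1, h2, h3, if_false]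
        rw [Nat.sub_sub]
        omega

/-- Reading positions backwards reverses the order of the blocks; this produces the duality of
blocks in `block_hi`. -/
theorem blockIndex_reverse (l : List ℕ) (i : ℕ) (h : i < l.sum) :
    blockIndex l.reverse (l.sum - 1 - i) + blockIndex l i + 1 = l.length := by
  induction l generalizing i with
  | nil => simp at h
  | cons a l ih =>
    simp only [List.sum_cons] at h
    simp only [List.reverse_cons, blockIndex_append, List.sum_reverse, List.sum_cons,
      List.length_reverse, List.length_cons, blockIndex]
    by_cases h1 : i < a
    · have h2 : ¬ a + l.sum - 1 - i < l.sum := by omega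
      have h3 : a + l.sum - 1 - i - l.sum < a := by omega
      simp [h1, h2, h3]
    · have h2 : a + l.sum - 1 - i < l.sum := by omega
      have h3 : a + l.sum - 1 - i = l.sum - 1 - (i - a) := by omega
      have := ih (i - a) (by omega)
      rw [if_pos h2, h3, if_neg h1]
      omega

variable {N : ℕ}

/-- The position `i` in the first half of the coordinates. -/
def lo (i : Fin N) : Fin (2 * N) := ⟨i.val, by omega⟩

/-- The position in the second half of the coordinates which is dual to `i`. -/
def hi (i : Fin N) : Fin (2 * N) := ⟨2 * N - 1 - i.val, by omega⟩

/-- The two halves of the coordinates. -/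
def halves (N : ℕ) : Fin N ⊕ Fin N ≃ Fin (2 * N) where
  toFun := Sum.elim lo hi
  invFun j := if h : j.val < N then Sum.inl ⟨j.val, h⟩ else Sum.inr ⟨2 * N - 1 - j.val, by omega⟩
  left_inv := by
    rintro (i | i)
    · simp [lo]
    · have : ¬ (hi i).val < N := by simp only [hi]; omega
      rw [Sum.elim_inr]
      refine (dif_neg this).trans ?_
      simp only [hi, Sum.inr.injEq, Fin.ext_iff]
      omega
  right_inv := by
    intro j
    by_cases h : j.val < N
    · simp [h, lo]
    · simp only [h, dif_neg, not_false_iff, Sum.elim_inr, hi, Fin.ext_iff]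
      omega

@[simp] theorem halves_inl (i : Fin N) : halves N (Sum.inl i) = lo i := rfl

@[simp] theorem halves_inr (i : Fin N) : halves N (Sum.inr i) = hi i := rfl

@[simp] theorem halves_symm_lo (i : Fin N) : (halves N).symm (lo i) = Sum.inl i := by
  rw [Equiv.symm_apply_eq, halves_inl]

@[simp] theorem halves_symm_hi (i : Fin N) : (halves N).symm (hi i) = Sum.inr i := by
  rw [Equiv.symm_apply_eq, halves_inr]

theorem lo_or_hi (j : Fin (2 * N)) : (∃ i, j = lo i) ∨ ∃ i, j = hi i := by
  obtain ⟨s, rfl⟩ := (halves N).surjective j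
  rcases s with i | i
  · exact Or.inl ⟨i, rfl⟩
  · exact Or.inr ⟨i, rfl⟩

theorem sum_size_eq (γ : LeviType N) (h : γ.rk = 0) : (List.ofFn γ.size).sum = N := by
  have := γ.sum_eq
  rw [h, add_zero] at this
  rw [List.sum_ofFn, this]

theorem block_lo (γ : LeviType N) (h : γ.rk = 0) (i : Fin N) :
    γ.block (lo i) = blockIndex (List.ofFn γ.size) i.val := by
  have hs := sum_size_eq γ h
  rw [LeviType.block, List.append_assoc, blockIndex_append, hs, if_pos (show (lo i).val < N from i.2)]
  rfl

theorem block_lo_lt (γ : LeviType N) (h : γ.rk = 0) (i : Fin N) : γ.block (lo i) < γ.k := by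
  rw [block_lo γ h]
  have := blockIndex_lt_length (List.ofFn γ.size) i.val (by rw [sum_size_eq γ h]; exact i.2)
  simpa using this

/-- The middle block has size `2 * rk = 0` but still occupies the index `k`, so the dual blocks are
`k + 1, …, 2k` and duality is `t ↦ 2k - t`. -/
theorem block_hi (γ : LeviType N) (h : γ.rk = 0) (i : Fin N) :
    γ.block (hi i) + γ.block (lo i) = 2 * γ.k := by
  have hs := sum_size_eq γ h
  have h1 := blockIndex_reverse (List.ofFn γ.size) i.val (by rw [hs]; exact i.2)
  have h2 : ¬ 2 * N - 1 - i.val < N := by omega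
  have h3 : 2 * N - 1 - i.val - N = N - 1 - i.val := by omega
  rw [block_lo γ h, LeviType.block, List.append_assoc, blockIndex_append, hs]
  simp only [hi, h2, if_false, h, mul_zero, List.cons_append, List.nil_append, blockIndex,
    Nat.not_lt_zero, Nat.sub_zero, List.length_ofFn, h3]
  rw [hs, List.length_ofFn] at h1
  omega

end Blocks

/-! ## The Siegel parabolic subgroup -/

section Siegel

theorem submatrix_halves_injective {N : ℕ} {R : Type*}
    {M M' : Matrix (Fin (2 * N)) (Fin (2 * N)) R}
    (h : M.submatrix (halves N) (halves N) = M'.submatrix (halves N) (halves N)) : M = M' := by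
  have := congrArg (fun M => M.submatrix (halves N).symm (halves N).symm) h
  simpa using this

variable {N : ℕ} {R : Type*} [CommRing R]

/-- Listing the second half of the coordinates backwards turns `w_N` into the identity, so that
`g^*` becomes the inverse transpose. -/
theorem J_submatrix_halves :
    (J N R).submatrix (halves N) (halves N) = fromBlocks 0 1 (-1) 0 := by
  ext (i | i) (j | j)
  · have : ¬ (i.val + j.val + 1 = 2 * N) := by omega
    simp [J, lo, this]
  · by_cases h : i = j
    · subst h
      have : i.val + (2 * N - 1 - i.val) + 1 = 2 * N := by omega
      simp [J, lo, hi, this]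
    · have : ¬ (i.val + (2 * N - 1 - j.val) + 1 = 2 * N) := by
        have := Fin.val_ne_of_ne h; omega
      simp [J, lo, hi, this, h]
  · by_cases h : i = j
    · subst h
      have h1 : 2 * N - 1 - i.val + i.val + 1 = 2 * N := by omega
      have h2 : ¬ 2 * N - 1 - i.val < N := by omega
      simp [J, lo, hi, h1, h2]
    · have : ¬ (2 * N - 1 - i.val + j.val + 1 = 2 * N) := by
        have := Fin.val_ne_of_ne h; omega
      simp [J, lo, hi, this, h]
  · have : ¬ (2 * N - 1 - i.val + (2 * N - 1 - j.val) + 1 = 2 * N) := by omega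
    simp [J, hi, this]

theorem mem_Sp_iff (g : GL (Fin (2 * N)) R) :
    g ∈ Sp N R ↔ (g.val.submatrix (halves N) (halves N))ᵀ * fromBlocks 0 1 (-1) 0 *
      g.val.submatrix (halves N) (halves N) = fromBlocks 0 1 (-1) 0 := by
  rw [← J_submatrix_halves, transpose_submatrix, submatrix_mul_equiv, submatrix_mul_equiv]
  change _ = _ ↔ _
  exact ⟨fun h => by rw [h], fun h => by
    have := congrArg (fun M => M.submatrix (halves N).symm (halves N).symm) h
    simpa using this⟩

theorem inv_val_mul (a : GL (Fin N) R) : (a⁻¹).val * a.val = 1 := by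
  rw [← Units.val_mul, inv_mul_cancel, Units.val_one]

theorem mul_inv_val (a : GL (Fin N) R) : a.val * (a⁻¹).val = 1 := by
  rw [← Units.val_mul, mul_inv_cancel, Units.val_one]

theorem inv_transpose_mul (a : GL (Fin N) R) : (a⁻¹).valᵀ * a.valᵀ = 1 := by
  rw [← transpose_mul, mul_inv_val, transpose_one]

theorem transpose_mul_inv (a : GL (Fin N) R) : a.valᵀ * (a⁻¹).valᵀ = 1 := by
  rw [← transpose_mul, inv_val_mul, transpose_one]

/-- The element `(1, s; 0, 1) * diag(a, a^{-T})` of the Siegel parabolic subgroup, for a basis in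
which the second half of the coordinates is listed in the reverse order. -/
def siegel (a : GL (Fin N) R) (s : Matrix (Fin N) (Fin N) R) : GL (Fin (2 * N)) R where
  val := (fromBlocks a.val (s * (a⁻¹).valᵀ) 0 (a⁻¹).valᵀ).submatrix (halves N).symm (halves N).symm
  inv := (fromBlocks (a⁻¹).val (-((a⁻¹).val * s)) 0 a.valᵀ).submatrix
    (halves N).symm (halves N).symm
  val_inv := by
    rw [submatrix_mul_equiv, fromBlocks_multiply]
    simp only [mul_inv_val, Matrix.mul_zero, add_zero, Matrix.mul_neg, ← Matrix.mul_assoc,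
      Matrix.one_mul, Matrix.zero_mul, inv_transpose_mul, zero_add, neg_zero]
    rw [Matrix.mul_assoc s, inv_transpose_mul, Matrix.mul_one, neg_add_cancel, fromBlocks_one,
      submatrix_one_equiv]
  inv_val := by
    rw [submatrix_mul_equiv, fromBlocks_multiply]
    simp only [inv_val_mul, Matrix.mul_zero, add_zero, Matrix.neg_mul, ← Matrix.mul_assoc,
      Matrix.zero_mul, transpose_mul_inv, zero_add]
    rw [add_neg_cancel, fromBlocks_one, submatrix_one_equiv]

theorem siegel_submatrix (a : GL (Fin N) R) (s : Matrix (Fin N) (Fin N) R) :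
    (siegel a s).val.submatrix (halves N) (halves N) =
      fromBlocks a.val (s * (a⁻¹).valᵀ) 0 (a⁻¹).valᵀ := by
  ext i j
  simp [siegel]

theorem siegel_lo_lo (a : GL (Fin N) R) (s : Matrix (Fin N) (Fin N) R) (i j : Fin N) :
    (siegel a s).val (lo i) (lo j) = a.val i j := by
  simp [siegel]

theorem siegel_lo_hi (a : GL (Fin N) R) (s : Matrix (Fin N) (Fin N) R) (i j : Fin N) :
    (siegel a s).val (lo i) (hi j) = (s * (a⁻¹).valᵀ) i j := by
  simp [siegel]

theorem siegel_hi_lo (a : GL (Fin N) R) (s : Matrix (Fin N) (Fin N) R) (i j : Fin N) :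
    (siegel a s).val (hi i) (lo j) = 0 := by
  simp [siegel]

theorem siegel_hi_hi (a : GL (Fin N) R) (s : Matrix (Fin N) (Fin N) R) (i j : Fin N) :
    (siegel a s).val (hi i) (hi j) = (a⁻¹).val j i := by
  simp [siegel]

theorem siegel_mul (a b : GL (Fin N) R) (s t : Matrix (Fin N) (Fin N) R) :
    siegel a s * siegel b t = siegel (a * b) (s + a.val * t * a.valᵀ) := by
  apply Units.ext
  apply submatrix_halves_injective
  rw [Units.val_mul, ← submatrix_mul_equiv _ _ _ (halves N), siegel_submatrix, siegel_submatrix,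
    siegel_submatrix, fromBlocks_multiply]
  simp only [Matrix.mul_zero, add_zero, Matrix.zero_mul, zero_add, _root_.mul_inv_rev, Units.val_mul,
    transpose_mul, Matrix.add_mul]
  congr 1
  rw [add_comm]
  congr 1
  · rw [Matrix.mul_assoc]
  · rw [Matrix.mul_assoc _ a.valᵀ, ← Matrix.mul_assoc a.valᵀ, transpose_mul_inv, Matrix.one_mul,
      Matrix.mul_assoc]

theorem siegel_injective {a b : GL (Fin N) R} {s t : Matrix (Fin N) (Fin N) R}
    (h : siegel a s = siegel b t) : a = b ∧ s = t := by
  have h1 := congrArg (fun g : GL (Fin (2 * N)) R => g.val.submatrix (halves N) (halves N)) h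
  simp only [siegel_submatrix, fromBlocks_inj] at h1
  have hab : a = b := Units.ext h1.1
  subst hab
  refine ⟨rfl, ?_⟩
  have := congrArg (fun M => M * a.valᵀ) h1.2.1
  simpa only [Matrix.mul_assoc, inv_transpose_mul, Matrix.mul_one] using this

/-- The symplectic condition on the blocks says `a⁻¹ (sᵀ - s) a^{-T} = 0`; the invertible outer
factors can be removed. -/
theorem siegel_mem_Sp (a : GL (Fin N) R) (s : Matrix (Fin N) (Fin N) R) :
    siegel a s ∈ Sp N R ↔ sᵀ = s := by
  rw [mem_Sp_iff, siegel_submatrix, fromBlocks_transpose, fromBlocks_multiply, fromBlocks_multiply,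
    fromBlocks_inj]
  simp only [Matrix.mul_zero, Matrix.zero_mul, add_zero, zero_add, Matrix.mul_one, Matrix.mul_neg,
    transpose_mul, transpose_transpose, transpose_zero, Matrix.neg_mul,
    transpose_mul_inv, inv_val_mul, true_and, neg_zero]
  constructor
  · intro h
    have h1 : (a⁻¹).val * (sᵀ - s) * (a⁻¹).valᵀ = 0 := by
      rw [Matrix.mul_sub, Matrix.sub_mul, ← h]
      simp only [Matrix.mul_assoc]
      abel
    have h2 : a.val * ((a⁻¹).val * (sᵀ - s) * (a⁻¹).valᵀ) * a.valᵀ = sᵀ - s := by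
      simp only [← Matrix.mul_assoc, mul_inv_val, Matrix.one_mul]
      rw [Matrix.mul_assoc, inv_transpose_mul, Matrix.mul_one]
    rw [h1, Matrix.mul_zero, Matrix.zero_mul] at h2
    exact (sub_eq_zero.1 h2.symm)
  · intro h
    rw [h]
    simp only [Matrix.mul_assoc]
    abel

theorem exists_siegel (g : GL (Fin (2 * N)) R) (hg : g ∈ Sp N R)
    (h0 : ∀ i j, g.val (hi i) (lo j) = 0) : ∃ a s, sᵀ = s ∧ g = siegel a s := by
  set G := g.val.submatrix (halves N) (halves N) with hG
  have h21 : G.toBlocks₂₁ = 0 := by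
    ext i j
    exact h0 i j
  have hGe : G = fromBlocks G.toBlocks₁₁ G.toBlocks₁₂ 0 G.toBlocks₂₂ := by
    rw [← h21, fromBlocks_toBlocks]
  have h := (mem_Sp_iff g).1 hg
  rw [← hG, hGe, fromBlocks_transpose, fromBlocks_multiply, fromBlocks_multiply,
    fromBlocks_inj] at h
  simp only [Matrix.mul_zero, Matrix.zero_mul, add_zero, zero_add, Matrix.mul_one, Matrix.mul_neg,
    transpose_zero, Matrix.neg_mul, neg_zero] at h
  have h1 : G.toBlocks₁₁ * G.toBlocks₂₂ᵀ = 1 := by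
    have := congrArg transpose h.2.1
    rw [transpose_mul, transpose_transpose, transpose_one] at this
    exact mul_eq_one_comm.1 this
  -- The off-diagonal part of the symplectic relation says that the lower right block is the inverse
  -- transpose of the upper left one, which is therefore invertible.
  let a : GL (Fin N) R := ⟨G.toBlocks₁₁, G.toBlocks₂₂ᵀ, h1, mul_eq_one_comm.1 h1⟩
  have hs : g = siegel a (G.toBlocks₁₂ * a.valᵀ) := by
    apply Units.ext
    apply submatrix_halves_injective
    rw [siegel_submatrix, ← hG]
    conv_lhs => rw [hGe]
    rw [Matrix.mul_assoc, transpose_mul_inv, Matrix.mul_one]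
    congr 1
  exact ⟨a, _, (siegel_mem_Sp _ _).1 (hs ▸ hg), hs⟩

/-- Every first-half block precedes every second-half block, so `P` lies in the Siegel parabolic.
Triangularity of the lower right block then comes for free: inverse transposition and duality of
blocks each reverse the order. -/
theorem mem_parabolic_iff (γ : LeviType N) (h : γ.rk = 0) (g : GL (Fin (2 * N)) R) :
    g ∈ parabolic γ R ↔ ∃ a s, sᵀ = s ∧
      (∀ i j, γ.block (lo j) < γ.block (lo i) → (a : GL (Fin N) R).val i j = 0) ∧
      g = siegel a s := by
  constructor
  · intro hg
    obtain ⟨a, s, hs, rfl⟩ := exists_siegel g hg.1 fun i j => hg.2 _ _ (by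
      have h1 := block_lo_lt γ h i
      have h2 := block_lo_lt γ h j
      have h3 := block_hi γ h i
      omega)
    refine ⟨a, s, hs, fun i j hij => ?_, rfl⟩
    rw [← siegel_lo_lo a s]
    exact hg.2 _ _ hij
  · rintro ⟨a, s, hs, ha, rfl⟩
    refine ⟨(siegel_mem_Sp a s).2 hs, fun i j hij => ?_⟩
    rcases lo_or_hi i with ⟨i, rfl⟩ | ⟨i, rfl⟩ <;> rcases lo_or_hi j with ⟨j, rfl⟩ | ⟨j, rfl⟩
    · rw [siegel_lo_lo, ha i j hij]
    · have h1 := block_lo_lt γ h i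
      have h2 := block_lo_lt γ h j
      have h3 := block_hi γ h j
      omega
    · exact siegel_hi_lo _ _ _ _
    · rw [siegel_hi_hi]
      have hb : a.val.BlockTriangular fun i => γ.block (lo i) := fun i j hij => ha i j hij
      have h1 := block_hi γ h i
      have h2 := block_hi γ h j
      exact blockTriangular_inv a hb (show γ.block (lo i) < γ.block (lo j) by omega)

theorem mem_levi_iff (γ : LeviType N) (h : γ.rk = 0) (g : GL (Fin (2 * N)) R) :
    g ∈ levi γ R ↔ ∃ a : GL (Fin N) R,
      (∀ i j, γ.block (lo i) ≠ γ.block (lo j) → a.val i j = 0) ∧ g = siegel a 0 := by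
  constructor
  · intro hg
    obtain ⟨a, s, -, -, rfl⟩ := (mem_parabolic_iff γ h g).1 (levi_le_parabolic γ R hg)
    have hs : s = 0 := by
      have h1 : s * (a⁻¹).valᵀ = 0 := by
        ext i j
        rw [← siegel_lo_hi a s]
        refine hg.2 _ _ ?_
        have h1 := block_lo_lt γ h i
        have h2 := block_lo_lt γ h j
        have h3 := block_hi γ h j
        omega
      have := congrArg (fun M => M * a.valᵀ) h1
      simpa only [Matrix.mul_assoc, inv_transpose_mul, Matrix.mul_one, Matrix.zero_mul] using this
    subst hs
    refine ⟨a, fun i j hij => ?_, rfl⟩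
    rw [← siegel_lo_lo a 0]
    exact hg.2 _ _ hij
  · rintro ⟨a, ha, rfl⟩
    refine ⟨(siegel_mem_Sp a 0).2 transpose_zero, fun i j hij => ?_⟩
    rcases lo_or_hi i with ⟨i, rfl⟩ | ⟨i, rfl⟩ <;> rcases lo_or_hi j with ⟨j, rfl⟩ | ⟨j, rfl⟩
    · rw [siegel_lo_lo, ha i j hij]
    · rw [siegel_lo_hi, Matrix.zero_mul, Matrix.zero_apply]
    · exact siegel_hi_lo _ _ _ _
    · rw [siegel_hi_hi]
      have h1 := block_hi γ h i
      have h2 := block_hi γ h j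
      have hne : γ.block (lo i) ≠ γ.block (lo j) := by omega
      rcases lt_or_gt_of_ne hne with hlt | hlt
      · have hb : a.val.BlockTriangular fun i => γ.block (lo i) :=
          fun i j hij => ha i j (ne_of_gt hij)
        exact blockTriangular_inv a hb hlt
      · have hb : a.val.BlockTriangular fun i => OrderDual.toDual (γ.block (lo i)) :=
          fun i j hij => ha i j (ne_of_lt (OrderDual.toDual_lt_toDual.1 hij))
        exact blockTriangular_inv a hb (OrderDual.toDual_lt_toDual.2 hlt)

/-- The centralizer of `x` in `P_γ(R)`. -/
def stab (γ : LeviType N) (x : GL (Fin (2 * N)) R) : Subgroup (GL (Fin (2 * N)) R) :=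
  parabolic γ R ⊓ Subgroup.centralizer {x}

/-- Commutation of `siegel a s` with `siegel ξ 0` separates into one linear condition on `a` and one
on `s`. This makes the stabilizer an open piece of a vector space. -/
theorem mem_stab_iff (γ : LeviType N) (h : γ.rk = 0) (ξ : GL (Fin N) R) (g : GL (Fin (2 * N)) R) :
    g ∈ stab γ (siegel ξ 0) ↔ ∃ a s, (sᵀ = s ∧ ξ.val * s * ξ.valᵀ = s) ∧
      ((∀ i j, γ.block (lo j) < γ.block (lo i) → (a : GL (Fin N) R).val i j = 0) ∧
        a.val * ξ.val = ξ.val * a.val) ∧ g = siegel a s := by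
  rw [stab, Subgroup.mem_inf, mem_parabolic_iff γ h, Subgroup.mem_centralizer_singleton_iff]
  constructor
  · rintro ⟨⟨a, s, hs, ha, rfl⟩, hc⟩
    rw [siegel_mul, siegel_mul] at hc
    have h1 := siegel_injective hc
    simp only [Matrix.mul_zero, Matrix.zero_mul, add_zero, zero_add] at h1
    refine ⟨a, s, ⟨hs, ?_⟩, ⟨ha, ?_⟩, rfl⟩
    · exact h1.2.symm
    · exact congrArg Units.val h1.1
  · rintro ⟨a, s, ⟨hs, hs'⟩, ⟨ha, ha'⟩, rfl⟩
    refine ⟨⟨a, s, hs, ha, rfl⟩, ?_⟩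
    rw [siegel_mul, siegel_mul]
    have : a * ξ = ξ * a := Units.ext ha'
    rw [this, hs']
    simp

end Siegel

/-! ## Modular characters of groups with an affine chart -/

section Chart

open Measure ENNReal NNReal

theorem continuous_det_of_pointwise {X V : Type*} [TopologicalSpace X] [NormedAddCommGroup V]
    [NormedSpace ℝ V] [FiniteDimensional ℝ V] (T : X → V →ₗ[ℝ] V)
    (hT : ∀ v, Continuous fun x => T x v) : Continuous fun x => LinearMap.det (T x) := by
  let b := Module.finBasis ℝ V
  have h : (fun x => LinearMap.det (T x)) = fun x => (LinearMap.toMatrix b b (T x)).det := by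
    funext x
    rw [LinearMap.det_toMatrix]
  rw [h]
  refine Continuous.matrix_det (continuous_matrix fun i j => ?_)
  simp only [LinearMap.toMatrix_apply]
  exact (LinearMap.continuous_of_finiteDimensional (b.coord i)).comp (hT (b j))

theorem addHaar_image_linearMap_nnabs {V : Type*} [NormedAddCommGroup V] [NormedSpace ℝ V]
    [FiniteDimensional ℝ V] [MeasurableSpace V] [BorelSpace V] (μ : Measure V)
    [IsAddHaarMeasure μ] (f : V →ₗ[ℝ] V) (s : Set V) :
    μ (f '' s) = (Real.nnabs (LinearMap.det f) : ℝ≥0∞) * μ s := by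
  rw [addHaar_image_linearMap, ENNReal.ofReal, ← Real.coe_nnabs, Real.toNNReal_coe]

/-- The modular character of a group with an open embedding into a real vector space, for which
left translations are affine. -/
theorem modularCharacter_of_chart {G V : Type*} [TopologicalSpace G] [Group G]
    [IsTopologicalGroup G] [LocallyCompactSpace G] [NormedAddCommGroup V] [NormedSpace ℝ V]
    [FiniteDimensional ℝ V] (Φ : G → V) (hΦ : Topology.IsOpenEmbedding Φ)
    (L : G → V →ₗ[ℝ] V) (t : G → V) (hL : ∀ g x, Φ (g * x) = t g + L g (Φ x))
    (hLc : ∀ v, Continuous fun g => L g v) (hLmul : ∀ g h, L (g * h) = L g ∘ₗ L h)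
    (hLone : L 1 = LinearMap.id) (a : G) (A : V →ₗ[ℝ] V) (hA : ∀ x, Φ (x * a) = A (Φ x))
    (hA0 : LinearMap.det A ≠ 0) :
    (modularCharacter a : ℝ) = |LinearMap.det (L a)| / |LinearMap.det A| := by
  borelize G
  borelize V
  let vol : Measure V := addHaar
  let lam : Measure G := comap Φ vol
  have hme : MeasurableEmbedding Φ := hΦ.measurableEmbedding
  have hlam : ∀ E, lam E = vol (Φ '' E) := fun E => hme.comap_apply _ _
  have hfin : IsLocallyFiniteMeasure lam := ⟨fun g => by
    obtain ⟨U, hU, hU'⟩ := vol.finiteAt_nhds (Φ g)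
    refine ⟨Φ ⁻¹' U, hΦ.continuous.continuousAt hU, ?_⟩
    rw [hlam]
    exact lt_of_le_of_lt (measure_mono (Set.image_preimage_subset _ _)) hU'⟩
  have hpos : IsOpenPosMeasure lam := ⟨fun U hU hne => by
    rw [hlam]
    exact ((hΦ.isOpenMap U hU).measure_pos vol (hne.image Φ)).ne'⟩
  let χ : G → ℝ≥0 := fun g => Real.nnabs (LinearMap.det (L g))
  have hmul : ∀ g h, χ (g * h) = χ g * χ h := fun g h => by
    simp only [χ, hLmul, LinearMap.det_comp, map_mul]
  have hone : χ 1 = 1 := by simp [χ, hLone]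
  have hχ0 : ∀ g, χ g ≠ 0 := fun g h0 => by
    have := hmul g g⁻¹
    rw [mul_inv_cancel, hone, h0, zero_mul] at this
    exact one_ne_zero this
  have hχ : Continuous χ := continuous_abs.subtype_mk _ |>.comp (continuous_det_of_pointwise L hLc)
  have hl : ∀ g, χ g • Measure.map (fun x => g * x) lam = lam := by
    intro g
    ext E hE
    have hm : Measurable fun x : G => g * x := measurable_const_mul g
    rw [Measure.smul_apply, map_apply hm hE, hlam, hlam, ENNReal.smul_def, smul_eq_mul,
      ← addHaar_image_linearMap_nnabs]
    -- In the chart, left translation by `g` is `L g` followed by a translation, and additive Haar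
    -- measure ignores the translation.
    have : Φ '' E = (fun v => t g + v) '' (L g '' (Φ '' ((fun x => g * x) ⁻¹' E))) := by
      ext v
      simp only [Set.mem_image, Set.mem_preimage, exists_exists_and_eq_and]
      constructor
      · rintro ⟨x, hx, rfl⟩
        exact ⟨g⁻¹ * x, by simpa using hx, by rw [← hL, mul_inv_cancel_left]⟩
      · rintro ⟨x, hx, rfl⟩
        exact ⟨g * x, hx, hL g x⟩
    rw [this, Set.image_add_left, measure_preimage_add]
  have hA1 : Real.nnabs (LinearMap.det A) ≠ 0 := by simpa using hA0
  have hr : Measure.map (fun x => x * a) lam = (Real.nnabs (LinearMap.det A))⁻¹ • lam := by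
    ext E hE
    have hm : Measurable fun x : G => x * a := measurable_mul_const a
    have : Φ '' E = A '' (Φ '' ((fun x => x * a) ⁻¹' E)) := by
      ext v
      simp only [Set.mem_image, Set.mem_preimage, exists_exists_and_eq_and]
      constructor
      · rintro ⟨x, hx, rfl⟩
        exact ⟨x * a⁻¹, by simpa using hx, by rw [← hA, inv_mul_cancel_right]⟩
      · rintro ⟨x, hx, rfl⟩
        exact ⟨x * a, hx, hA x⟩
    rw [Measure.smul_apply, map_apply hm hE, hlam, hlam, this, addHaar_image_linearMap_nnabs,
      ENNReal.smul_def, smul_eq_mul, ← mul_assoc, ← ENNReal.coe_mul, inv_mul_cancel₀ hA1,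
      ENNReal.coe_one, one_mul]
  rw [modularCharacter_eq_of_relatively_invariant lam χ hχ hχ0 hmul hl a _ hr]
  simp [χ, div_eq_mul_inv]

end Chart

/-! ## The modulus function over a finite-dimensional real algebra -/

section RealPoints

variable {N : ℕ} {K : Type*} [NormedCommRing K] [NormedAlgebra ℝ K]

/-- The matrices which commute with `ξ` and are block upper triangular. -/
def triCommutant (β : Fin N → ℕ) (ξ : Matrix (Fin N) (Fin N) K) :
    Submodule ℝ (Matrix (Fin N) (Fin N) K) where
  carrier := {a | (∀ i j, β j < β i → a i j = 0) ∧ a * ξ = ξ * a}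
  zero_mem' := by simp
  add_mem' := by
    rintro a b ⟨h1, h2⟩ ⟨h3, h4⟩
    exact ⟨fun i j h => by rw [Matrix.add_apply, h1 i j h, h3 i j h, add_zero],
      by rw [Matrix.add_mul, Matrix.mul_add, h2, h4]⟩
  smul_mem' := by
    rintro c a ⟨h1, h2⟩
    exact ⟨fun i j h => by rw [Matrix.smul_apply, h1 i j h, smul_zero],
      by rw [Matrix.smul_mul, Matrix.mul_smul, h2]⟩

/-- The symmetric matrices `s` with `ξ s ξᵀ = s`. -/
def symFixed (ξ : Matrix (Fin N) (Fin N) K) : Submodule ℝ (Matrix (Fin N) (Fin N) K) where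
  carrier := {s | sᵀ = s ∧ ξ * s * ξᵀ = s}
  zero_mem' := by simp
  add_mem' := by
    rintro a b ⟨h1, h2⟩ ⟨h3, h4⟩
    exact ⟨by rw [transpose_add, h1, h3], by rw [Matrix.mul_add, Matrix.add_mul, h2, h4]⟩
  smul_mem' := by
    rintro c a ⟨h1, h2⟩
    exact ⟨by rw [transpose_smul, h1], by rw [Matrix.mul_smul, Matrix.smul_mul, h2]⟩

theorem triCommutant_mul_mem {β : Fin N → ℕ} {ξ a b : Matrix (Fin N) (Fin N) K}
    (ha : a ∈ triCommutant β ξ) (hb : b ∈ triCommutant β ξ) : a * b ∈ triCommutant β ξ := by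
  refine ⟨fun i j h => ?_, by rw [Matrix.mul_assoc, hb.2, ← Matrix.mul_assoc, ha.2,
    Matrix.mul_assoc]⟩
  have h1 : a.BlockTriangular β := fun i j => ha.1 i j
  have h2 : b.BlockTriangular β := fun i j => hb.1 i j
  exact (h1.mul h2) h

theorem symFixed_conj_mem {ξ a s : Matrix (Fin N) (Fin N) K} (ha : a * ξ = ξ * a)
    (hs : s ∈ symFixed ξ) : a * s * aᵀ ∈ symFixed ξ := by
  refine ⟨by rw [transpose_mul, transpose_mul, transpose_transpose, hs.1, Matrix.mul_assoc], ?_⟩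
  have : aᵀ * ξᵀ = ξᵀ * aᵀ := by rw [← transpose_mul, ← transpose_mul, ha]
  calc ξ * (a * s * aᵀ) * ξᵀ = (ξ * a) * s * (aᵀ * ξᵀ) := by simp only [Matrix.mul_assoc]
    _ = a * (ξ * s * ξᵀ) * aᵀ := by rw [this, ← ha]; simp only [Matrix.mul_assoc]
    _ = _ := by rw [hs.2]

/-- Left multiplication on the algebra of block upper triangular matrices commuting with `ξ`. -/
def leftMul {β : Fin N → ℕ} {ξ : Matrix (Fin N) (Fin N) K} (a : triCommutant β ξ) :
    triCommutant β ξ →ₗ[ℝ] triCommutant β ξ where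
  toFun b := ⟨a.1 * b.1, triCommutant_mul_mem a.2 b.2⟩
  map_add' _ _ := Subtype.ext (Matrix.mul_add _ _ _)
  map_smul' _ _ := Subtype.ext (Matrix.mul_smul _ _ _)

/-- Right multiplication on the algebra of block upper triangular matrices commuting with `ξ`. -/
def rightMul {β : Fin N → ℕ} {ξ : Matrix (Fin N) (Fin N) K} (a : triCommutant β ξ) :
    triCommutant β ξ →ₗ[ℝ] triCommutant β ξ where
  toFun b := ⟨b.1 * a.1, triCommutant_mul_mem b.2 a.2⟩
  map_add' _ _ := Subtype.ext (Matrix.add_mul _ _ _)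
  map_smul' _ _ := Subtype.ext (Matrix.smul_mul _ _ _)

/-- The action `s ↦ a s aᵀ` on symmetric matrices. -/
def symConj {β : Fin N → ℕ} {ξ : Matrix (Fin N) (Fin N) K} (a : triCommutant β ξ) :
    symFixed ξ →ₗ[ℝ] symFixed ξ where
  toFun s := ⟨a.1 * s.1 * a.1ᵀ, symFixed_conj_mem a.2.2 s.2⟩
  map_add' s t := Subtype.ext (by
    change a.1 * (s.1 + t.1) * a.1ᵀ = _
    rw [Matrix.mul_add, Matrix.add_mul]
    rfl)
  map_smul' c s := Subtype.ext (by
    change a.1 * (c • s.1) * a.1ᵀ = _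
    rw [Matrix.mul_smul, Matrix.smul_mul]
    rfl)

variable {γ : LeviType N} {ξ : GL (Fin N) K}

theorem chart_mem (h : γ.rk = 0) (g : stab γ (siegel ξ 0)) :
    g.1.val.submatrix lo lo ∈ triCommutant (fun i => γ.block (lo i)) ξ.val ∧
      g.1.val.submatrix lo hi * (g.1.val.submatrix lo lo)ᵀ ∈ symFixed ξ.val := by
  obtain ⟨g, hg⟩ := g
  obtain ⟨a, s, hs, ha, rfl⟩ := (mem_stab_iff γ h ξ g).1 hg
  have h1 : (siegel a s).val.submatrix lo lo = a.val := by
    ext i j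
    exact siegel_lo_lo a s i j
  have h2 : (siegel a s).val.submatrix lo hi = s * (a⁻¹).valᵀ := by
    ext i j
    exact siegel_lo_hi a s i j
  rw [h1, h2, Matrix.mul_assoc, inv_transpose_mul, Matrix.mul_one]
  exact ⟨ha, hs⟩

/-- The coordinates of an element `(1, s; 0, 1) * diag(a, a^{-T})`. -/
def chart (h : γ.rk = 0) (g : stab γ (siegel ξ 0)) :
    triCommutant (fun i => γ.block (lo i)) ξ.val × symFixed ξ.val :=
  (⟨_, (chart_mem h g).1⟩, ⟨_, (chart_mem h g).2⟩)

theorem chart_siegel (h : γ.rk = 0) (a : GL (Fin N) K) (s : Matrix (Fin N) (Fin N) K)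
    (hg : siegel a s ∈ stab γ (siegel ξ 0)) :
    ((chart h ⟨siegel a s, hg⟩).1 : Matrix (Fin N) (Fin N) K) = a.val ∧
      ((chart h ⟨siegel a s, hg⟩).2 : Matrix (Fin N) (Fin N) K) = s := by
  have h1 : (siegel a s).val.submatrix lo lo = a.val := by
    ext i j
    exact siegel_lo_lo a s i j
  have h2 : (siegel a s).val.submatrix lo hi = s * (a⁻¹).valᵀ := by
    ext i j
    exact siegel_lo_hi a s i j
  simp only [chart]
  rw [h1, h2, Matrix.mul_assoc, inv_transpose_mul, Matrix.mul_one]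
  exact ⟨rfl, rfl⟩

/-- This form avoids computing with submatrices: a chart value is recognized by exhibiting the
corresponding Siegel factorization. -/
theorem chart_eq_iff (h : γ.rk = 0) (g : stab γ (siegel ξ 0))
    (v : triCommutant (fun i => γ.block (lo i)) ξ.val × symFixed ξ.val) :
    chart h g = v ↔ ∃ a : GL (Fin N) K, a.val = v.1.1 ∧ g.1 = siegel a v.2.1 := by
  obtain ⟨g, hg⟩ := g
  obtain ⟨a, s, hs, ha, rfl⟩ := (mem_stab_iff γ h ξ g).1 hg
  have hc := chart_siegel h a s hg
  constructor
  · rintro rfl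
    exact ⟨a, hc.1.symm, by rw [hc.2]⟩
  · rintro ⟨b, hb, hbv⟩
    obtain ⟨rfl, hs⟩ := siegel_injective hbv
    exact Prod.ext (Subtype.ext (hc.1.trans hb)) (Subtype.ext (hc.2.trans hs))

theorem continuous_chart (h : γ.rk = 0) : Continuous (chart (ξ := ξ) h) := by
  have hc : Continuous fun g : stab γ (siegel ξ 0) => g.1.val :=
    Units.continuous_val.comp continuous_subtype_val
  refine Continuous.prodMk (Continuous.subtype_mk ?_ _) (Continuous.subtype_mk ?_ _)
  · exact hc.matrix_submatrix _ _
  · exact (hc.matrix_submatrix _ _).matrix_mul (hc.matrix_submatrix _ _).matrix_transpose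

theorem isUnit_chart (h : γ.rk = 0) (g : stab γ (siegel ξ 0)) : IsUnit (chart h g).1.1 := by
  obtain ⟨a, ha, -⟩ := (chart_eq_iff h g _).1 rfl
  rw [← ha]
  exact a.isUnit

/-- The image is the open set `Ω` of pairs with invertible first component. The inverse of the chart
is continuous because matrix inversion is the adjugate divided by the determinant, and inversion is
continuous at units of a complete normed ring. -/
theorem isOpenEmbedding_chart [CompleteSpace K] (h : γ.rk = 0) :
    Topology.IsOpenEmbedding (chart (ξ := ξ) h) := by
  let Ω : Set (triCommutant (fun i => γ.block (lo i)) ξ.val × symFixed ξ.val) :=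
    {v | IsUnit v.1.1.det}
  have hdet : Continuous fun v : triCommutant (fun i => γ.block (lo i)) ξ.val × symFixed ξ.val =>
      v.1.1.det := (continuous_subtype_val.comp continuous_fst).matrix_det
  have hΩ : IsOpen Ω := Units.isOpen.preimage hdet
  have hU : ∀ v : Ω, IsUnit v.1.1.1 := fun v => (Matrix.isUnit_iff_isUnit_det _).2 v.2
  have hinv : Continuous fun v : Ω => (v.1.1.1)⁻¹ := by
    rw [continuous_iff_continuousAt]
    intro v
    have h1 : ContinuousAt (fun v : Ω => Ring.inverse v.1.1.1.det) v := by
      obtain ⟨u, hu⟩ := v.2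
      refine ContinuousAt.comp (g := Ring.inverse) (f := fun v : Ω => v.1.1.1.det) ?_
        (hdet.comp continuous_subtype_val).continuousAt
      rw [← hu]
      exact NormedRing.inverse_continuousAt u
    have h2 : Continuous fun v : Ω => v.1.1.1.adjugate :=
      ((continuous_subtype_val.comp continuous_fst).comp continuous_subtype_val).matrix_adjugate
    exact h1.smul h2.continuousAt
  let unit : Ω → GL (Fin N) K := fun v => (hU v).unit
  have hunit : ∀ v, ((unit v)⁻¹).val = (v.1.1.1)⁻¹ := fun v =>
    Matrix.coe_units_inv (unit v)
  have hcv : Continuous fun v : Ω => v.1.1.1 :=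
    (continuous_subtype_val.comp continuous_fst).comp continuous_subtype_val
  have hcs : Continuous fun v : Ω => v.1.2.1 :=
    (continuous_subtype_val.comp continuous_snd).comp continuous_subtype_val
  let Ψ : Ω → stab γ (siegel ξ 0) := fun v => ⟨siegel (unit v) v.1.2.1,
    (mem_stab_iff γ h ξ _).2 ⟨unit v, v.1.2.1, v.1.2.2, v.1.1.2, rfl⟩⟩
  have hΨ : Continuous Ψ := by
    refine Continuous.subtype_mk (Units.continuous_iff.2 ⟨?_, ?_⟩) _
    · change Continuous fun v : Ω => (fromBlocks (unit v).val (v.1.2.1 * ((unit v)⁻¹).valᵀ) 0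
        ((unit v)⁻¹).valᵀ).submatrix (halves N).symm (halves N).symm
      simp only [hunit]
      exact (hcv.matrix_fromBlocks (hcs.matrix_mul hinv.matrix_transpose) continuous_const
        hinv.matrix_transpose).matrix_submatrix _ _
    · change Continuous fun v : Ω => (fromBlocks ((unit v)⁻¹).val (-(((unit v)⁻¹).val * v.1.2.1)) 0
        (unit v).valᵀ).submatrix (halves N).symm (halves N).symm
      simp only [hunit]
      exact (hinv.matrix_fromBlocks (hinv.matrix_mul hcs).neg continuous_const
        hcv.matrix_transpose).matrix_submatrix _ _
  have hΦΨ : ∀ v, chart h (Ψ v) = v.1 := fun v =>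
    (chart_eq_iff h _ _).2 ⟨unit v, rfl, rfl⟩
  have hmem : ∀ g, chart (ξ := ξ) h g ∈ Ω := fun g =>
    (Matrix.isUnit_iff_isUnit_det _).1 (isUnit_chart h g)
  have hΨΦ : ∀ g, Ψ ⟨chart h g, hmem g⟩ = g := fun g => by
    obtain ⟨a, ha, hg⟩ := (chart_eq_iff h g _).1 rfl
    apply Subtype.ext
    rw [hg]
    change siegel _ _ = _
    congr 1
    exact Units.ext ha.symm
  let e : stab γ (siegel ξ 0) ≃ₜ Ω :=
    { toFun := fun g => ⟨chart h g, hmem g⟩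
      invFun := Ψ
      left_inv := hΨΦ
      right_inv := fun v => Subtype.ext (hΦΨ v)
      continuous_toFun := (continuous_chart h).subtype_mk _
      continuous_invFun := hΨ }
  exact hΩ.isOpenEmbedding_subtypeVal.comp e.isOpenEmbedding

end RealPoints

/-! ### Traces of weights on the coordinate spaces of the stabilizer -/

section Traces

variable {N : ℕ} {K : Type*} [NormedCommRing K] [NormedAlgebra ℝ K]

/-- A block diagonal factor moves entries only within a block, where the weights are constant. -/
theorem scale_mul_of_blockDiagonal {f : Fin N → Fin N → ℝ} {lb : Fin N → ℕ}
    (hf : ∀ i j k, lb j = lb k → f i j = f i k) (b x : Matrix (Fin N) (Fin N) K)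
    (hx : ∀ i j, lb i ≠ lb j → x i j = 0) : scale f b * x = scale f (b * x) := by
  ext i j
  rw [scale_apply, Matrix.mul_apply, Matrix.mul_apply, Finset.smul_sum]
  refine Finset.sum_congr rfl fun k _ => ?_
  by_cases h : lb k = lb j
  · rw [scale_apply, hf i k j h, smul_mul_assoc]
  · rw [hx k j h, mul_zero, mul_zero, smul_zero]

theorem mul_scale_of_blockDiagonal {f : Fin N → Fin N → ℝ} {lb : Fin N → ℕ}
    (hf : ∀ i j k, lb i = lb j → f i k = f j k) (b x : Matrix (Fin N) (Fin N) K)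
    (hx : ∀ i j, lb i ≠ lb j → x i j = 0) : x * scale f b = scale f (x * b) := by
  ext i j
  rw [scale_apply, Matrix.mul_apply, Matrix.mul_apply, Finset.smul_sum]
  refine Finset.sum_congr rfl fun k _ => ?_
  by_cases h : lb i = lb k
  · rw [scale_apply, hf i k j h, mul_smul_comm]
  · rw [hx i k h, zero_mul, zero_mul, smul_zero]

theorem scale_mem_triCommutant {β lb : Fin N → ℕ} {ξ : Matrix (Fin N) (Fin N) K}
    (hξ : ∀ i j, lb i ≠ lb j → ξ i j = 0) {f : Fin N → Fin N → ℝ}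
    (hf : ∀ i j k, lb j = lb k → f i j = f i k) (hf' : ∀ i j k, lb i = lb j → f i k = f j k)
    {a : Matrix (Fin N) (Fin N) K} (ha : a ∈ triCommutant β ξ) : scale f a ∈ triCommutant β ξ := by
  refine ⟨fun i j h => by rw [scale_apply, ha.1 i j h, smul_zero], ?_⟩
  rw [scale_mul_of_blockDiagonal hf _ _ hξ, mul_scale_of_blockDiagonal hf' _ _ hξ, ha.2]

theorem scale_mem_symFixed {lb : Fin N → ℕ} {ξ : Matrix (Fin N) (Fin N) K}
    (hξ : ∀ i j, lb i ≠ lb j → ξ i j = 0) {f : Fin N → Fin N → ℝ}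
    (hf : ∀ i j k, lb j = lb k → f i j = f i k) (hf' : ∀ i j, f i j = f j i)
    {s : Matrix (Fin N) (Fin N) K} (hs : s ∈ symFixed ξ) : scale f s ∈ symFixed ξ := by
  constructor
  · ext i j
    rw [transpose_apply, scale_apply, scale_apply, hf' j i, ← transpose_apply s, hs.1]
  · have h1 : ∀ i j k, lb i = lb j → f i k = f j k := fun i j k h => by
      rw [hf' i k, hf' j k, hf k i j h]
    rw [mul_scale_of_blockDiagonal h1 _ _ hξ,
      scale_mul_of_blockDiagonal hf _ ξᵀ fun i j h => hξ j i h.symm, hs.2]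

variable [FiniteDimensional ℝ K]

/-- An endomorphism of the whole space with image in `V` has the same trace as its restriction to
`V`. Taking for `g` the map `f` preceded by a projector onto `V` moves the computation to the full
matrix space. -/
theorem restrict_trace_eq (V : Submodule ℝ (Matrix (Fin N) (Fin N) K))
    (f g : Matrix (Fin N) (Fin N) K →ₗ[ℝ] Matrix (Fin N) (Fin N) K)
    (hf : ∀ v ∈ V, f v ∈ V) (hg : ∀ v, g v ∈ V) (hfg : ∀ v ∈ V, f v = g v) :
    LinearMap.trace ℝ V (f.restrict hf) = LinearMap.trace ℝ _ g := by
  rw [← LinearMap.trace_restrict_eq_of_forall_mem V g hg]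
  congr 1
  ext1 v
  exact Subtype.ext (hfg v v.2)

theorem trace_scale_triCommutant {β lb : Fin N → ℕ} {ξ : Matrix (Fin N) (Fin N) K}
    (hβ : ∀ i j, lb i < lb j → β i < β j) (hξ : ∀ i j, lb i ≠ lb j → ξ i j = 0) (hξξ : ξ * ξ = 1)
    {w : Fin N → ℝ} (hw : ∀ i j, lb i = lb j → w i = w j)
    (hV : ∀ a ∈ triCommutant β ξ, scale (fun i j => w i - w j) a ∈ triCommutant β ξ) :
    LinearMap.trace ℝ _ ((scale fun i j => w i - w j).restrict hV) =
      Algebra.trace ℝ K (∑ i, ∑ j, (if lb i < lb j then (w i - w j) / 2 else 0) •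
        (1 + ξ i i * ξ j j)) := by
  -- The factor `1/2` averages `v` with `ξ v ξ`. Positions inside a block of `lb` are dropped
  -- because their weight `w i - w j` is zero, and those below the blocks because `v` vanishes
  -- there.
  let m : Fin N → Fin N → ℝ := fun i j => if lb i < lb j then (w i - w j) / 2 else 0
  let g : Matrix (Fin N) (Fin N) K →ₗ[ℝ] Matrix (Fin N) (Fin N) K :=
    (LinearMap.id + LinearMap.mulLeft ℝ ξ ∘ₗ LinearMap.mulRight ℝ ξ) ∘ₗ scale m
  have hg : ∀ v, g v = scale m v + ξ * (scale m v * ξ) := fun v => rfl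
  have hm : ∀ v : Matrix (Fin N) (Fin N) K, ∀ i j, ¬ lb i < lb j → scale m v i j = 0 :=
    fun v i j h => by simp [m, h]
  have hm1 : ∀ i j k, lb j = lb k → m i j = m i k := fun i j k h => by
    simp only [m, h, hw j k h]
  have hm2 : ∀ i j k, lb i = lb j → m i k = m j k := fun i j k h => by
    simp only [m, h, hw i j h]
  have hg' : ∀ v, g v = scale m (v + ξ * v * ξ) := fun v => by
    rw [hg, scale_mul_of_blockDiagonal hm1 _ _ hξ, mul_scale_of_blockDiagonal hm2 _ _ hξ, map_add,
      Matrix.mul_assoc]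
  rw [restrict_trace_eq _ _ g hV, trace_matrix_eq g fun i j => m i j • (1 + ξ i i * ξ j j)]
  · intro i j k
    rw [hg', scale_apply, Matrix.add_apply, Matrix.single_apply_same, Matrix.mul_apply,
      Finset.sum_eq_single j]
    · rw [Matrix.mul_apply, Finset.sum_eq_single i]
      · rw [Matrix.single_apply_same, smul_mul_assoc]
        congr 1
        ring
      · intro b _ hb
        rw [Matrix.single_apply_of_row_ne hb.symm, mul_zero]
      · simp
    · intro b _ hb
      rw [Matrix.mul_apply, Finset.sum_eq_zero, zero_mul]
      intro c _
      rw [Matrix.single_apply_of_col_ne _ _ hb.symm, mul_zero]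
    · simp
  · intro v
    refine ⟨fun i j hij => ?_, ?_⟩
    · rw [hg']
      refine hm _ i j fun h => ?_
      exact absurd (hβ i j h) (by omega)
    · rw [hg, Matrix.add_mul, Matrix.mul_add]
      simp only [Matrix.mul_assoc, hξξ, Matrix.mul_one]
      rw [← Matrix.mul_assoc ξ ξ, hξξ, Matrix.one_mul, add_comm]
  · intro v hv
    have h1 : v + ξ * v * ξ = (2 : ℝ) • v := by
      rw [← hv.2, Matrix.mul_assoc, hξξ, Matrix.mul_one, two_smul]
    rw [hg', h1]
    ext i j
    simp only [scale_apply, Matrix.smul_apply, smul_smul]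
    rcases lt_trichotomy (lb i) (lb j) with h | h | h
    · simp [m, h]
    · simp [m, h, hw i j h]
    · rw [hv.1 i j (hβ j i h), smul_zero, smul_zero]

theorem trace_scale_symFixed {lb : Fin N → ℕ} {ξ : Matrix (Fin N) (Fin N) K}
    (hξ : ∀ i j, lb i ≠ lb j → ξ i j = 0) (hξξ : ξ * ξ = 1)
    {w : Fin N → ℝ} (hw : ∀ i j, lb i = lb j → w i = w j)
    (hV : ∀ a ∈ symFixed ξ, scale (fun i j => w i + w j) a ∈ symFixed ξ) :
    LinearMap.trace ℝ _ ((scale fun i j => w i + w j).restrict hV) =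
      Algebra.trace ℝ K (∑ i, ∑ j, ((w i + w j) / 4) •
        (1 + (1 : Matrix (Fin N) (Fin N) K) i j + ξ i i * ξ j j + ξ i j * ξ j i)) := by
  -- The factor `1/4` averages over the group of order four generated by transposition and `s ↦ ξ s
  -- ξᵀ`; its four elements give the four summands of the trace.
  let m : Fin N → Fin N → ℝ := fun i j => (w i + w j) / 4
  let τ : Matrix (Fin N) (Fin N) K →ₗ[ℝ] Matrix (Fin N) (Fin N) K :=
    (Matrix.transposeLinearEquiv (Fin N) (Fin N) ℝ K).toLinearMap
  let g : Matrix (Fin N) (Fin N) K →ₗ[ℝ] Matrix (Fin N) (Fin N) K :=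
    scale m ∘ₗ (LinearMap.id + LinearMap.mulLeft ℝ ξ ∘ₗ LinearMap.mulRight ℝ ξᵀ) ∘ₗ
      (LinearMap.id + τ)
  have hξξ' : ξᵀ * ξᵀ = 1 := by rw [← transpose_mul, hξξ, transpose_one]
  have hg : ∀ v, g v = scale m ((v + vᵀ) + ξ * ((v + vᵀ) * ξᵀ)) := fun v => rfl
  rw [restrict_trace_eq _ _ g hV, trace_matrix_eq g fun i j => m i j •
    (1 + (1 : Matrix (Fin N) (Fin N) K) i j + ξ i i * ξ j j + ξ i j * ξ j i)]
  · intro i j k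
    have key : ∀ p q : Fin N, (ξ * (Matrix.single p q k * ξᵀ)) i j = ξ i p * ξ j q * k := by
      intro p q
      rw [Matrix.mul_apply, Finset.sum_eq_single p]
      · rw [Matrix.single_mul_apply_same, transpose_apply]
        ring
      · intro b _ hb
        rw [Matrix.single_mul_apply_of_ne _ _ _ _ _ hb, mul_zero]
      · simp
    rw [hg, scale_apply, smul_mul_assoc]
    congr 1
    rw [Matrix.add_mul, Matrix.mul_add, Matrix.transpose_single]
    simp only [Matrix.add_apply, key, Matrix.single_apply_same]
    by_cases h : i = j
    · subst h
      rw [Matrix.single_apply_same, Matrix.one_apply_eq]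
      ring
    · rw [Matrix.single_apply_of_row_ne (Ne.symm h), Matrix.one_apply_ne h]
      ring
  · intro v
    rw [hg]
    refine scale_mem_symFixed hξ (fun i j k h => by simp [m, hw j k h])
      (fun i j => by simp [m, add_comm]) ⟨?_, ?_⟩
    · simp only [transpose_add, transpose_mul, transpose_transpose, Matrix.mul_assoc]
      rw [add_comm vᵀ v]
    · rw [Matrix.mul_add, Matrix.add_mul]
      simp only [Matrix.mul_assoc, hξξ', Matrix.mul_one]
      rw [← Matrix.mul_assoc ξ ξ, hξξ, Matrix.one_mul, add_comm]
  · intro v hv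
    have h1 : (v + vᵀ) + ξ * ((v + vᵀ) * ξᵀ) = (4 : ℝ) • v := by
      rw [hv.1, Matrix.add_mul, Matrix.mul_add, ← Matrix.mul_assoc, hv.2]
      module
    rw [hg, h1]
    ext i j
    simp only [scale_apply, Matrix.smul_apply, smul_smul, m]
    congr 1
    ring

end Traces

/-! ### The modulus of the stabilizer over a real algebra -/

section Modulus

attribute [local instance] Matrix.normedAddCommGroup Matrix.normedSpace

variable {N : ℕ} {K : Type*} [NormedCommRing K] [NormedAlgebra ℝ K]
  {γ : LeviType N} {ξ : GL (Fin N) K}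

/-- The product rule `(a, s)(b, t) = (ab, s + a t aᵀ)`, read as an affine function of the right
factor. -/
theorem chart_mul (h : γ.rk = 0) (g x : stab γ (siegel ξ 0)) :
    chart h (g * x) = (0, (chart h g).2) +
      ((leftMul (chart h g).1).prodMap (symConj (chart h g).1)) (chart h x) := by
  obtain ⟨a, ha, hg⟩ := (chart_eq_iff h g _).1 rfl
  obtain ⟨b, hb, hx⟩ := (chart_eq_iff h x _).1 rfl
  refine (chart_eq_iff h _ _).2 ⟨a * b, ?_, ?_⟩
  · rw [Units.val_mul, ha, hb]
    exact (zero_add _).symm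
  · rw [Subgroup.coe_mul, hg, hx, siegel_mul, ha]
    rfl

/-- The modulus function on elements `diag(e^{w_1}, …, e^{w_N}, …)` of the stabilizer. -/
theorem modularCharacter_stab [FiniteDimensional ℝ K] (h : γ.rk = 0)
    [LocallyCompactSpace (stab γ (siegel ξ 0))]
    {lb : Fin N → ℕ} (hβ : ∀ i j, lb i < lb j → γ.block (lo i) < γ.block (lo j))
    (hξ : ∀ i j, lb i ≠ lb j → ξ.val i j = 0) (hξξ : ξ.val * ξ.val = 1)
    {w : Fin N → ℝ} (hw : ∀ i j, lb i = lb j → w i = w j) (a : stab γ (siegel ξ 0))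
    (d : GL (Fin N) K) (hd : d.val = Matrix.diagonal fun i => algebraMap ℝ K (Real.exp (w i)))
    (ha : a.1 = siegel d 0) (r : ℝ)
    (hr : algebraMap ℝ K r = ∑ i, ∑ j, (if lb i < lb j then (w i - w j) / 2 else 0) •
        (1 + ξ.val i i * ξ.val j j) + ∑ i, ∑ j, ((w i + w j) / 4) •
        (1 + (1 : Matrix (Fin N) (Fin N) K) i j + ξ.val i i * ξ.val j j +
          ξ.val i j * ξ.val j i)) :
    (Measure.modularCharacter a : ℝ) = Real.exp (Module.finrank ℝ K * r) := by
  have : CompleteSpace K := FiniteDimensional.complete ℝ K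
  set β : Fin N → ℕ := fun i => γ.block (lo i) with hβdef
  have hB : ∀ f : ℝ → ℝ, ∀ b ∈ triCommutant β ξ.val,
      scale (fun i j => f (w i - w j)) b ∈ triCommutant β ξ.val := fun f b hb =>
    scale_mem_triCommutant hξ (fun i j k h => by rw [hw j k h]) (fun i j k h => by rw [hw i j h]) hb
  have hS : ∀ f : ℝ → ℝ, ∀ s ∈ symFixed ξ.val,
      scale (fun i j => f (w i + w j)) s ∈ symFixed ξ.val := fun f b hb =>
    scale_mem_symFixed hξ (fun i j k h => by rw [hw j k h]) (fun i j => by rw [add_comm]) hb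
  obtain ⟨hca₁, hca₂⟩ : (chart h a).1.1 = d.val ∧ (chart h a).2 = 0 := by
    obtain ⟨b, hb, hb'⟩ := (chart_eq_iff h a _).1 rfl
    obtain ⟨rfl, hs⟩ := siegel_injective (ha.symm.trans hb')
    exact ⟨hb.symm, Subtype.ext hs.symm⟩
  let L : stab γ (siegel ξ 0) → (triCommutant β ξ.val × symFixed ξ.val) →ₗ[ℝ]
      (triCommutant β ξ.val × symFixed ξ.val) :=
    fun g => (leftMul (chart h g).1).prodMap (symConj (chart h g).1)
  let A : (triCommutant β ξ.val × symFixed ξ.val) →ₗ[ℝ]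
      (triCommutant β ξ.val × symFixed ξ.val) := (rightMul (chart h a).1).prodMap LinearMap.id
  let S₁ := (scale fun i j => Real.exp (w i - w j)).restrict (hB Real.exp)
  let S₂ := (scale fun i j => Real.exp (w i + w j)).restrict (hS Real.exp)
  -- Writing `d b = (d b d⁻¹) d` splits left translation by the torus element into right translation
  -- followed by the adjoint action, which scales entries by `exp (w i ∓ w j)`. The quotient of
  -- determinants is thus that of the adjoint action.
  have hLA : L a = (S₁.prodMap S₂) ∘ₗ A := by
    refine LinearMap.ext fun v => Prod.ext (Subtype.ext ?_) (Subtype.ext ?_)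
    · change (chart h a).1.1 * v.1.1 = scale _ (v.1.1 * (chart h a).1.1)
      rw [hca₁]
      ext i j
      rw [scale_apply, hd, Matrix.diagonal_mul, Matrix.mul_diagonal, Algebra.smul_def,
        sub_eq_add_neg, Real.exp_add, map_mul]
      have : algebraMap ℝ K (Real.exp (-w j)) * algebraMap ℝ K (Real.exp (w j)) = 1 := by
        rw [← map_mul, ← Real.exp_add, neg_add_cancel, Real.exp_zero, map_one]
      linear_combination (-(algebraMap ℝ K (Real.exp (w i)) * v.1.1 i j)) * this
    · change (chart h a).1.1 * v.2.1 * (chart h a).1.1ᵀ = scale _ v.2.1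
      rw [hca₁]
      ext i j
      rw [scale_apply, hd, Matrix.diagonal_transpose, Matrix.mul_diagonal, Matrix.diagonal_mul,
        Algebra.smul_def, Real.exp_add, map_mul]
      ring
  have hLmul : ∀ g g', L (g * g') = L g ∘ₗ L g' := by
    intro g g'
    have h1 : (chart h (g * g')).1.1 = (chart h g).1.1 * (chart h g').1.1 := by
      rw [chart_mul]
      exact zero_add _
    refine LinearMap.ext fun v => Prod.ext (Subtype.ext ?_) (Subtype.ext ?_)
    · change (chart h (g * g')).1.1 * v.1.1 = (chart h g).1.1 * ((chart h g').1.1 * v.1.1)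
      rw [h1, Matrix.mul_assoc]
    · change (chart h (g * g')).1.1 * v.2.1 * (chart h (g * g')).1.1ᵀ = (chart h g).1.1 *
        ((chart h g').1.1 * v.2.1 * (chart h g').1.1ᵀ) * (chart h g).1.1ᵀ
      rw [h1, transpose_mul]
      simp only [Matrix.mul_assoc]
  have hLone : L 1 = LinearMap.id := by
    have h1 : (chart (ξ := ξ) h 1).1.1 = 1 := by
      change (1 : Matrix _ _ K).submatrix lo lo = 1
      ext i j
      by_cases hij : i = j
      · rw [hij, submatrix_apply, Matrix.one_apply_eq, Matrix.one_apply_eq]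
      · rw [submatrix_apply, Matrix.one_apply_ne hij, Matrix.one_apply_ne]
        exact fun h' => hij (Fin.ext (congrArg Fin.val h' :))
    refine LinearMap.ext fun v => Prod.ext (Subtype.ext ?_) (Subtype.ext ?_)
    · change (chart (ξ := ξ) h 1).1.1 * v.1.1 = v.1.1
      rw [h1, Matrix.one_mul]
    · change (chart (ξ := ξ) h 1).1.1 * v.2.1 * (chart (ξ := ξ) h 1).1.1ᵀ = v.2.1
      rw [h1, transpose_one, Matrix.one_mul, Matrix.mul_one]
  have hA : ∀ x, chart h (x * a) = A (chart h x) := by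
    intro x
    rw [chart_mul]
    refine Prod.ext (Subtype.ext ?_) (Subtype.ext ?_)
    · exact zero_add _
    · change (chart h x).2.1 + (chart h x).1.1 * (chart h a).2.1 * (chart h x).1.1ᵀ =
        (chart h x).2.1
      rw [hca₂, Submodule.coe_zero, Matrix.mul_zero, Matrix.zero_mul, add_zero]
  have hT : LinearMap.det (S₁.prodMap S₂) = Real.exp (Module.finrank ℝ K * r) := by
    rw [LinearMap.det_prodMap, det_scale_exp _ _ (hB id) S₁ (fun v i j => rfl),
      det_scale_exp _ _ (hS id) S₂ (fun v i j => rfl), ← Real.exp_add]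
    congr 1
    refine (congrArg₂ (· + ·) (trace_scale_triCommutant hβ hξ hξξ hw _)
      (trace_scale_symFixed hξ hξξ hw _)).trans ?_
    -- The sum of weights is a real scalar in `K`, so its trace over `ℝ` is `r` times the dimension
    -- of `K`.
    rw [← map_add, ← hr, Algebra.trace_algebraMap, nsmul_eq_mul]
  have hcont : Continuous fun g : stab γ (siegel ξ 0) => (chart h g).1.1 :=
    continuous_subtype_val.comp (continuous_fst.comp (continuous_chart h))
  have hLc : ∀ v, Continuous fun g => L g v := by
    intro v
    refine Continuous.prodMk (Continuous.subtype_mk ?_ _) (Continuous.subtype_mk ?_ _)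
    · exact hcont.matrix_mul continuous_const
    · exact (hcont.matrix_mul continuous_const).matrix_mul hcont.matrix_transpose
  -- `L a` is invertible, as `L` is multiplicative, and it factors through `A`.
  have hA0 : LinearMap.det A ≠ 0 := by
    have h1 : LinearMap.det (L a) * LinearMap.det (L a⁻¹) = 1 := by
      rw [← LinearMap.det_comp, ← hLmul, mul_inv_cancel, hLone, LinearMap.det_id]
    rw [hLA, LinearMap.det_comp] at h1
    intro h0
    rw [h0, mul_zero, zero_mul] at h1
    exact zero_ne_one h1
  rw [modularCharacter_of_chart (chart h) (isOpenEmbedding_chart h) L (fun g => (0, (chart h g).2))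
    (chart_mul h) hLc hLmul hLone a A hA hA0, hLA, LinearMap.det_comp, abs_mul,
    mul_div_assoc, div_self (abs_ne_zero.2 hA0), mul_one, hT, Real.abs_exp]

end Modulus

/-! ## Products of rings, and the modulus function over the adeles -/

section Products

variable {N : ℕ} {R S : Type*} [CommRing R] [CommRing S]

theorem map_J (f : R →+* S) : (J N R).map f = J N S := by
  ext i j
  simp only [J, map_apply, of_apply]
  split_ifs <;> simp

theorem map_mem_Sp (f : R →+* S) {g : GL (Fin (2 * N)) R} (hg : g ∈ Sp N R) :
    GeneralLinearGroup.map f g ∈ Sp N S := by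
  change (g.val.map f)ᵀ * J N S * g.val.map f = J N S
  rw [← map_J f, ← transpose_map, ← Matrix.map_mul, ← Matrix.map_mul]
  congr 1

theorem map_mem_stab (f : R →+* S) {γ : LeviType N} {x g : GL (Fin (2 * N)) R}
    (hg : g ∈ stab γ x) : GeneralLinearGroup.map f g ∈ stab γ (GeneralLinearGroup.map f x) := by
  refine ⟨⟨map_mem_Sp f hg.1.1, fun i j h => ?_⟩, ?_⟩
  · change f (g.val i j) = 0
    rw [hg.1.2 i j h, map_zero]
  · refine Subgroup.mem_centralizer_singleton_iff.2 ?_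
    rw [← map_mul, ← map_mul, Subgroup.mem_centralizer_singleton_iff.1 hg.2]

theorem map_siegel (f : R →+* S) (a : GL (Fin N) R) (s : Matrix (Fin N) (Fin N) R) :
    GeneralLinearGroup.map f (siegel a s) = siegel (GeneralLinearGroup.map f a) (s.map f) := by
  apply Units.ext
  apply submatrix_halves_injective
  rw [siegel_submatrix]
  change ((siegel a s).val.submatrix (halves N) (halves N)).map f = _
  rw [siegel_submatrix, fromBlocks_map]
  congr 1
  · rw [Matrix.map_mul, transpose_map]
    rfl
  · ext i j
    exact map_zero f

theorem isClosed_stab [TopologicalSpace R] [IsTopologicalRing R] [T2Space R] (γ : LeviType N)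
    (x : GL (Fin (2 * N)) R) : IsClosed (stab γ x : Set (GL (Fin (2 * N)) R)) := by
  have hc : Continuous fun g : GL (Fin (2 * N)) R => g.val := Units.continuous_val
  have h : (parabolic γ R : Set (GL (Fin (2 * N)) R)) =
      {g | g.valᵀ * J N R * g.val = J N R} ∩
      ⋂ i, ⋂ j, {g | γ.block j < γ.block i → g.val i j = 0} := by
    ext g
    simp only [Set.mem_inter_iff, Set.mem_iInter]
    rfl
  have hP : IsClosed (parabolic γ R : Set (GL (Fin (2 * N)) R)) := by
    rw [h]
    refine IsClosed.inter ?_ (isClosed_iInter fun i => isClosed_iInter fun j => ?_)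
    · exact isClosed_eq ((hc.matrix_transpose.matrix_mul continuous_const).matrix_mul hc)
        continuous_const
    · by_cases hij : γ.block j < γ.block i
      · simp only [hij, true_imp_iff]
        exact isClosed_eq (hc.matrix_elem i j) continuous_const
      · simp [hij]
  exact hP.inter (Set.isClosed_centralizer _)

theorem locallyCompactSpace_stab [TopologicalSpace R] [IsTopologicalRing R] [T2Space R]
    [LocallyCompactSpace R] (γ : LeviType N) (x : GL (Fin (2 * N)) R) :
    LocallyCompactSpace (stab γ x) := by
  have : LocallyCompactSpace (Matrix (Fin (2 * N)) (Fin (2 * N)) R) :=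
    inferInstanceAs (LocallyCompactSpace (Fin (2 * N) → Fin (2 * N) → R))
  have : LocallyCompactSpace (Matrix (Fin (2 * N)) (Fin (2 * N)) R)ᵐᵒᵖ :=
    MulOpposite.opHomeomorph.symm.isClosedEmbedding.locallyCompactSpace
  have : LocallyCompactSpace (GL (Fin (2 * N)) R) :=
    Units.isClosedEmbedding_embedProduct.locallyCompactSpace
  exact (isClosed_stab γ x).isClosedEmbedding_subtypeVal.locallyCompactSpace

theorem continuous_map_GL [TopologicalSpace R] [TopologicalSpace S] (f : R →+* S)
    (hf : Continuous f) :
    Continuous (GeneralLinearGroup.map f : GL (Fin (2 * N)) R → GL (Fin (2 * N)) S) := by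
  refine Units.continuous_iff.2 ⟨?_, ?_⟩
  · exact Units.continuous_val.matrix_map hf
  · have : Continuous fun g : GL (Fin (2 * N)) R => (g⁻¹).val := Units.continuous_coe_inv
    exact this.matrix_map hf

variable {R₁ R₂ : Type*} [CommRing R₁] [CommRing R₂]

/-- A ring is the product of two others. -/
structure IsProduct (f₁ : R →+* R₁) (f₂ : R →+* R₂) (j : R₁ × R₂ → R) : Prop where
  fst : ∀ p, f₁ (j p) = p.1
  snd : ∀ p, f₂ (j p) = p.2
  eta : ∀ r, j (f₁ r, f₂ r) = r

variable {f₁ : R →+* R₁} {f₂ : R →+* R₂} {j : R₁ × R₂ → R}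

theorem IsProduct.matrix_ext (h : IsProduct f₁ f₂ j) {m : ℕ} {A B : Matrix (Fin m) (Fin m) R}
    (h₁ : A.map f₁ = B.map f₁) (h₂ : A.map f₂ = B.map f₂) : A = B := by
  ext i k
  rw [← h.eta (A i k), ← h.eta (B i k)]
  exact congrArg₂ (fun a b => j (a, b)) (congrFun (congrFun h₁ i) k) (congrFun (congrFun h₂ i) k)

theorem IsProduct.ext (h : IsProduct f₁ f₂ j) {m : ℕ} {g g' : GL (Fin m) R}
    (h₁ : GeneralLinearGroup.map f₁ g = GeneralLinearGroup.map f₁ g')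
    (h₂ : GeneralLinearGroup.map f₂ g = GeneralLinearGroup.map f₂ g') : g = g' :=
  Units.ext (h.matrix_ext (congrArg Units.val h₁) (congrArg Units.val h₂))

theorem IsProduct.mem_stab (h : IsProduct f₁ f₂ j) {γ : LeviType N} {x g : GL (Fin (2 * N)) R}
    (h₁ : GeneralLinearGroup.map f₁ g ∈ stab γ (GeneralLinearGroup.map f₁ x))
    (h₂ : GeneralLinearGroup.map f₂ g ∈ stab γ (GeneralLinearGroup.map f₂ x)) : g ∈ stab γ x := by
  refine ⟨⟨?_, fun i k hik => ?_⟩, ?_⟩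
  · change g.valᵀ * J N R * g.val = J N R
    refine h.matrix_ext ?_ ?_
    · rw [Matrix.map_mul, Matrix.map_mul, transpose_map, map_J]
      exact h₁.1.1
    · rw [Matrix.map_mul, Matrix.map_mul, transpose_map, map_J]
      exact h₂.1.1
  · rw [← h.eta (g.val i k), ← h.eta 0, map_zero, map_zero]
    exact congrArg₂ (fun a b => j (a, b)) (h₁.1.2 i k hik) (h₂.1.2 i k hik)
  · refine Subgroup.mem_centralizer_singleton_iff.2 (h.ext ?_ ?_)
    · rw [map_mul, map_mul]
      exact Subgroup.mem_centralizer_singleton_iff.1 h₁.2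
    · rw [map_mul, map_mul]
      exact Subgroup.mem_centralizer_singleton_iff.1 h₂.2

/-- The matrix with given components. -/
def joinMatrix (j : R₁ × R₂ → R) {m : ℕ} (A : Matrix (Fin m) (Fin m) R₁)
    (B : Matrix (Fin m) (Fin m) R₂) : Matrix (Fin m) (Fin m) R :=
  Matrix.of fun i k => j (A i k, B i k)

theorem IsProduct.map_joinMatrix (h : IsProduct f₁ f₂ j) {m : ℕ} (A : Matrix (Fin m) (Fin m) R₁)
    (B : Matrix (Fin m) (Fin m) R₂) :
    (joinMatrix j A B).map f₁ = A ∧ (joinMatrix j A B).map f₂ = B :=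
  ⟨by ext i k; exact h.fst _, by ext i k; exact h.snd _⟩

theorem IsProduct.joinMatrix_mul_eq_one (h : IsProduct f₁ f₂ j) {m : ℕ} (g : GL (Fin m) R₁)
    (g' : GL (Fin m) R₂) :
    joinMatrix j g.val g'.val * joinMatrix j (g⁻¹).val (g'⁻¹).val = 1 := by
  refine h.matrix_ext ?_ ?_
  · rw [Matrix.map_mul, (h.map_joinMatrix _ _).1, (h.map_joinMatrix _ _).1,
      Matrix.map_one _ (map_zero _) (map_one _), ← Units.val_mul, mul_inv_cancel, Units.val_one]
  · rw [Matrix.map_mul, (h.map_joinMatrix _ _).2, (h.map_joinMatrix _ _).2,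
      Matrix.map_one _ (map_zero _) (map_one _), ← Units.val_mul, mul_inv_cancel, Units.val_one]

/-- The invertible matrix with given components. -/
def IsProduct.join (h : IsProduct f₁ f₂ j) {m : ℕ} (g : GL (Fin m) R₁) (g' : GL (Fin m) R₂) :
    GL (Fin m) R :=
  ⟨joinMatrix j g.val g'.val, joinMatrix j (g⁻¹).val (g'⁻¹).val, h.joinMatrix_mul_eq_one g g', by
    have := h.joinMatrix_mul_eq_one g⁻¹ g'⁻¹
    rwa [inv_inv, inv_inv] at this⟩

theorem IsProduct.map_join (h : IsProduct f₁ f₂ j) {m : ℕ} (g : GL (Fin m) R₁)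
    (g' : GL (Fin m) R₂) : GeneralLinearGroup.map f₁ (h.join g g') = g ∧
      GeneralLinearGroup.map f₂ (h.join g g') = g' :=
  ⟨Units.ext (h.map_joinMatrix _ _).1, Units.ext (h.map_joinMatrix _ _).2⟩

variable [TopologicalSpace R] [TopologicalSpace R₁] [TopologicalSpace R₂]

/-- The decomposition of the stabilizer over a product of two rings. -/
def IsProduct.stabEquiv (h : IsProduct f₁ f₂ j) (h₁ : Continuous f₁) (h₂ : Continuous f₂)
    (hj : Continuous j) (γ : LeviType N) (x : GL (Fin (2 * N)) R) :
    stab γ x ≃ₜ* stab γ (GeneralLinearGroup.map f₁ x) × stab γ (GeneralLinearGroup.map f₂ x) where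
  toFun g := (⟨_, map_mem_stab f₁ g.2⟩, ⟨_, map_mem_stab f₂ g.2⟩)
  invFun p := ⟨h.join p.1.1 p.2.1, h.mem_stab ((h.map_join _ _).1.symm ▸ p.1.2)
    ((h.map_join _ _).2.symm ▸ p.2.2)⟩
  left_inv g := Subtype.ext (h.ext (h.map_join _ _).1 (h.map_join _ _).2)
  right_inv p := Prod.ext (Subtype.ext (h.map_join _ _).1) (Subtype.ext (h.map_join _ _).2)
  map_mul' g g' := Prod.ext (Subtype.ext (map_mul _ _ _)) (Subtype.ext (map_mul _ _ _))
  continuous_toFun := by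
    refine Continuous.prodMk (Continuous.subtype_mk ?_ _) (Continuous.subtype_mk ?_ _)
    · exact (continuous_map_GL f₁ h₁).comp continuous_subtype_val
    · exact (continuous_map_GL f₂ h₂).comp continuous_subtype_val
  continuous_invFun := by
    have c1 : Continuous fun p : stab γ (GeneralLinearGroup.map f₁ x) ×
        stab γ (GeneralLinearGroup.map f₂ x) => p.1.1 :=
      continuous_subtype_val.comp continuous_fst
    have c2 : Continuous fun p : stab γ (GeneralLinearGroup.map f₁ x) ×
        stab γ (GeneralLinearGroup.map f₂ x) => p.2.1 :=
      continuous_subtype_val.comp continuous_snd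
    refine Continuous.subtype_mk (Units.continuous_iff.2 ⟨?_, ?_⟩) _
    · refine continuous_matrix fun i k => hj.comp (Continuous.prodMk ?_ ?_)
      · exact (Units.continuous_val.comp c1).matrix_elem i k
      · exact (Units.continuous_val.comp c2).matrix_elem i k
    · refine continuous_matrix fun i k => hj.comp (Continuous.prodMk ?_ ?_)
      · exact (Units.continuous_coe_inv.comp c1).matrix_elem i k
      · exact (Units.continuous_coe_inv.comp c2).matrix_elem i k

end Products

/-! ### The adeles as the product of `F ⊗ ℝ` and the finite adeles -/

section AdelicProduct

variable (F : Type*) [Field F] [NumberField F]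

/-- The projection of the adeles to the archimedean component. -/
def toMixed : Adele F →+* mixedEmbedding.mixedSpace F :=
  ((InfiniteAdeleRing.ringEquiv_mixedSpace F : _ ≃+* _).toRingHom).comp
    (RingHom.fst (InfiniteAdeleRing F) (FiniteAdeleRing (𝓞 F) F))

/-- The projection of the adeles to the finite adeles. -/
def toFinite : Adele F →+* FiniteAdeleRing (𝓞 F) F :=
  RingHom.snd (InfiniteAdeleRing F) (FiniteAdeleRing (𝓞 F) F)

/-- The adele with given components. -/
def ofComponents (p : mixedEmbedding.mixedSpace F × FiniteAdeleRing (𝓞 F) F) : Adele F :=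
  ((InfiniteAdeleRing.ringEquiv_mixedSpace F).symm p.1, p.2)

theorem isProduct_adele : IsProduct (toMixed F) (toFinite F) (ofComponents F) where
  fst p := (InfiniteAdeleRing.ringEquiv_mixedSpace F).apply_symm_apply p.1
  snd _ := rfl
  eta r := Prod.ext ((InfiniteAdeleRing.ringEquiv_mixedSpace F).symm_apply_apply r.1) rfl

theorem continuous_ringEquiv_mixedSpace (F : Type*) [Field F] :
    Continuous (InfiniteAdeleRing.ringEquiv_mixedSpace F) := by
  refine Continuous.prodMk (continuous_pi fun v => ?_) (continuous_pi fun v => ?_)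
  · exact (InfinitePlace.Completion.isometry_extensionEmbeddingOfIsReal v.2).continuous.comp
      (continuous_apply v.1)
  · exact (InfinitePlace.Completion.isometry_extensionEmbedding v.1).continuous.comp
      (continuous_apply v.1)

theorem continuous_ringEquiv_mixedSpace_symm (F : Type*) [Field F] :
    Continuous (InfiniteAdeleRing.ringEquiv_mixedSpace F).symm := by
  refine continuous_pi fun v => ?_
  have key := fun y => (InfiniteAdeleRing.ringEquiv_mixedSpace F).apply_symm_apply y
  by_cases hv : v.IsReal
  · have h : (fun y => (InfiniteAdeleRing.ringEquiv_mixedSpace F).symm y v) =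
        fun y => (InfinitePlace.Completion.isometryEquivRealOfIsReal hv).symm (y.1 ⟨v, hv⟩) := by
      funext y
      rw [IsometryEquiv.eq_symm_apply]
      exact congrFun (congrArg Prod.fst (key y)) ⟨v, hv⟩
    rw [h]
    exact (IsometryEquiv.continuous _).comp ((continuous_apply _).comp continuous_fst)
  · have hv' := InfinitePlace.not_isReal_iff_isComplex.1 hv
    have h : (fun y => (InfiniteAdeleRing.ringEquiv_mixedSpace F).symm y v) =
        fun y => (InfinitePlace.Completion.isometryEquivComplexOfIsComplex hv').symm
          (y.2 ⟨v, hv'⟩) := by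
      funext y
      rw [IsometryEquiv.eq_symm_apply]
      exact congrFun (congrArg Prod.snd (key y)) ⟨v, hv'⟩
    rw [h]
    exact (IsometryEquiv.continuous _).comp ((continuous_apply _).comp continuous_snd)

theorem continuous_toMixed : Continuous (toMixed F) :=
  (continuous_ringEquiv_mixedSpace F).comp continuous_fst

theorem continuous_toFinite : Continuous (toFinite F) := continuous_snd

theorem continuous_ofComponents : Continuous (ofComponents F) :=
  ((continuous_ringEquiv_mixedSpace_symm F).comp continuous_fst).prodMk continuous_snd

theorem toMixed_realToAdele (y : ℝ) :
    toMixed F (realToAdele F y) = algebraMap ℝ (mixedEmbedding.mixedSpace F) y :=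
  (InfiniteAdeleRing.ringEquiv_mixedSpace F).apply_symm_apply _

theorem toFinite_realToAdele (y : ℝ) : toFinite F (realToAdele F y) = 1 := rfl

end AdelicProduct

/-! ### The exponent of the modulus, and reduction to the archimedean factor -/

section AdelicModulus

variable {N : ℕ}

/-- The block of the first half of the coordinates which contains a position. -/
def blk (γ : LeviType N) (h : γ.rk = 0) (i : Fin N) : Fin γ.k := ⟨γ.block (lo i), block_lo_lt γ h i⟩

theorem AMEntry_block_lo (γ : LeviType N) (h : γ.rk = 0) (y : Fin γ.k → ℝ) (i : Fin N) :
    AMEntry γ y (γ.block (lo i)) = y (blk γ h i) := by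
  rw [AMEntry, dif_pos (block_lo_lt γ h i)]
  rfl

theorem AMEntry_block_hi (γ : LeviType N) (h : γ.rk = 0) (y : Fin γ.k → ℝ) (i : Fin N) :
    AMEntry γ y (γ.block (hi i)) = (y (blk γ h i))⁻¹ := by
  have h1 := block_lo_lt γ h i
  have h2 := block_hi γ h i
  rw [AMEntry, dif_neg (by omega), dif_pos (by omega)]
  congr 2
  apply Fin.ext
  simp only [blk]
  omega

/-- Weights constant on the fibres see only the sums over the fibres; this is what allows the
diagonal of `ξ` to be replaced by integers with the same block traces. -/
theorem sum_smul_eq_of_fiber {K : Type*} [AddCommGroup K] [Module ℝ K] (lb : Fin N → ℕ)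
    (u v : Fin N → K) (huv : ∀ c, ∑ i with lb i = c, u i = ∑ i with lb i = c, v i) (g : Fin N → ℝ)
    (hg : ∀ i j, lb i = lb j → g i = g j) : ∑ i, g i • u i = ∑ i, g i • v i := by
  rw [← Finset.sum_fiberwise_of_maps_to (g := lb) (t := Finset.univ.image lb)
      (fun i _ => Finset.mem_image_of_mem lb (Finset.mem_univ i)),
    ← Finset.sum_fiberwise_of_maps_to (g := lb) (t := Finset.univ.image lb)
      (fun i _ => Finset.mem_image_of_mem lb (Finset.mem_univ i))]
  refine Finset.sum_congr rfl fun c hc => ?_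
  obtain ⟨i₀, -, rfl⟩ := Finset.mem_image.1 hc
  have key : ∀ f : Fin N → K, ∑ i with lb i = lb i₀, g i • f i =
      g i₀ • ∑ i with lb i = lb i₀, f i := fun f => by
    rw [Finset.smul_sum]
    refine Finset.sum_congr rfl fun i hi => ?_
    rw [hg i i₀ (Finset.mem_filter.1 hi).2]
  rw [key, key, huv]

/-- The exponent of the modulus function: `w` are the logarithms of the entries of an element of
the torus, constant on the blocks `lb`, and `t` are integers with the same sums over the blocks as
the diagonal entries of the involution. -/
def modExponent (lb : Fin N → ℕ) (w : Fin N → ℝ) (t : Fin N → ℤ) : ℝ :=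
  ∑ i, ∑ j, ((if lb i < lb j then (w i - w j) / 2 else 0) * (1 + t i * t j)) +
    ∑ i, ∑ j, ((w i + w j) / 4 * (1 + (if i = j then 2 else 0) + t i * t j))

/-- Both sums with `ξ i i * ξ j j` depend only on block traces, one variable at a time. The sum with
`ξ i j * ξ j i` collapses to diagonal entries of `ξ² = 1`, and joins the contribution of the
identity matrix in the term `2` at `i = j`. -/
theorem algebraMap_modExponent {K : Type*} [CommRing K] [Algebra ℝ K]
    (lb : Fin N → ℕ) (w : Fin N → ℝ) (hw : ∀ i j, lb i = lb j → w i = w j) (t : Fin N → ℤ)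
    (ξ : Matrix (Fin N) (Fin N) K) (hξ : ∀ i j, lb i ≠ lb j → ξ i j = 0) (hξξ : ξ * ξ = 1)
    (ht : ∀ c, ∑ i with lb i = c, ξ i i = ∑ i with lb i = c, (t i : K)) :
    algebraMap ℝ K (modExponent lb w t) =
      ∑ i, ∑ j, (if lb i < lb j then (w i - w j) / 2 else 0) • (1 + ξ i i * ξ j j) +
      ∑ i, ∑ j, ((w i + w j) / 4) •
        (1 + (1 : Matrix (Fin N) (Fin N) K) i j + ξ i i * ξ j j + ξ i j * ξ j i) := by
  have key : ∀ f : Fin N → Fin N → ℝ, (∀ i j k, lb j = lb k → f i j = f i k) →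
      (∀ i j k, lb i = lb j → f i k = f j k) →
      ∑ i, ∑ j, f i j • (ξ i i * ξ j j) = ∑ i, ∑ j, f i j • ((t i : K) * t j) := by
    intro f h1 h2
    have e1 : ∀ i, ∑ j, f i j • (ξ i i * ξ j j) = ∑ j, f i j • (ξ i i * (t j : K)) := by
      intro i
      simp only [← mul_smul_comm, ← Finset.mul_sum]
      rw [sum_smul_eq_of_fiber lb _ _ ht (f i) (h1 i)]
    have e2 : ∀ j, ∑ i, f i j • (ξ i i * (t j : K)) = ∑ i, f i j • ((t i : K) * t j) := by
      intro j
      simp only [← smul_mul_assoc, ← Finset.sum_mul]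
      rw [sum_smul_eq_of_fiber lb _ _ ht (fun i => f i j) (fun i k h => h2 i k j h)]
    simp only [e1]
    rw [Finset.sum_comm]
    simp only [e2]
    rw [Finset.sum_comm]
  have k1 := key (fun i j => if lb i < lb j then (w i - w j) / 2 else 0)
    (fun i j k h => by simp only [h, hw j k h]) (fun i j k h => by simp only [h, hw i j h])
  have k2 := key (fun i j => (w i + w j) / 4)
    (fun i j k h => by simp only [hw j k h]) (fun i j k h => by simp only [hw i j h])
  have k3 : ∑ i, ∑ j, ((w i + w j) / 4) • (ξ i j * ξ j i) =
      ∑ i, ∑ j, ((w i + w j) / 4) • (1 : Matrix (Fin N) (Fin N) K) i j := by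
    refine Finset.sum_congr rfl fun i _ => ?_
    have e1 : ∀ j, ((w i + w j) / 4) • (ξ i j * ξ j i) = (w i / 2) • (ξ i j * ξ j i) := by
      intro j
      by_cases h : lb i = lb j
      · rw [hw i j h]
        congr 1
        ring
      · rw [hξ i j h, zero_mul, smul_zero, smul_zero]
    have e2 : ∑ j, ((w i + w j) / 4) • (1 : Matrix (Fin N) (Fin N) K) i j = (w i / 2) • 1 := by
      rw [Finset.sum_eq_single_of_mem i (Finset.mem_univ i) (fun j _ hj => by
        rw [Matrix.one_apply_ne hj.symm, smul_zero]), Matrix.one_apply_eq]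
      congr 1
      ring
    rw [e2]
    simp only [e1]
    rw [← Finset.smul_sum, ← Matrix.mul_apply, hξξ, Matrix.one_apply_eq]
  simp only [smul_add, Finset.sum_add_distrib]
  rw [k1, k2, k3]
  simp only [← Finset.sum_add_distrib, modExponent, map_add, map_sum, map_mul]
  refine Finset.sum_congr rfl fun i _ => Finset.sum_congr rfl fun j _ => ?_
  simp only [Algebra.smul_def, map_intCast, map_one]
  by_cases h : i = j
  · subst h
    simp only [if_true, Matrix.one_apply_eq, map_ofNat]
    ring
  · simp only [h, if_false, Matrix.one_apply_ne h, map_zero]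
    ring

/-- The elements of the torus `A_M`, over a ring with a multiplicative map from `ℝ`. -/
theorem exists_diagonal_siegel {K : Type*} [CommRing K] (φ : ℝ →* K) (γ : LeviType N)
    (h : γ.rk = 0) (y : Fin γ.k → ℝ) (hy : ∀ i, 0 < y i) :
    ∃ d : GL (Fin N) K, d.val = diagonal (fun i => φ (y (blk γ h i))) ∧
      (siegel d 0).val = diagonal fun j => φ (AMEntry γ y (γ.block j)) := by
  have hd' : (diagonal fun i => φ (y (blk γ h i))) * (diagonal fun i => φ (y (blk γ h i))⁻¹) =
      (1 : Matrix (Fin N) (Fin N) K) := by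
    rw [diagonal_mul_diagonal, ← diagonal_one]
    congr 1
    funext i
    rw [← map_mul, mul_inv_cancel₀ (hy _).ne', map_one]
  let d : GL (Fin N) K := ⟨diagonal fun i => φ (y (blk γ h i)),
    diagonal fun i => φ (y (blk γ h i))⁻¹, hd', mul_eq_one_comm.1 hd'⟩
  refine ⟨d, rfl, ?_⟩
  have hdv : d.val = diagonal fun i => φ (y (blk γ h i)) := rfl
  have hdi : (d⁻¹).val = diagonal fun i => φ (y (blk γ h i))⁻¹ := rfl
  have hlh : ∀ i j : Fin N, lo i ≠ hi j := fun i j h' => by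
    have := congrArg Fin.val h'
    simp only [lo, hi] at this
    omega
  ext p q
  obtain ⟨i, rfl⟩ | ⟨i, rfl⟩ := lo_or_hi p <;> obtain ⟨j, rfl⟩ | ⟨j, rfl⟩ := lo_or_hi q
  · rw [siegel_lo_lo]
    by_cases hij : i = j
    · subst hij
      rw [diagonal_apply_eq, AMEntry_block_lo γ h, hdv, diagonal_apply_eq]
    · have hne : lo i ≠ lo j := fun h' => hij (Fin.ext (Fin.mk.inj h'))
      rw [diagonal_apply_ne _ hne, hdv, diagonal_apply_ne _ hij]
  · rw [siegel_lo_hi, diagonal_apply_ne _ (hlh i j), Matrix.zero_mul]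
    rfl
  · rw [siegel_hi_lo, diagonal_apply_ne _ (hlh j i).symm]
  · rw [siegel_hi_hi, hdi]
    by_cases hij : i = j
    · subst hij
      rw [diagonal_apply_eq, diagonal_apply_eq, AMEntry_block_hi γ h]
    · rw [diagonal_apply_ne _ (Ne.symm hij), diagonal_apply_ne]
      intro h'
      have := congrArg Fin.val h'
      simp only [hi] at this
      exact hij (Fin.ext (by omega))

/-- The modulus function of the stabilizer, for an element which is real in one component and
trivial in the other. -/
theorem modularCharacter_of_isProduct {R K R₂ : Type*} [CommRing R] [TopologicalSpace R]
    [IsTopologicalRing R] [NormedCommRing K] [NormedAlgebra ℝ K] [FiniteDimensional ℝ K]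
    [CommRing R₂] [TopologicalSpace R₂] [IsTopologicalRing R₂] [T2Space R₂] [LocallyCompactSpace R₂]
    {f₁ : R →+* K} {f₂ : R →+* R₂} {j : K × R₂ → R} (hj : IsProduct f₁ f₂ j)
    (hf₁ : Continuous f₁) (hf₂ : Continuous f₂) (hjc : Continuous j)
    {γ : LeviType N} (h : γ.rk = 0) (x : GL (Fin (2 * N)) R) [LocallyCompactSpace (stab γ x)]
    (ξ : GL (Fin N) K) (hx : GeneralLinearGroup.map f₁ x = siegel ξ 0)
    {lb : Fin N → ℕ} (hβ : ∀ i j, lb i < lb j → γ.block (lo i) < γ.block (lo j))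
    (hξ : ∀ i j, lb i ≠ lb j → ξ.val i j = 0) (hξξ : ξ.val * ξ.val = 1) (t : Fin N → ℤ)
    (ht : ∀ c, ∑ i with lb i = c, ξ.val i i = ∑ i with lb i = c, (t i : K))
    (y : Fin γ.k → ℝ) (hy : ∀ i, 0 < y i)
    (hyb : ∀ i j, lb i = lb j → y (blk γ h i) = y (blk γ h j)) (a : stab γ x)
    (ha₁ : a.1.val.map f₁ = diagonal fun j => algebraMap ℝ K (AMEntry γ y (γ.block j)))
    (ha₂ : a.1.val.map f₂ = 1) :
    (Measure.modularCharacter a : ℝ) = Real.exp (Module.finrank ℝ K *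
      modExponent lb (fun i => Real.log (y (blk γ h i))) t) := by
  have : ProperSpace K := FiniteDimensional.proper ℝ K
  have l1 : LocallyCompactSpace (stab γ (GeneralLinearGroup.map f₁ x)) :=
    locallyCompactSpace_stab γ _
  have l2 : LocallyCompactSpace (stab γ (GeneralLinearGroup.map f₂ x)) :=
    locallyCompactSpace_stab γ _
  let e := hj.stabEquiv hf₁ hf₂ hjc γ x
  -- The element is trivial in the second component, so only the modulus of the first factor counts.
  have he : e a = ((e a).1, 1) := Prod.ext rfl (Subtype.ext (Units.ext ha₂))
  have h1 : Measure.modularCharacter a = Measure.modularCharacter (e a).1 := by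
    rw [← modularCharacter_of_prod e, ← he, ContinuousMulEquiv.symm_apply_apply]
  rw [h1]
  clear h1 he
  have hval : (e a).1.1.val = diagonal fun j => algebraMap ℝ K (AMEntry γ y (γ.block j)) := ha₁
  revert hval
  generalize (e a).1 = b
  clear e
  -- Rewriting `x` by its Siegel form changes the ambient group, hence also its elements and its
  -- local compactness instance.
  revert l1 b
  rw [hx]
  intro l1 b hval
  obtain ⟨d, hd, hds⟩ := exists_diagonal_siegel (algebraMap ℝ K : ℝ →* K) γ h y hy
  have hbd : b.1 = siegel d 0 := Units.ext (hval.trans hds.symm)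
  have hwb : ∀ i j, lb i = lb j → Real.log (y (blk γ h i)) = Real.log (y (blk γ h j)) :=
    fun i j hij => by rw [hyb i j hij]
  refine modularCharacter_stab h hβ hξ hξξ hwb b d ?_ hbd _
    (algebraMap_modExponent lb _ hwb t _ hξ hξξ ht)
  simp only [Real.exp_log (hy _)]
  exact hd

end AdelicModulus

/-! ### The adelic modulus on `A_M` -/

section AdelicModulus

variable {N : ℕ}
variable {F : Type*} [Field F] [NumberField F]

theorem toAdelic_siegel (ξ : GL (Fin N) F) :
    toAdelic (siegel ξ 0) =
      siegel (GeneralLinearGroup.map (algebraMap F (Adele F)) ξ) 0 := by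
  rw [toAdelic, map_siegel, Matrix.map_zero _ (map_zero _)]

open scoped Classical in
/-- The modulus function of the stabilizer on `A_M`. -/
theorem modularCharacter_adelic {γ : LeviType N} (h : γ.rk = 0) (ξ : GL (Fin N) F)
    [LocallyCompactSpace (stab γ (toAdelic (siegel ξ 0)))]
    {lb : Fin N → ℕ} (hβ : ∀ i j, lb i < lb j → γ.block (lo i) < γ.block (lo j))
    (hξ : ∀ i j, lb i ≠ lb j → ξ.val i j = 0) (hξξ : ξ.val * ξ.val = 1) (t : Fin N → ℤ)
    (ht : ∀ c, ∑ i with lb i = c, ξ.val i i = ∑ i with lb i = c, (t i : F))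
    (y : Fin γ.k → ℝ) (hy : ∀ i, 0 < y i)
    (hyb : ∀ i j, lb i = lb j → y (blk γ h i) = y (blk γ h j))
    (a : stab γ (toAdelic (siegel ξ 0)))
    (ha : a.1.val = diagonal fun j => realToAdele F (AMEntry γ y (γ.block j))) :
    (Measure.modularCharacter a : ℝ) = Real.exp (Module.finrank ℚ F *
      modExponent lb (fun i => Real.log (y (blk γ h i))) t) := by
  have hφ : ∀ i j, (GeneralLinearGroup.map ((toMixed F).comp (algebraMap F (Adele F))) ξ).val i j =
      ((toMixed F).comp (algebraMap F (Adele F))) (ξ.val i j) := fun i j => rfl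
  have hξξ' : ξ * ξ = 1 := Units.ext hξξ
  -- The degree of `F` enters as the real dimension of `F ⊗ ℝ`.
  rw [← mixedEmbedding.finrank F]
  refine modularCharacter_of_isProduct (isProduct_adele F) (continuous_toMixed F)
    (continuous_toFinite F) (continuous_ofComponents F) h (toAdelic (siegel ξ 0))
    (GeneralLinearGroup.map ((toMixed F).comp (algebraMap F (Adele F))) ξ) ?_ hβ
    (fun i j hij => by rw [hφ, hξ i j hij, map_zero]) ?_ t (fun c => ?_) y hy hyb a ?_ ?_
  · rw [toAdelic_siegel, map_siegel, Matrix.map_zero _ (map_zero _)]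
    rfl
  · rw [← Units.val_mul, ← map_mul, hξξ', map_one, Units.val_one]
  · have := congrArg ((toMixed F).comp (algebraMap F (Adele F))) (ht c)
    rw [map_sum, map_sum] at this
    simpa only [map_intCast, hφ] using this
  · rw [ha, Matrix.diagonal_map (map_zero _)]
    simp only [toMixed_realToAdele]
  · rw [ha, Matrix.diagonal_map (map_zero _)]
    simp only [toFinite_realToAdele]
    exact Matrix.diagonal_one

end AdelicModulus

/-! ## The map `H_M` and the modulus functions on `A_M` -/

section Heights

variable {F : Type*} [Field F] [NumberField F] {N : ℕ}

/-- The real or complex embedding of each completion is isometric and takes the component at that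
place back to `y`. -/
theorem norm_realToInfiniteAdele (F : Type*) [Field F] (y : ℝ) (v : InfinitePlace F) :
    ‖realToInfiniteAdele F y v‖ = |y| := by
  have key := (InfiniteAdeleRing.ringEquiv_mixedSpace F).apply_symm_apply
    (algebraMap ℝ (mixedEmbedding.mixedSpace F) y)
  by_cases hv : v.IsReal
  · have h1 : InfinitePlace.Completion.extensionEmbeddingOfIsReal hv (realToInfiniteAdele F y v) =
        y := congrFun (congrArg Prod.fst key) ⟨v, hv⟩
    rw [← (InfinitePlace.Completion.isometry_extensionEmbeddingOfIsReal hv).norm_map_of_map_zero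
      (map_zero _), h1, Real.norm_eq_abs]
  · have hv' := InfinitePlace.not_isReal_iff_isComplex.1 hv
    have h1 : InfinitePlace.Completion.extensionEmbedding v (realToInfiniteAdele F y v) =
        (y : ℂ) := congrFun (congrArg Prod.snd key) ⟨v, hv'⟩
    rw [← (InfinitePlace.Completion.isometry_extensionEmbedding v).norm_map_of_map_zero
      (map_zero _), h1, Complex.norm_real, Real.norm_eq_abs]

theorem adelicAbs_realToAdele_pow (y : ℝ) (m : ℕ) :
    adelicAbs (realToAdele F y ^ m) = |y| ^ (Module.finrank ℚ F * m) := by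
  have h1 : ∀ v : InfinitePlace F, ‖(realToAdele F y ^ m).1 v‖ = |y| ^ m := fun v => by
    change ‖realToInfiniteAdele F y v ^ m‖ = _
    rw [norm_pow, norm_realToInfiniteAdele F]
  have h2 : ∀ v : HeightOneSpectrum (𝓞 F), ‖(realToAdele F y ^ m).2 v‖ = 1 := fun v => by
    have : (realToAdele F y ^ m).2 v = (1 : v.adicCompletion F) ^ m := rfl
    rw [this, one_pow, norm_one]
  rw [adelicAbs]
  simp only [h1, h2, finprod_one, mul_one, ← pow_mul]
  rw [Finset.prod_pow_eq_pow_sum, ← Finset.mul_sum, InfinitePlace.sum_mult_eq, mul_comm]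

/-- The positions in a block of the first half are the positions in the full block. -/
def blockEquiv (γ : LeviType N) (h : γ.rk = 0) (t : ℕ) (ht : t < γ.k) :
    {i : Fin N // γ.block (lo i) = t} ≃ {j : Fin (2 * N) // γ.block j = t} where
  toFun i := ⟨lo i.1, i.2⟩
  invFun j := ⟨⟨j.1.val, by
    obtain ⟨i, hi'⟩ | ⟨i, hi'⟩ := lo_or_hi j.1
    · rw [hi']
      exact i.2
    · exfalso
      have h1 := block_hi γ h i
      have h2 := block_lo_lt γ h i
      have h3 := j.2
      rw [hi'] at h3
      omega⟩, j.2⟩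
  left_inv _ := rfl
  right_inv _ := rfl

theorem det_diagBlock_siegel {R : Type*} [CommRing R] (γ : LeviType N) (h : γ.rk = 0)
    (α : GL (Fin N) R) (t : ℕ) (ht : t < γ.k) :
    (diagBlock γ (siegel α 0) t).det =
      (α.val.submatrix (Subtype.val : {i : Fin N // γ.block (lo i) = t} → Fin N)
        Subtype.val).det := by
  rw [← det_submatrix_equiv_self (blockEquiv γ h t ht)]
  congr 1
  ext i j
  exact siegel_lo_lo α 0 i.1 j.1

theorem HM_of_mem_AM (γ : LeviType N) (h : γ.rk = 0) (y : Fin γ.k → ℝ) (hy : ∀ i, 0 < y i)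
    (a : GL (Fin (2 * N)) (Adele F))
    (ha : a.val = diagonal fun j => realToAdele F (AMEntry γ y (γ.block j))) (t : Fin γ.k) :
    HM γ a t = Module.finrank ℚ F *
      (Fintype.card {i : Fin N // γ.block (lo i) = t.val} * Real.log (y t)) := by
  have h1 : diagBlock γ a t.val = diagonal fun _ => realToAdele F (y t) := by
    ext p q
    rw [diagBlock, submatrix_apply, ha]
    by_cases hpq : p = q
    · subst hpq
      rw [diagonal_apply_eq, diagonal_apply_eq, p.2, AMEntry, dif_pos t.2]
    · rw [diagonal_apply_ne _ hpq, diagonal_apply_ne _ fun h' => hpq (Subtype.ext h')]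
  rw [HM, h1, det_diagonal, Finset.prod_const, Finset.card_univ,
    ← Fintype.card_congr (blockEquiv γ h t.val t.2), adelicAbs_realToAdele_pow, abs_of_pos (hy t),
    Real.log_pow]
  push_cast
  ring

/-- The determinant of a scalar block contributes one factor per position of the block, so the
pairing becomes a sum over positions. The common factor, the degree of `F`, is the one in the
exponents of the modulus functions and cancels later. -/
theorem pairing_of_mem_AM (γ : LeviType N) (h : γ.rk = 0) (y : Fin γ.k → ℝ) (hy : ∀ i, 0 < y i)
    (a : GL (Fin (2 * N)) (Adele F))
    (ha : a.val = diagonal fun j => realToAdele F (AMEntry γ y (γ.block j))) (lam : Fin γ.k → ℝ) :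
    pairing γ lam a = Module.finrank ℚ F *
      ∑ i, lam (blk γ h i) * Real.log (y (blk γ h i)) := by
  rw [pairing, ← Finset.sum_fiberwise Finset.univ (blk γ h), Finset.mul_sum]
  refine Finset.sum_congr rfl fun t _ => ?_
  have h1 : ∑ i with blk γ h i = t, lam (blk γ h i) * Real.log (y (blk γ h i)) =
      ∑ i with blk γ h i = t, lam t * Real.log (y t) :=
    Finset.sum_congr rfl fun i hi => by rw [(Finset.mem_filter.1 hi).2]
  have h2 : Fintype.card {i : Fin N // γ.block (lo i) = t.val} =
      (Finset.univ.filter fun i => blk γ h i = t).card := by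
    rw [Fintype.card_subtype]
    congr 1
    ext i
    simp only [Finset.mem_filter, Finset.mem_univ, true_and]
    exact ⟨fun h' => Fin.ext h', fun h' => congrArg Fin.val h'⟩
  rw [h1, Finset.sum_const, HM_of_mem_AM γ h y hy a ha, h2, nsmul_eq_mul]
  ring

theorem modularCharacter_subgroup_congr {G : Type*} [Group G] [TopologicalSpace G]
    [IsTopologicalGroup G] {H H' : Subgroup G} (e : H = H') [LocallyCompactSpace H]
    [LocallyCompactSpace H'] (a : H) (a' : H') (ha : a.1 = a'.1) :
    Measure.modularCharacter a = Measure.modularCharacter a' := by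
  subst e
  rw [Subtype.ext ha]

theorem deltaPx_siegel {γ : LeviType N} (h : γ.rk = 0) (ξ : GL (Fin N) F)
    {lb : Fin N → ℕ} (hβ : ∀ i j, lb i < lb j → γ.block (lo i) < γ.block (lo j))
    (hξ : ∀ i j, lb i ≠ lb j → ξ.val i j = 0) (hξξ : ξ.val * ξ.val = 1) (t : Fin N → ℤ)
    (ht : ∀ c, ∑ i with lb i = c, ξ.val i i = ∑ i with lb i = c, (t i : F))
    (y : Fin γ.k → ℝ) (hy : ∀ i, 0 < y i)
    (hyb : ∀ i j, lb i = lb j → y (blk γ h i) = y (blk γ h j))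
    (a : parabolicStab γ (siegel ξ 0))
    (ha : a.1.val = diagonal fun j => realToAdele F (AMEntry γ y (γ.block j))) :
    deltaPx γ (siegel ξ 0) a = Real.exp (Module.finrank ℚ F *
      modExponent lb (fun i => Real.log (y (blk γ h i))) t) := by
  have : LocallyCompactSpace (stab γ (toAdelic (siegel ξ 0))) :=
    instLocallyCompactParabolicStab γ (siegel ξ 0)
  exact modularCharacter_adelic h ξ hβ hξ hξξ t ht y hy hyb a ha

theorem siegel_one_zero {R : Type*} [CommRing R] : siegel (1 : GL (Fin N) R) 0 = 1 := by
  have h1 := siegel_mul (1 : GL (Fin N) R) 1 0 0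
  rw [one_mul, Matrix.mul_zero, Matrix.zero_mul, add_zero] at h1
  exact mul_eq_left.1 h1

/-- `P` is its own centralizer subgroup for `x = 1`, so the formula for stabilizers applies with `ξ
= 1`, all `t i = 1`, and the blocks of `M` themselves as `lb`. -/
theorem deltaP_of_mem_AM {γ : LeviType N} (h : γ.rk = 0) (y : Fin γ.k → ℝ) (hy : ∀ i, 0 < y i)
    (a : parabolic γ (Adele F))
    (ha : a.1.val = diagonal fun j => realToAdele F (AMEntry γ y (γ.block j))) :
    deltaP F γ a = Real.exp (Module.finrank ℚ F *
      modExponent (fun i => γ.block (lo i)) (fun i => Real.log (y (blk γ h i))) fun _ => 1) := by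
  have h1 : parabolic γ (Adele F) = parabolicStab γ (siegel (1 : GL (Fin N) F) 0) := by
    have : toAdelic (1 : GL (Fin (2 * N)) F) = 1 := map_one _
    rw [parabolicStab, siegel_one_zero, this]
    refine (inf_eq_left.2 fun g _ => ?_).symm
    rw [Subgroup.mem_centralizer_singleton_iff, one_mul, mul_one]
  rw [deltaP, modularCharacter_subgroup_congr h1 a ⟨a.1, h1 ▸ a.2⟩ rfl]
  refine deltaPx_siegel h 1 (fun i j hij => hij)
    (fun i j hij => Matrix.one_apply_ne fun h' => hij (by rw [h'])) (one_mul _) (fun _ => 1)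
    (fun c => ?_) y hy (fun i j hij => ?_) ⟨a.1, h1 ▸ a.2⟩ ha
  · simp
  · rw [show blk γ h i = blk γ h j from Fin.ext hij]

/-- If `x` permutes the blocks of `M`, then so does its action on `H_M`. -/
theorem HM_conj {γ : LeviType N} (h : γ.rk = 0) (ξ : GL (Fin N) F) (hξξ : ξ.val * ξ.val = 1)
    (σ : Fin γ.k → Fin γ.k) (hσ : ∀ i j, ξ.val i j ≠ 0 → blk γ h j = σ (blk γ h i))
    (hσσ : ∀ t, σ (σ t) = t) (m : GL (Fin (2 * N)) (Adele F)) (hm : m ∈ levi γ (Adele F))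
    (t : Fin γ.k) :
    HM γ (toAdelic (siegel ξ 0) * m * (toAdelic (siegel ξ 0))⁻¹) t = HM γ m (σ t) := by
  obtain ⟨α, hα, rfl⟩ := (mem_levi_iff γ h m).1 hm
  set Ξ := GeneralLinearGroup.map (algebraMap F (Adele F)) ξ with hΞ
  have hξξ' : ξ * ξ = 1 := Units.ext hξξ
  have hΞΞ : Ξ * Ξ = 1 := by rw [hΞ, ← map_mul, hξξ', map_one]
  have hΞ0 : ∀ i j, blk γ h j ≠ σ (blk γ h i) → Ξ.val i j = 0 := fun i j hij => by
    change algebraMap F (Adele F) (ξ.val i j) = 0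
    rw [not_not.1 fun h' => hij (hσ i j h'), map_zero]
  have h1 : toAdelic (siegel ξ 0) * siegel α 0 * (toAdelic (siegel ξ 0))⁻¹ =
      siegel (Ξ * α * Ξ) 0 := by
    have h2 : siegel Ξ 0 * siegel Ξ 0 = 1 := by
      rw [siegel_mul, hΞΞ, Matrix.mul_zero, Matrix.zero_mul, add_zero, siegel_one_zero]
    rw [toAdelic_siegel, ← hΞ, inv_eq_of_mul_eq_one_right h2, siegel_mul, siegel_mul]
    simp
  have hα0 : ∀ i j, blk γ h i ≠ blk γ h j → α.val i j = 0 := fun i j hij =>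
    hα i j fun h' => hij (Fin.ext h')
  rw [HM, HM, h1, det_diagBlock_siegel γ h _ _ t.2, det_diagBlock_siegel γ h _ _ (σ t).2]
  congr 2
  let p := fun (s : Fin γ.k) => (Subtype.val : {i : Fin N // γ.block (lo i) = s.val} → Fin N)
  have hp : ∀ s i, blk γ h (p s i) = s := fun s i => Fin.ext i.2
  -- If the row block `r` of `A` is supported in the column block `s`, only `s` contributes to the
  -- intermediate sum.
  have hsub : ∀ (A B : Matrix (Fin N) (Fin N) (Adele F)) (r s u : Fin γ.k),
      (∀ i j, blk γ h i = r → blk γ h j ≠ s → A i j = 0) →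
      (A * B).submatrix (p r) (p u) = A.submatrix (p r) (p s) * B.submatrix (p s) (p u) := by
    intro A B r s u hA
    ext i j
    rw [submatrix_apply, Matrix.mul_apply, Matrix.mul_apply]
    simp only [submatrix_apply]
    refine (Finset.sum_of_injOn (p s) Subtype.val_injective.injOn (fun _ _ => by simp)
      (fun l _ hl => ?_) (fun _ _ => rfl)).symm
    rw [hA _ _ (hp r i), zero_mul]
    intro h'
    exact hl ⟨⟨l, congrArg Fin.val h'⟩, by simp, rfl⟩
  -- The diagonal block is conjugated by rectangularly indexed blocks of `Ξ`, which are inverse to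
  -- each other because `Ξ² = 1` (`e2`, `e3`); the determinant is unchanged.
  have e1 : (Ξ * α * Ξ).val.submatrix (p t) (p t) = Ξ.val.submatrix (p t) (p (σ t)) *
      α.val.submatrix (p (σ t)) (p (σ t)) * Ξ.val.submatrix (p (σ t)) (p t) := by
    rw [Units.val_mul, Units.val_mul, Matrix.mul_assoc, hsub _ _ t (σ t) t, hsub _ _ (σ t) (σ t) t,
      Matrix.mul_assoc]
    · intro i j hi hj
      exact hα0 i j (by rw [hi]; exact hj.symm)
    · intro i j hi hj
      exact hΞ0 i j (by rw [hi]; exact hj)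
  have e2 : Ξ.val.submatrix (p (σ t)) (p t) * Ξ.val.submatrix (p t) (p (σ t)) = 1 := by
    rw [← hsub _ _ (σ t) t (σ t) fun i j hi hj => hΞ0 i j (by rw [hi, hσσ]; exact hj),
      ← Units.val_mul, hΞΞ, Units.val_one]
    exact Matrix.submatrix_one _ Subtype.val_injective
  have e3 : Ξ.val.submatrix (p t) (p (σ t)) * Ξ.val.submatrix (p (σ t)) (p t) = 1 := by
    rw [← hsub _ _ t (σ t) t fun i j hi hj => hΞ0 i j (by rw [hi]; exact hj),
      ← Units.val_mul, hΞΞ, Units.val_one]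
    exact Matrix.submatrix_one _ Subtype.val_injective
  exact (congrArg Matrix.det e1).trans (det_conj_of_mul_eq_one e3 e2)

end Heights

/-! ## The vector `ρ_x` in terms of the traces of the blocks -/

section Rho

variable {N : ℕ}

/-- The summands without `t` cancel except on the diagonal, which leaves the `1/2`. Exchanging
indices in the part carrying `w j` collects all coefficients at `w i`: a pair `t i * t j` gets `1`,
`1/2` or `0` according as the block of `j` comes after, equals or comes before that of `i`. Pairs in
different `mb` blocks but the same `lb` block carry weight zero. -/
theorem modExponent_sub (lb mb : Fin N → ℕ) (w : Fin N → ℝ) (hw : ∀ i j, lb i = lb j → w i = w j)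
    (h₁ : ∀ i j, lb i < lb j → mb i < mb j) (h₂ : ∀ i j, mb i < mb j → lb i ≤ lb j)
    (t : Fin N → ℤ) :
    modExponent lb w t - 1 / 2 * modExponent mb w (fun _ => 1) =
      ∑ i, w i * (1 / 2 + t i * ∑ j, (t j : ℝ) * ((if lb i < lb j then 1 else 0) +
        if lb i = lb j then 1 / 2 else 0)) := by
  let P : Fin N → Fin N → ℝ := fun i j =>
    w i * (t i * t j) * ((if lb i < lb j then 1 / 2 else 0) + 1 / 4)
  let Q : Fin N → Fin N → ℝ := fun i j =>
    w j * (t i * t j) * ((if lb i < lb j then -1 / 2 else 0) + 1 / 4)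
  let D : Fin N → Fin N → ℝ := fun i j => if i = j then w i / 2 else 0
  have e1 : modExponent lb w t - 1 / 2 * modExponent mb w (fun _ => 1) =
      ∑ i, ∑ j, (P i j + Q i j + D i j) := by
    simp only [modExponent, mul_add (1 / 2 : ℝ), Finset.mul_sum, ← Finset.sum_add_distrib,
      ← Finset.sum_sub_distrib]
    refine Finset.sum_congr rfl fun i _ => Finset.sum_congr rfl fun j _ => ?_
    have e : (if mb i < mb j then (w i - w j) / 2 else 0) =
        if lb i < lb j then (w i - w j) / 2 else 0 := by
      by_cases hm : mb i < mb j
      · rcases (h₂ i j hm).lt_or_eq with hl | hl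
        · rw [if_pos hm, if_pos hl]
        · rw [if_pos hm, if_neg hl.not_lt, hw i j hl, sub_self, zero_div]
      · rw [if_neg hm, if_neg fun hl => hm (h₁ i j hl)]
    rw [e]
    simp only [P, Q, D]
    by_cases hij : i = j
    · subst hij
      simp only [lt_irrefl, if_false, if_true]
      push_cast
      ring
    · simp only [hij, if_false]
      split_ifs <;> (push_cast; ring)
  have e2 : ∑ i, ∑ j, Q i j = ∑ i, ∑ j, Q j i := Finset.sum_comm
  have e3 : ∀ i, ∑ j, D i j = w i / 2 := fun i => by simp [D]
  rw [e1]
  simp only [Finset.sum_add_distrib]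
  rw [e2]
  simp only [e3, ← Finset.sum_add_distrib]
  refine Finset.sum_congr rfl fun i _ => ?_
  rw [mul_add, add_comm, Finset.mul_sum, Finset.mul_sum]
  congr 1
  · ring
  · refine Finset.sum_congr rfl fun j _ => ?_
    simp only [P, Q]
    rcases lt_trichotomy (lb i) (lb j) with hl | hl | hl
    · rw [if_pos hl, if_neg hl.not_gt, if_pos hl, if_neg hl.ne]
      ring
    · rw [if_neg hl.not_lt, if_neg hl.not_gt, if_neg hl.not_lt, if_pos hl]
      ring
    · rw [if_neg hl.not_gt, if_pos hl, if_neg hl.not_gt, if_neg hl.ne']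
      ring

variable {F : Type*} [Field F] [NumberField F]

variable (F) in
/-- The embedding of the real numbers in the adeles, as a multiplicative map. -/
def realToAdeleHom : ℝ →* Adele F where
  toFun := realToAdele F
  map_one' := by
    rw [realToAdele, map_one]
    rfl
  map_mul' a b := by
    rw [realToAdele, map_mul]
    exact Prod.ext rfl (one_mul _).symm

/-- The eigenspaces, when `x` permutes the blocks of `M`. -/
theorem mem_eigenspace_iff {γ : LeviType N} (h : γ.rk = 0) (ξ : GL (Fin N) F)
    (hξξ : ξ.val * ξ.val = 1) (σ : Fin γ.k → Fin γ.k)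
    (hσ : ∀ i j, ξ.val i j ≠ 0 → blk γ h j = σ (blk γ h i)) (hσσ : ∀ t, σ (σ t) = t)
    (hsurj : Function.Surjective (blk γ h)) (lam : Fin γ.k → ℝ) (e : ℝ) :
    lam ∈ eigenspace γ (siegel ξ 0) e ↔ ∀ t, lam (σ t) = e * lam t := by
  have key : ∀ m ∈ levi γ (Adele F),
      pairing γ lam (toAdelic (siegel ξ 0) * m * (toAdelic (siegel ξ 0))⁻¹) =
        ∑ t, lam (σ t) * HM γ m t := by
    intro m hm
    rw [pairing]
    simp only [HM_conj h ξ hξξ σ hσ hσσ m hm]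
    exact Finset.sum_bij' (fun t _ => σ t) (fun t _ => σ t) (by simp) (by simp)
      (fun t _ => hσσ t) (fun t _ => hσσ t) (fun t _ => by rw [hσσ])
  constructor
  · intro hlam t
    -- An element of `A_M` supported in one block, on which `H_M` has a single nonzero coordinate;
    -- it isolates the identity at `t`.
    let y : Fin γ.k → ℝ := fun s => if s = t then Real.exp 1 else 1
    have hy : ∀ s, 0 < y s := fun s => by
      simp only [y]
      split_ifs <;> positivity
    obtain ⟨d, -, hd⟩ := exists_diagonal_siegel (realToAdeleHom F) γ h y hy
    have hm : siegel d 0 ∈ levi γ (Adele F) := by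
      refine ⟨(siegel_mem_Sp d 0).2 transpose_zero, fun i j hij => ?_⟩
      rw [hd, diagonal_apply_ne _ fun h' => hij (by rw [h'])]
    have h1 := hlam _ hm
    rw [key _ hm, pairing] at h1
    have hHM : ∀ s, HM γ (siegel d 0) s = if s = t then (Module.finrank ℚ F *
        Fintype.card {i : Fin N // γ.block (lo i) = t.val} : ℝ) else 0 := fun s => by
      rw [HM_of_mem_AM γ h y hy _ hd s]
      by_cases hs : s = t
      · subst hs
        simp [y]
      · simp [y, hs]
    simp only [hHM, mul_ite, mul_zero, Finset.sum_ite_eq', Finset.mem_univ, if_true] at h1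
    obtain ⟨i, hi⟩ := hsurj t
    have hc : 0 < Fintype.card {i : Fin N // γ.block (lo i) = t.val} :=
      Fintype.card_pos_iff.2 ⟨⟨i, congrArg Fin.val hi⟩⟩
    have hf : 0 < Module.finrank ℚ F := Module.finrank_pos
    rw [← mul_assoc e] at h1
    exact mul_right_cancel₀ (mul_pos (Nat.cast_pos.2 hf) (Nat.cast_pos.2 hc)).ne' h1
  · intro hlam m hm
    rw [key m hm, pairing, Finset.mul_sum]
    exact Finset.sum_congr rfl fun t _ => by rw [hlam, mul_assoc]

/-- The characterization of `ρ_x`, when `x` permutes the blocks of `M` and the traces of its blocks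
in `L` are integers. -/
theorem isRho_iff {γ : LeviType N} (h : γ.rk = 0) (ξ : GL (Fin N) F)
    (hξξ : ξ.val * ξ.val = 1) (σ : Fin γ.k → Fin γ.k)
    (hσ : ∀ i j, ξ.val i j ≠ 0 → blk γ h j = σ (blk γ h i)) (hσσ : ∀ t, σ (σ t) = t)
    (hsurj : Function.Surjective (blk γ h)) {lb : Fin N → ℕ}
    (hl₁ : ∀ i j, lb i < lb j → γ.block (lo i) < γ.block (lo j))
    (hl₂ : ∀ i j, γ.block (lo i) < γ.block (lo j) → lb i ≤ lb j)
    (hl : ∀ i j, lb i = lb j ↔ blk γ h j = blk γ h i ∨ blk γ h j = σ (blk γ h i))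
    (t : Fin N → ℤ) (ht : ∀ c, ∑ i with lb i = c, ξ.val i i = ∑ i with lb i = c, (t i : F))
    (rho₀ : Fin γ.k → ℝ) (hρσ : ∀ s, rho₀ (σ s) = rho₀ s)
    (hρ : ∀ i, rho₀ (blk γ h i) = 1 / 2 + t i * ∑ j, (t j : ℝ) * ((if lb i < lb j then 1 else 0) +
        if lb i = lb j then 1 / 2 else 0)) (rho : Fin γ.k → ℝ) :
    IsRho γ (siegel ξ 0) rho ↔ rho = rho₀ := by
  have hcomm : ∀ (y : Fin γ.k → ℝ) (hy : ∀ s, 0 < y s) (d : GL (Fin N) (Adele F)),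
      d.val = diagonal (fun i => realToAdele F (y (blk γ h i))) → (∀ s, y (σ s) = y s) →
      siegel d 0 ∈ Subgroup.centralizer {toAdelic (siegel ξ 0)} := by
    intro y hy d hd hyσ
    rw [Subgroup.mem_centralizer_singleton_iff, toAdelic_siegel, siegel_mul, siegel_mul]
    congr 1
    · apply Units.ext
      ext i j : 2
      rw [Units.val_mul, Units.val_mul, hd, diagonal_mul, mul_diagonal, mul_comm]
      change algebraMap F (Adele F) (ξ.val i j) * _ = algebraMap F (Adele F) (ξ.val i j) * _
      by_cases hij : ξ.val i j = 0
      · rw [hij, map_zero, zero_mul, zero_mul]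
      · rw [hσ i j hij, hyσ]
    · simp
  have hexists : ∀ (y : Fin γ.k → ℝ), (∀ s, 0 < y s) → (∀ s, y (σ s) = y s) →
      ∃ a : leviStab γ (siegel ξ 0),
        a.1.val = diagonal fun j => realToAdele F (AMEntry γ y (γ.block j)) := by
    intro y hy hyσ
    obtain ⟨d, hd, hds⟩ := exists_diagonal_siegel (realToAdeleHom F) γ h y hy
    refine ⟨⟨siegel d 0, ⟨(siegel_mem_Sp d 0).2 transpose_zero, fun i j hij => ?_⟩,
      hcomm y hy d hd hyσ⟩, hds⟩
    rw [hds, diagonal_apply_ne _ fun h' => hij (by rw [h'])]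
  -- Conversely, an element of `A_M` commuting with `x` has equal parameters on exchanged blocks:
  -- compare the entries of the two products at a nonzero entry of `ξ`, in the archimedean
  -- component, where real scalars embed injectively.
  have hinv : ∀ (y : Fin γ.k → ℝ), (∀ s, 0 < y s) → ∀ a : leviStab γ (siegel ξ 0),
      a.1.val = diagonal (fun j => realToAdele F (AMEntry γ y (γ.block j))) →
      ∀ s, y (σ s) = y s := by
    intro y hy a ha s
    obtain ⟨i, rfl⟩ := hsurj s
    obtain ⟨j, hj⟩ : ∃ j, ξ.val i j ≠ 0 := by
      by_contra! h0
      have h1 := congrFun (congrFun hξξ i) i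
      rw [Matrix.mul_apply, Matrix.one_apply_eq] at h1
      simp [h0] at h1
    have h1 := Subgroup.mem_centralizer_singleton_iff.1 a.2.2
    have h2 := congrArg (fun g : GL (Fin (2 * N)) (Adele F) => g.val (lo i) (lo j)) h1
    beta_reduce at h2
    rw [Units.val_mul, Units.val_mul, ha, diagonal_mul, mul_diagonal, toAdelic_siegel,
      siegel_lo_lo, AMEntry_block_lo γ h, AMEntry_block_lo γ h, mul_comm] at h2
    have h3 := congrArg (toMixed F) h2
    change toMixed F (algebraMap F (Adele F) (ξ.val i j) * _) =
      toMixed F (algebraMap F (Adele F) (ξ.val i j) * _) at h3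
    have hu : toMixed F (algebraMap F (Adele F) (ξ.val i j)) *
        toMixed F (algebraMap F (Adele F) (ξ.val i j)⁻¹) = 1 := by
      rw [← map_mul, ← map_mul, mul_inv_cancel₀ hj, map_one, map_one]
    rw [map_mul, map_mul, (IsUnit.of_mul_eq_one _ hu).mul_right_inj, toMixed_realToAdele, toMixed_realToAdele] at h3
    have h4 := (algebraMap ℝ (mixedEmbedding.mixedSpace F)).injective h3
    rw [← hσ i j hj, h4]
  have hval : ∀ (y : Fin γ.k → ℝ) (hy : ∀ s, 0 < y s) (a : leviStab γ (siegel ξ 0)),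
      a.1.val = diagonal (fun j => realToAdele F (AMEntry γ y (γ.block j))) →
      deltaPx γ (siegel ξ 0) (Subgroup.inclusion (leviStab_le_parabolicStab γ _) a) *
          (deltaP F γ (Subgroup.inclusion (leviStab_le_parabolic γ _) a)) ^ (-(1 / 2 : ℝ)) =
        Real.exp (Module.finrank ℚ F * ∑ i, rho₀ (blk γ h i) * Real.log (y (blk γ h i))) := by
    intro y hy a ha
    have hyσ := hinv y hy a ha
    have hyb : ∀ i j, lb i = lb j → y (blk γ h i) = y (blk γ h j) := fun i j hij => by
      rcases (hl i j).1 hij with h' | h'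
      · rw [h']
      · rw [h', hyσ]
    have hξl : ∀ i j, lb i ≠ lb j → ξ.val i j = 0 := fun i j hij => by
      by_contra h'
      exact hij ((hl i j).2 (Or.inr (hσ i j h')))
    rw [deltaPx_siegel h ξ hl₁ hξl hξξ t ht y hy hyb _ ha, deltaP_of_mem_AM h y hy _ ha,
      ← Real.exp_mul, ← Real.exp_add]
    have := modExponent_sub lb (fun i => γ.block (lo i)) (fun i => Real.log (y (blk γ h i)))
      (fun i j hij => by rw [hyb i j hij]) hl₁ hl₂ t
    simp only [hρ, mul_comm _ (Real.log _), ← this]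
    congr 1
    ring
  have hmem : rho₀ ∈ eigenspace γ (siegel ξ 0) 1 :=
    (mem_eigenspace_iff h ξ hξξ σ hσ hσσ hsurj rho₀ 1).2 fun s => by rw [hρσ, one_mul]
  constructor
  · rintro ⟨h1, h2⟩
    have h3 := (mem_eigenspace_iff h ξ hξξ σ hσ hσσ hsurj _ 1).1 (Submodule.sub_mem _ h1 hmem)
    set v := rho - rho₀ with hv
    have hy : ∀ s, 0 < Real.exp (v s) := fun s => Real.exp_pos _
    -- The difference `v` of two candidates is itself invariant, so `exp v` gives an admissible test
    -- element. Pairing with it gives a sum of squares of the coordinates of `v`, which must vanish.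
    obtain ⟨a, ha⟩ := hexists (fun s => Real.exp (v s)) hy fun s => by rw [h3, one_mul]
    have h4 := h2 a ⟨_, hy, ha⟩
    rw [hval _ hy a ha, pairing_of_mem_AM γ h _ hy _ ha, Real.exp_eq_exp] at h4
    have hf : (Module.finrank ℚ F : ℝ) ≠ 0 := Nat.cast_ne_zero.2 Module.finrank_pos.ne'
    have h5 := mul_left_cancel₀ hf h4
    rw [← sub_eq_zero, ← Finset.sum_sub_distrib] at h5
    simp only [← sub_mul, Real.log_exp] at h5
    have h6 : ∀ i, v (blk γ h i) * v (blk γ h i) = 0 := fun i =>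
      (Finset.sum_eq_zero_iff_of_nonneg fun i _ => mul_self_nonneg (v (blk γ h i))).1 h5 i
        (Finset.mem_univ i)
    funext s
    obtain ⟨i, rfl⟩ := hsurj s
    exact sub_eq_zero.1 (mul_self_eq_zero.1 (h6 i))
  · rintro rfl
    refine ⟨hmem, ?_⟩
    rintro a ⟨y, hy, ha⟩
    rw [hval y hy a ha, pairing_of_mem_AM γ h y hy _ ha]

end Rho

/-! ## The blocks of `M` and `L` -/

section Blocks

/-- Blocks are compared through partial sums of sizes, which leaves block questions to linear
arithmetic. -/
theorem blockIndex_lt_iff (l : List ℕ) (i t : ℕ) (ht : t ≤ l.length) :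
    blockIndex l i < t ↔ i < (l.take t).sum := by
  induction l generalizing i t with
  | nil => simp_all
  | cons a l ih =>
    cases t with
    | zero => simp
    | succ t =>
      simp only [List.length_cons, Nat.add_le_add_iff_right] at ht
      simp only [blockIndex, List.take_succ_cons, List.sum_cons]
      split_ifs with hi
      · simp only [Nat.zero_lt_succ, true_iff]
        omega
      · rw [Nat.add_lt_add_iff_right, ih _ _ ht]
        omega

variable {N : ℕ}

/-- The first position of a block. -/
def LeviType.start (γ : LeviType N) (t : ℕ) : ℕ := ((List.ofFn γ.size).take t).sum

theorem start_succ (γ : LeviType N) (t : ℕ) (ht : t < γ.k) :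
    γ.start (t + 1) = γ.start t + γ.size ⟨t, ht⟩ := by
  rw [LeviType.start, List.sum_take_succ _ t (by simpa using ht), List.getElem_ofFn]
  rfl

theorem start_k (γ : LeviType N) (h : γ.rk = 0) : γ.start γ.k = N := by
  rw [LeviType.start, List.take_of_length_le (by simp), sum_size_eq γ h]

theorem block_lo_lt_iff (γ : LeviType N) (h : γ.rk = 0) (i : Fin N) (t : ℕ) (ht : t ≤ γ.k) :
    γ.block (lo i) < t ↔ i.val < γ.start t := by
  rw [block_lo γ h]
  exact blockIndex_lt_iff _ _ _ (by simpa using ht)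

theorem start_lt_start_succ (γ : LeviType N) (t : ℕ) (ht : t < γ.k) :
    γ.start t < γ.start (t + 1) := by
  have := γ.size_pos ⟨t, ht⟩
  rw [start_succ γ t ht]
  omega

theorem start_le (γ : LeviType N) (h : γ.rk = 0) (t : ℕ) : γ.start t ≤ N := by
  refine le_of_le_of_eq ?_ (sum_size_eq γ h)
  exact (List.take_sublist _ _).sum_le_sum (fun _ _ => Nat.zero_le _)

theorem block_lo_eq_iff (γ : LeviType N) (h : γ.rk = 0) (i : Fin N) (t : ℕ) (ht : t < γ.k) :
    γ.block (lo i) = t ↔ γ.start t ≤ i.val ∧ i.val < γ.start (t + 1) := by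
  have h1 := block_lo_lt_iff γ h i t ht.le
  have h2 := block_lo_lt_iff γ h i (t + 1) ht
  omega

theorem surjective_blk (γ : LeviType N) (h : γ.rk = 0) : Function.Surjective (blk γ h) := by
  intro t
  have h1 := start_lt_start_succ γ t.val t.2
  have h2 := start_le γ h (t.val + 1)
  exact ⟨⟨γ.start t.val, by omega⟩, Fin.ext ((block_lo_eq_iff γ h _ _ t.2).2 ⟨le_rfl, h1⟩)⟩

variable {n : ℕ} (D : CuspidalType n)

theorem CuspidalType.M_start_succ_of_lt (t : ℕ) (ht : t < 2 * D.k) :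
    D.M.start (t + 1) = D.M.start t + D.r ⟨t / 2, by omega⟩ := by
  rw [start_succ D.M t (show t < 2 * D.k + (D.l₁ + D.l₂) by omega)]
  congr 1
  exact Fin.append_left (fun i : Fin (2 * D.k) => D.r ⟨i.val / 2, by omega⟩) D.s ⟨t, ht⟩

theorem CuspidalType.M_start_succ_of_ge (t : ℕ) (ht : t < D.l₁ + D.l₂) :
    D.M.start (2 * D.k + t + 1) = D.M.start (2 * D.k + t) + D.s ⟨t, ht⟩ := by
  rw [start_succ D.M _ (show 2 * D.k + t < 2 * D.k + (D.l₁ + D.l₂) by omega)]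
  congr 1
  exact Fin.append_right (fun i : Fin (2 * D.k) => D.r ⟨i.val / 2, by omega⟩) D.s ⟨t, ht⟩

theorem CuspidalType.L_start_succ_of_lt (t : ℕ) (ht : t < D.k) :
    D.L.start (t + 1) = D.L.start t + 2 * D.r ⟨t, ht⟩ := by
  rw [start_succ D.L t (show t < D.k + (D.l₁ + D.l₂) by omega)]
  congr 1
  exact Fin.append_left (fun i : Fin D.k => 2 * D.r i) D.s ⟨t, ht⟩

theorem CuspidalType.L_start_succ_of_ge (t : ℕ) (ht : t < D.l₁ + D.l₂) :
    D.L.start (D.k + t + 1) = D.L.start (D.k + t) + D.s ⟨t, ht⟩ := by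
  rw [start_succ D.L _ (show D.k + t < D.k + (D.l₁ + D.l₂) by omega)]
  congr 1
  exact Fin.append_right (fun i : Fin D.k => 2 * D.r i) D.s ⟨t, ht⟩

/-- Two consecutive blocks of size `r_t` fill one block of size `2 r_t`, so the boundaries of `L`
are every second boundary of `M` in the paired range. -/
theorem CuspidalType.L_start_of_le (t : ℕ) (ht : t ≤ D.k) : D.L.start t = D.M.start (2 * t) := by
  induction t with
  | zero => rfl
  | succ t ih =>
    have h1 : 2 * (t + 1) = 2 * t + 1 + 1 := by ring
    rw [D.L_start_succ_of_lt t (by omega), ih (by omega), h1,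
      D.M_start_succ_of_lt (2 * t + 1) (by omega), D.M_start_succ_of_lt (2 * t) (by omega), add_assoc]
    have e1 : (⟨2 * t / 2, by omega⟩ : Fin D.k) = ⟨t, ht⟩ := Fin.ext (by simp only; omega)
    have e2 : (⟨(2 * t + 1) / 2, by omega⟩ : Fin D.k) = ⟨t, ht⟩ := Fin.ext (by simp only; omega)
    rw [e1, e2, ← two_mul (D.r _)]

theorem CuspidalType.L_start_of_ge (t : ℕ) (ht : t ≤ D.l₁ + D.l₂) :
    D.L.start (D.k + t) = D.M.start (2 * D.k + t) := by
  induction t with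
  | zero => exact D.L_start_of_le D.k le_rfl
  | succ t ih =>
    rw [← add_assoc, ← add_assoc, D.L_start_succ_of_ge t (by omega),
      D.M_start_succ_of_ge t (by omega), ih (by omega)]

/-- The comparison with every threshold agrees by equality of the boundaries; two consecutive
thresholds then pin down the index. -/
theorem CuspidalType.L_block_lo (i : Fin (2 * n)) :
    D.L.block (lo i) = if D.M.block (lo i) < 2 * D.k then D.M.block (lo i) / 2
      else D.M.block (lo i) - D.k := by
  have hM : D.M.block (lo i) < 2 * D.k + (D.l₁ + D.l₂) := block_lo_lt D.M rfl i
  have hL : D.L.block (lo i) < D.k + (D.l₁ + D.l₂) := block_lo_lt D.L rfl i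
  have h1 : ∀ t ≤ D.k, D.L.block (lo i) < t ↔ D.M.block (lo i) < 2 * t := fun t ht => by
    rw [block_lo_lt_iff D.L rfl i t (show t ≤ D.k + (D.l₁ + D.l₂) by omega),
      block_lo_lt_iff D.M rfl i (2 * t) (show 2 * t ≤ 2 * D.k + (D.l₁ + D.l₂) by omega),
      D.L_start_of_le t ht]
  have h2 : ∀ t ≤ D.l₁ + D.l₂, D.L.block (lo i) < D.k + t ↔ D.M.block (lo i) < 2 * D.k + t :=
    fun t ht => by
    rw [block_lo_lt_iff D.L rfl i _ (show D.k + t ≤ D.k + (D.l₁ + D.l₂) by omega),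
      block_lo_lt_iff D.M rfl i _ (show 2 * D.k + t ≤ 2 * D.k + (D.l₁ + D.l₂) by omega),
      D.L_start_of_ge t ht]
  split_ifs with hk
  · have h3 := h1 (D.M.block (lo i) / 2) (by omega)
    have h4 := h1 (D.M.block (lo i) / 2 + 1) (by omega)
    omega
  · have h3 := h2 (D.M.block (lo i) - 2 * D.k) (by omega)
    have h4 := h2 (D.M.block (lo i) - 2 * D.k + 1) (by omega)
    omega

/-- The last `l₂` blocks have size one, so their positions are counted from the end. -/
theorem CuspidalType.M_start_add (t : ℕ) (ht : t ≤ D.l₂) :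
    D.M.start (2 * D.k + D.l₁ + t) + (D.l₂ - t) = 2 * n := by
  induction h : D.l₂ - t generalizing t with
  | zero =>
    have : 2 * D.k + D.l₁ + t = D.M.k := by
      change _ = 2 * D.k + (D.l₁ + D.l₂)
      omega
    rw [this, start_k D.M rfl, add_zero]
  | succ m ih =>
    have h1 := D.M_start_succ_of_ge (D.l₁ + t) (by omega)
    rw [D.s_one _ (show D.l₁ ≤ D.l₁ + t by omega)] at h1
    have h2 := ih (t + 1) (by omega) (by omega)
    rw [show 2 * D.k + (D.l₁ + t) + 1 = 2 * D.k + D.l₁ + (t + 1) by ring,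
      show 2 * D.k + (D.l₁ + t) = 2 * D.k + D.l₁ + t by ring] at h1
    omega

/-- The blocks of size one at the end. -/
theorem CuspidalType.M_block_lo_eq_iff (i : Fin (2 * n)) (t : ℕ) (ht : t < D.l₂) :
    D.M.block (lo i) = 2 * D.k + D.l₁ + t ↔ i.val + D.l₂ = 2 * n + t := by
  rw [block_lo_eq_iff D.M rfl i _ (show 2 * D.k + D.l₁ + t < 2 * D.k + (D.l₁ + D.l₂) by omega)]
  have h1 := D.M_start_add t ht.le
  have h2 := D.M_start_add (t + 1) ht
  rw [← add_assoc] at h2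
  omega

/-- The permutation of the blocks of `M` which exchanges the members of each pair. -/
def CuspidalType.swap (t : Fin D.M.k) : Fin D.M.k :=
  ⟨if t.val < 2 * D.k then (if t.val % 2 = 0 then t.val + 1 else t.val - 1) else t.val, by
    have : t.val < 2 * D.k + (D.l₁ + D.l₂) := t.2
    change _ < 2 * D.k + (D.l₁ + D.l₂)
    split_ifs <;> omega⟩

theorem CuspidalType.swap_swap (t : Fin D.M.k) : D.swap (D.swap t) = t := by
  apply Fin.ext
  simp only [swap]
  split_ifs <;> omega

theorem CuspidalType.L_block_lt (i j : Fin (2 * n)) (h : D.L.block (lo i) < D.L.block (lo j)) :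
    D.M.block (lo i) < D.M.block (lo j) := by
  rw [D.L_block_lo, D.L_block_lo] at h
  split_ifs at h <;> omega

theorem CuspidalType.L_block_le (i j : Fin (2 * n)) (h : D.M.block (lo i) < D.M.block (lo j)) :
    D.L.block (lo i) ≤ D.L.block (lo j) := by
  rw [D.L_block_lo, D.L_block_lo]
  split_ifs <;> omega

theorem CuspidalType.L_block_eq_iff (i j : Fin (2 * n)) :
    D.L.block (lo i) = D.L.block (lo j) ↔
      blk D.M rfl j = blk D.M rfl i ∨ blk D.M rfl j = D.swap (blk D.M rfl i) := by
  rw [D.L_block_lo, D.L_block_lo, Fin.ext_iff, Fin.ext_iff]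
  have hs : (D.swap (blk D.M rfl i)).val = if D.M.block (lo i) < 2 * D.k then
    (if D.M.block (lo i) % 2 = 0 then D.M.block (lo i) + 1 else D.M.block (lo i) - 1)
    else D.M.block (lo i) := rfl
  change _ ↔ D.M.block (lo j) = D.M.block (lo i) ∨ D.M.block (lo j) = _
  split_ifs at hs ⊢ <;> omega

end Blocks

/-! ## The structure of a standard cuspidal element -/

section Structure

variable {N : ℕ} {F : Type*} [Field F]

theorem exists_GL_diagonal (v : Fin N → F) (hv : ∀ i, v i ≠ 0) :
    ∃ d : GL (Fin N) F, d.val = diagonal v := by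
  have h : diagonal v * diagonal (fun i => (v i)⁻¹) = 1 := by
    rw [diagonal_mul_diagonal, ← diagonal_one]
    congr 1
    funext i
    exact mul_inv_cancel₀ (hv i)
  exact ⟨⟨_, _, h, mul_eq_one_comm.1 h⟩, rfl⟩

theorem exists_GL_transvection (i j : Fin N) (hij : i ≠ j) :
    ∃ d : GL (Fin N) F, d.val = transvection i j 1 := by
  have h : transvection i j (1 : F) * transvection i j (-1 : F) = 1 := by
    rw [transvection_mul_transvection_same i j hij, add_neg_cancel, transvection_zero]
  exact ⟨⟨_, _, h, mul_eq_one_comm.1 h⟩, rfl⟩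

theorem siegel_mem_levi {γ : LeviType N} (h : γ.rk = 0) (α : GL (Fin N) F) :
    siegel α 0 ∈ levi γ F ↔ ∀ i j, blk γ h i ≠ blk γ h j → α.val i j = 0 := by
  rw [mem_levi_iff γ h]
  constructor
  · rintro ⟨β, hβ, hab⟩ i j hij
    rw [(siegel_injective hab).1]
    exact hβ i j fun h' => hij (Fin.ext h')
  · intro hα
    exact ⟨α, fun i j hij => hα i j fun h' => hij (congrArg Fin.val h'), rfl⟩

theorem transvection_apply_of_ne (i j p q : Fin N) (hpq : p ≠ q) (h : ¬ (i = p ∧ j = q)) :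
    transvection i j (1 : F) p q = 0 := by
  rw [transvection, Matrix.add_apply, Matrix.one_apply_ne hpq, zero_add, Matrix.single_apply,
    if_neg h]

theorem transvection_mem_levi {γ : LeviType N} (h : γ.rk = 0) (i j : Fin N)
    (hb : blk γ h i = blk γ h j) (d : GL (Fin N) F) (hd : d.val = transvection i j 1) :
    siegel d 0 ∈ levi γ F := by
  refine (siegel_mem_levi h d).2 fun p q hpq => ?_
  rw [hd]
  refine transvection_apply_of_ne i j p q (fun h' => hpq (by rw [h'])) ?_
  rintro ⟨rfl, rfl⟩
  exact hpq hb

/-- An involution of `F^N` which normalizes the Levi subgroup maps each of its blocks into a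
block. -/
theorem blk_eq_of_normalizes [CharZero F] {γ : LeviType N} (h : γ.rk = 0) (ξ : GL (Fin N) F)
    (hξξ : ξ * ξ = 1)
    (hn : ∀ α : GL (Fin N) F, siegel α 0 ∈ levi γ F → siegel (ξ * α * ξ) 0 ∈ levi γ F)
    {i i' j j' : Fin N} (hii : blk γ h i = blk γ h i') (hij : ξ.val i j ≠ 0)
    (hij' : ξ.val i' j' ≠ 0) : blk γ h j = blk γ h j' := by
  -- A central element of the Levi subgroup that distinguishes the block of `j` from all others. Its
  -- conjugate `z` by `ξ` is central too: diagonal, as it commutes with diagonal elements, and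
  -- constant on blocks, as it commutes with transvections. The relation `z ξ = ξ d` then reads off
  -- the block of `j'`.
  obtain ⟨d, hd⟩ := exists_GL_diagonal (F := F) (fun l => if blk γ h l = blk γ h j then 2 else 1)
    fun l => by split_ifs <;> simp
  have hdc : ∀ β : GL (Fin N) F, siegel β 0 ∈ levi γ F → d * β = β * d := by
    intro β hβ
    apply Units.ext
    ext p q : 2
    rw [Units.val_mul, Units.val_mul, hd, diagonal_mul, mul_diagonal, mul_comm]
    by_cases hpq : blk γ h p = blk γ h q
    · rw [hpq]
    · rw [(siegel_mem_levi h β).1 hβ p q hpq, zero_mul, zero_mul]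
  obtain ⟨z, hz⟩ : ∃ z, z = ξ * d * ξ := ⟨_, rfl⟩
  have hzc : ∀ β : GL (Fin N) F, siegel β 0 ∈ levi γ F → z * β = β * z := by
    intro β hβ
    have h1 := hdc _ (hn β hβ)
    calc z * β = ξ * (d * (ξ * β * ξ)) * ξ := by
          simp only [hz, mul_assoc, hξξ, mul_one]
      _ = (ξ * ξ) * β * (ξ * d * ξ) := by
          rw [h1]
          simp only [mul_assoc]
      _ = β * z := by rw [hξξ, one_mul, hz]
  have hzd : ∀ p q, p ≠ q → z.val p q = 0 := by
    intro p q hpq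
    obtain ⟨e, he⟩ := exists_GL_diagonal (F := F) (fun l => if l = p then 2 else 1)
      fun l => by split_ifs <;> simp
    have h1 := hzc e ((siegel_mem_levi h e).2 fun a b hab => by
      rw [he, diagonal_apply_ne _ fun h' => hab (by rw [h'])])
    have h2 := congrArg (fun g : GL (Fin N) F => g.val p q) h1
    beta_reduce at h2
    rw [Units.val_mul, Units.val_mul, he, mul_diagonal, diagonal_mul, if_neg hpq.symm, if_pos rfl,
      mul_one] at h2
    linear_combination -h2
  have hzi : z.val i i = z.val i' i' := by
    by_cases hne : i = i'
    · rw [hne]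
    obtain ⟨e, he⟩ := exists_GL_transvection (F := F) i i' hne
    have h1 := hzc e (transvection_mem_levi h i i' hii e he)
    have h2 := congrArg (fun g : GL (Fin N) F => g.val i i') h1
    beta_reduce at h2
    rw [Units.val_mul, Units.val_mul, he, transvection, Matrix.mul_add, Matrix.add_mul,
      Matrix.mul_one, Matrix.one_mul, Matrix.add_apply, Matrix.add_apply] at h2
    simpa using h2
  have hzξ : z * ξ = ξ * d := by rw [hz, mul_assoc, hξξ, mul_one]
  have hzz : ∀ p q, ξ.val p q ≠ 0 → z.val p p = d.val q q := by
    intro p q hpq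
    have h2 := congrArg (fun g : GL (Fin N) F => g.val p q) hzξ
    beta_reduce at h2
    rw [Units.val_mul, Units.val_mul, hd, mul_diagonal, Matrix.mul_apply,
      Finset.sum_eq_single_of_mem p (Finset.mem_univ p)
        (fun l _ hl => by rw [hzd p l hl.symm, zero_mul]), mul_comm] at h2
    rw [hd, diagonal_apply_eq]
    exact mul_left_cancel₀ hpq h2
  have h3 := (hzz i j hij).symm.trans (hzi.trans (hzz i' j' hij'))
  rw [hd, diagonal_apply_eq, diagonal_apply_eq, if_pos rfl] at h3
  by_contra hne
  rw [if_neg (Ne.symm hne)] at h3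
  norm_num at h3

variable {n : ℕ}

/-- The standard Levi subgroup of type `(a, N - a; 0)`. -/
@[reducible]
def cutType (a : ℕ) (h₀ : 0 < a) (h₁ : a < N) : LeviType N where
  k := 2
  size := ![a, N - a]
  rk := 0
  size_pos i := by
    fin_cases i
    · exact h₀
    · exact Nat.sub_pos_of_lt h₁
  sum_eq := by
    simp [Fin.sum_univ_two]
    omega

theorem blk_cutType (a : ℕ) (h₀ : 0 < a) (h₁ : a < N) (i j : Fin N) :
    blk (cutType a h₀ h₁) rfl i = blk (cutType a h₀ h₁) rfl j ↔ (i.val < a ↔ j.val < a) := by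
  have hs : (cutType a h₀ h₁).start 1 = a := by
    rw [start_succ _ 0 (show 0 < 2 by omega)]
    exact zero_add a
  have hi := block_lo_lt_iff (cutType a h₀ h₁) rfl i 1 (show 1 ≤ 2 by omega)
  have hj := block_lo_lt_iff (cutType a h₀ h₁) rfl j 1 (show 1 ≤ 2 by omega)
  have hi' : (cutType a h₀ h₁).block (lo i) < 2 := block_lo_lt _ rfl i
  have hj' : (cutType a h₀ h₁).block (lo j) < 2 := block_lo_lt _ rfl j
  rw [hs] at hi hj
  rw [Fin.ext_iff]
  change (cutType a h₀ h₁).block (lo i) = (cutType a h₀ h₁).block (lo j) ↔ _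
  omega

theorem isSemistandardLevi_levi (γ : LeviType N) : IsSemistandardLevi (levi γ F) := by
  refine ⟨⟨γ, 1, one_mem _, ?_⟩, fun t ht htd => ⟨ht, fun i j hij => htd i j ?_⟩⟩
  · ext g
    simp [Subgroup.mem_map]
  · rintro rfl
    exact hij rfl

theorem mem_of_leviHull_eq {γ δ : LeviType N} {x : GL (Fin (2 * N)) F}
    (h : leviHull γ x = levi δ F) : x ∈ levi δ F := by
  rw [← h]
  exact Subgroup.mem_sInf.2 fun L hL => hL.2.2

/-- Minimality of `L(x)`: any standard Levi subgroup containing both `M` and `x` contains it. -/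
theorem levi_le_of_leviHull_eq {γ δ ε : LeviType N} {x : GL (Fin (2 * N)) F}
    (h : leviHull γ x = levi δ F) (hγ : levi γ F ≤ levi ε F) (hx : x ∈ levi ε F) :
    levi δ F ≤ levi ε F := by
  rw [← h]
  exact sInf_le ⟨isSemistandardLevi_levi ε, hγ, hx⟩

theorem mul_self_of_mem_X {x : GL (Fin (2 * N)) F} (hx : x ∈ X N F) : x * x = 1 := by
  obtain ⟨g, -, rfl⟩ := hx
  have h : eps N F * eps N F = 1 := Units.ext (epsEntry_sq N F)
  calc g * eps N F * g⁻¹ * (g * eps N F * g⁻¹) = g * (eps N F * eps N F) * g⁻¹ := by group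
    _ = 1 := by rw [h, mul_one, mul_inv_cancel]

end Structure

/-! ### How a standard cuspidal involution acts on the blocks -/

section Cuspidal

variable {F : Type*} [Field F] {n : ℕ} {D : CuspidalType n}
  {x : GL (Fin (2 * (2 * n))) F}

/-- A standard cuspidal element lies in the Siegel Levi subgroup, and is given there by an
involution. -/
theorem IsStandardCuspidal.exists_siegel (hx : IsStandardCuspidal D x) :
    ∃ ξ : GL (Fin (2 * n)) F, x = siegel ξ 0 ∧ ξ * ξ = 1 ∧
      ∀ i j, ξ.val i j ≠ 0 → D.L.block (lo i) = D.L.block (lo j) := by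
  obtain ⟨ξ, hξ, rfl⟩ := (mem_levi_iff D.L rfl x).1 (mem_of_leviHull_eq hx.2.2.1)
  refine ⟨ξ, rfl, ?_, fun i j => not_imp_comm.1 (hξ i j)⟩
  have h := mul_self_of_mem_X hx.1
  rw [siegel_mul, ← siegel_one_zero] at h
  exact (siegel_injective h).1

theorem exists_ne_zero_of_mul_self {N : ℕ} {ξ : GL (Fin N) F} (hξξ : ξ * ξ = 1) (i : Fin N) :
    (∃ j, ξ.val i j ≠ 0) ∧ ∃ j, ξ.val j i ≠ 0 := by
  have h1 : ξ.val * ξ.val = 1 := by rw [← Units.val_mul, hξξ, Units.val_one]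
  have h2 := congrFun (congrFun h1 i) i
  rw [Matrix.mul_apply, Matrix.one_apply_eq] at h2
  obtain ⟨j, -, hj⟩ := Finset.exists_ne_zero_of_sum_ne_zero (h2.trans_ne one_ne_zero)
  exact ⟨⟨j, left_ne_zero_of_mul hj⟩, ⟨j, right_ne_zero_of_mul hj⟩⟩

/-- A standard cuspidal element exchanges the members of each pair of blocks of `M`. -/
theorem IsStandardCuspidal.blk_eq_swap [CharZero F] {ξ : GL (Fin (2 * n)) F}
    (hx : IsStandardCuspidal D (siegel ξ 0)) (hξξ : ξ * ξ = 1)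
    (hξ : ∀ i j, ξ.val i j ≠ 0 → D.L.block (lo i) = D.L.block (lo j)) (i j : Fin (2 * n))
    (hij : ξ.val i j ≠ 0) : blk D.M rfl j = D.swap (blk D.M rfl i) := by
  have hn : ∀ α : GL (Fin (2 * n)) F, siegel α 0 ∈ levi D.M F →
      siegel (ξ * α * ξ) 0 ∈ levi D.M F := by
    intro α hα
    have h1 := (Subgroup.mem_normalizer_iff.1 hx.2.1 (siegel α 0)).1 hα
    have h2 : siegel ξ 0 * siegel ξ 0 = 1 := by
      rw [siegel_mul, hξξ, Matrix.mul_zero, Matrix.zero_mul, add_zero, siegel_one_zero]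
    rw [inv_eq_of_mul_eq_one_right h2, siegel_mul, siegel_mul] at h1
    simpa using h1
  have hconst := fun {i i' j j' : Fin (2 * n)} => blk_eq_of_normalizes rfl ξ hξξ hn
    (i := i) (i' := i') (j := j) (j' := j')
  rcases (D.L_block_eq_iff i j).1 (hξ i j hij) with hb | hb
  swap
  · exact hb
  by_contra hne
  have ht : D.M.block (lo i) < 2 * D.k := by
    by_contra ht
    refine hne (hb.trans (Fin.ext ?_))
    change D.M.block (lo i) = if D.M.block (lo i) < 2 * D.k then _ else D.M.block (lo i)
    rw [if_neg ht]
  -- One nonzero entry inside a member of the pair makes `ξ` preserve that member. It then preserves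
  -- the other one as well: a row meeting the other member cannot lie in the first.
  have hdiag : ∀ i' j', D.L.block (lo i') = D.L.block (lo i) → ξ.val i' j' ≠ 0 →
      blk D.M rfl j' = blk D.M rfl i' := by
    intro i' j' hi' hij'
    have hsame : ∀ a b, blk D.M rfl a = blk D.M rfl i → ξ.val a b ≠ 0 →
        blk D.M rfl b = blk D.M rfl i := fun a b ha hab => (hconst ha hab hij).trans hb
    rcases (D.L_block_eq_iff i i').1 hi'.symm with h1 | h1
    · rw [h1]
      exact hsame i' j' h1 hij'
    · obtain ⟨a, ha⟩ := (exists_ne_zero_of_mul_self hξξ i').2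
      have hla : D.L.block (lo i) = D.L.block (lo a) := hi'.symm.trans (hξ a i' ha).symm
      rcases (D.L_block_eq_iff i a).1 hla with h2 | h2
      · exact absurd (hb.trans ((hsame a i' h2 ha).symm.trans h1)) hne
      · exact (hconst (h1.trans h2.symm) hij' ha)
  set p := D.M.block (lo i) / 2 with hp
  have hpk : 2 * p + 1 < 2 * D.k + (D.l₁ + D.l₂) := by omega
  have hcut₀ := start_lt_start_succ D.M (2 * p) (show 2 * p < 2 * D.k + (D.l₁ + D.l₂) by omega)
  have hcut₁ := start_lt_start_succ D.M (2 * p + 1) hpk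
  have hcut₂ := start_le D.M rfl (2 * p + 1 + 1)
  -- The boundary between the two members of the pair. Cutting there gives a Levi subgroup of type
  -- `(a, 2n - a; 0)` containing `M` and `x`, hence `L`; but `L` contains the transvection joining
  -- the positions `a - 1` and `a` on either side of the cut.
  set a := D.M.start (2 * p + 1) with ha
  have h₀ : 0 < a := by omega
  have h₁ : a < 2 * n := by omega
  have hlt : ∀ l, l.val < a ↔ D.M.block (lo l) < 2 * p + 1 := fun l =>
    (block_lo_lt_iff D.M rfl l _ hpk.le).symm
  have hM : levi D.M F ≤ levi (cutType a h₀ h₁) F := by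
    intro g hg
    obtain ⟨α, hα, rfl⟩ := (mem_levi_iff D.M rfl g).1 hg
    refine (siegel_mem_levi rfl α).2 fun r s hrs => hα r s fun h' => hrs ?_
    rw [blk_cutType, hlt, hlt, h']
  have hxc : siegel ξ 0 ∈ levi (cutType a h₀ h₁) F := by
    refine (siegel_mem_levi rfl ξ).2 fun r s hrs => ?_
    by_contra hne'
    refine hrs ?_
    rw [blk_cutType, hlt, hlt]
    have h1 := hξ r s hne'
    by_cases h2 : D.L.block (lo r) = D.L.block (lo i)
    · have h3 : D.M.block (lo s) = D.M.block (lo r) := congrArg Fin.val (hdiag r s h2 hne')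
      rw [h3]
    · have h4 : D.L.block (lo i) = p := by rw [D.L_block_lo, if_pos ht]
      rw [h4] at h2
      rw [D.L_block_lo, D.L_block_lo] at h1
      rw [D.L_block_lo] at h2
      split_ifs at h1 h2 <;> omega
  have hL := levi_le_of_leviHull_eq hx.2.2.1 hM hxc
  have hr : (⟨a - 1, by omega⟩ : Fin (2 * n)) ≠ ⟨a, h₁⟩ := fun h' => by
    have := congrArg Fin.val h'
    simp only at this
    omega
  obtain ⟨e, he⟩ := exists_GL_transvection (F := F) _ _ hr
  have hm₁ : D.M.block (lo (⟨a - 1, by omega⟩ : Fin (2 * n))) = 2 * p :=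
    (block_lo_eq_iff D.M rfl _ _ (show 2 * p < 2 * D.k + (D.l₁ + D.l₂) by omega)).2 ⟨by simp only; omega, by simp only; omega⟩
  have hm₂ : D.M.block (lo (⟨a, h₁⟩ : Fin (2 * n))) = 2 * p + 1 :=
    (block_lo_eq_iff D.M rfl _ _ hpk).2 ⟨le_rfl, by simp only; omega⟩
  have heL : siegel e 0 ∈ levi D.L F := by
    refine transvection_mem_levi rfl _ _ (Fin.ext ?_) e he
    change D.L.block (lo _) = D.L.block (lo _)
    rw [D.L_block_lo, D.L_block_lo, hm₁, hm₂]
    split_ifs <;> omega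
  have h5 := (siegel_mem_levi rfl e).1 (hL heL) ⟨a - 1, by omega⟩ ⟨a, h₁⟩ fun h' => by
    rw [blk_cutType] at h'
    simp only at h'
    omega
  rw [he, transvection, Matrix.add_apply, Matrix.one_apply_ne hr, Matrix.single_apply_same,
    zero_add] at h5
  exact one_ne_zero h5

/-- The trace is conjugation invariant, and equally many signs `1` and `-1` sum to zero. -/
theorem HasSignature.trace_eq {ι : Type*} [Fintype ι] [DecidableEq ι] {z : Matrix ι ι F} {p : ℕ}
    (h : HasSignature z p p) : z.trace = 0 := by
  obtain ⟨g, e, hp, hq, rfl⟩ := h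
  have h1 : ∀ i, ((e i : ℤ) : F) = (if e i = 1 then 1 else 0) - if e i = -1 then 1 else 0 := by
    intro i
    rcases Int.units_eq_one_or (e i) with h | h <;> rw [h]
    · simp [show (1 : ℤˣ) ≠ -1 by decide]
    · simp [show (-1 : ℤˣ) ≠ 1 by decide]
  rw [Matrix.trace_mul_cycle, ← Units.val_mul, inv_mul_cancel, Units.val_one, Matrix.one_mul,
    trace_diagonal]
  simp only [h1]
  rw [Finset.sum_sub_distrib, Finset.sum_boole, Finset.sum_boole, ← Fintype.card_subtype,
    ← Fintype.card_subtype, ← Nat.card_eq_fintype_card, ← Nat.card_eq_fintype_card, hp, hq, sub_self]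

theorem trace_diagBlock_siegel {N : ℕ} (γ : LeviType N) (h : γ.rk = 0) (ξ : GL (Fin N) F) (c : ℕ)
    (hc : c < γ.k) :
    (diagBlock γ (siegel ξ 0) c).trace = ∑ i with γ.block (lo i) = c, ξ.val i i := by
  rw [Finset.sum_subtype _ (p := fun i : Fin N => γ.block (lo i) = c) (by simp), Matrix.trace,
    ← (blockEquiv γ h c hc).sum_comp]
  exact Finset.sum_congr rfl fun i _ => siegel_lo_lo ξ 0 i.1 i.1

/-- The signs of a standard cuspidal element, and zero for the blocks where its trace vanishes. -/
def cuspidalSign [DecidableEq F] (D : CuspidalType n) (ξ : GL (Fin (2 * n)) F) (i : Fin (2 * n)) :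
    ℤ :=
  if D.M.block (lo i) < 2 * D.k + D.l₁ then 0 else if ξ.val i i = 1 then 1 else -1

theorem CuspidalType.eq_of_blk_eq (D : CuspidalType n) {i j : Fin (2 * n)}
    (hi : ¬ D.M.block (lo i) < 2 * D.k + D.l₁) (h : D.M.block (lo j) = D.M.block (lo i)) :
    j = i := by
  have h0 : D.M.block (lo i) < 2 * D.k + (D.l₁ + D.l₂) := block_lo_lt D.M rfl i
  have h1 := D.M_block_lo_eq_iff i (D.M.block (lo i) - (2 * D.k + D.l₁)) (by omega)
  have h2 := D.M_block_lo_eq_iff j (D.M.block (lo i) - (2 * D.k + D.l₁)) (by omega)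
  exact Fin.ext (by omega)

/-- A block of size one is fixed by the exchange, so its row of `ξ` has only the diagonal entry,
whose square is `1`. -/
theorem diag_mul_self {ξ : GL (Fin (2 * n)) F} (hξξ : ξ * ξ = 1)
    (hσ : ∀ i j, ξ.val i j ≠ 0 → blk D.M rfl j = D.swap (blk D.M rfl i)) {i : Fin (2 * n)}
    (hi : ¬ D.M.block (lo i) < 2 * D.k + D.l₁) : ξ.val i i = 1 ∨ ξ.val i i = -1 := by
  have h1 : ξ.val * ξ.val = 1 := by rw [← Units.val_mul, hξξ, Units.val_one]
  have h2 := congrFun (congrFun h1 i) i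
  rw [Matrix.mul_apply, Matrix.one_apply_eq, Finset.sum_eq_single_of_mem i (Finset.mem_univ i)] at h2
  · exact mul_self_eq_one_iff.1 h2
  · intro j _ hj
    by_contra hne
    refine hj (D.eq_of_blk_eq hi ?_)
    have h3 : D.M.block (lo j) = (D.swap (blk D.M rfl i)).val :=
      congrArg Fin.val (hσ i j (left_ne_zero_of_mul hne))
    rw [h3]
    change (if D.M.block (lo i) < 2 * D.k then _ else D.M.block (lo i)) = _
    rw [if_neg (by omega)]

/-- The traces of the blocks of a standard cuspidal element. -/
theorem IsStandardCuspidal.sum_diag [DecidableEq F] {ξ : GL (Fin (2 * n)) F}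
    (hx : IsStandardCuspidal D (siegel ξ 0)) (hξξ : ξ * ξ = 1)
    (hσ : ∀ i j, ξ.val i j ≠ 0 → blk D.M rfl j = D.swap (blk D.M rfl i)) (c : ℕ) :
    ∑ i with D.L.block (lo i) = c, ξ.val i i =
      ∑ i with D.L.block (lo i) = c, (cuspidalSign D ξ i : F) := by
  by_cases hc : D.k ≤ c ∧ c < D.k + D.l₁
  · have h1 : ∀ i ∈ Finset.univ.filter (fun i => D.L.block (lo i) = c),
        (cuspidalSign D ξ i : F) = 0 := by
      intro i hi
      have h2 := (Finset.mem_filter.1 hi).2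
      rw [D.L_block_lo] at h2
      rw [cuspidalSign, if_pos, Int.cast_zero]
      split_ifs at h2 <;> omega
    rw [Finset.sum_eq_zero h1]
    obtain ⟨c, rfl⟩ := Nat.exists_eq_add_of_le hc.1
    -- On an even block only the trace is known to vanish, not the single diagonal entries; this is
    -- why equality is asked for sums over blocks.
    obtain ⟨p, q, hpq, rfl⟩ := hx.2.2.2 ⟨c, by omega⟩ (by simp only; omega)
    rw [← trace_diagBlock_siegel D.L rfl ξ _ (show D.k + c < D.k + (D.l₁ + D.l₂) by omega)]
    exact hpq.trace_eq
  · refine Finset.sum_congr rfl fun i hi => ?_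
    have h2 := (Finset.mem_filter.1 hi).2
    rw [D.L_block_lo] at h2
    have h0 : D.M.block (lo i) < 2 * D.k + (D.l₁ + D.l₂) := block_lo_lt D.M rfl i
    by_cases hi : D.M.block (lo i) < 2 * D.k + D.l₁
    · have h3 : D.M.block (lo i) < 2 * D.k := by
        split_ifs at h2 <;> omega
      rw [cuspidalSign, if_pos hi, Int.cast_zero]
      by_contra hne
      have h4 : D.M.block (lo i) = (D.swap (blk D.M rfl i)).val := congrArg Fin.val (hσ i i hne)
      have h5 : (D.swap (blk D.M rfl i)).val = if D.M.block (lo i) < 2 * D.k then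
        (if D.M.block (lo i) % 2 = 0 then D.M.block (lo i) + 1 else D.M.block (lo i) - 1)
        else D.M.block (lo i) := rfl
      rw [if_pos h3] at h5
      split_ifs at h5 <;> omega
    · rw [cuspidalSign, if_neg hi]
      rcases diag_mul_self hξξ hσ hi with h | h
      · rw [h, if_pos rfl, Int.cast_one]
      · split_ifs with h'
        · rw [h', Int.cast_one]
        · rw [h, Int.cast_neg, Int.cast_one]

end Cuspidal

/-! ## The explicit vector and the explicit affine subspace -/

section Explicit

variable {F : Type*} [Field F] {n : ℕ} {D : CuspidalType n}

open Classical in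
/-- The sign `h_{l₁ + a}` as a real number. -/
def realSign (D : CuspidalType n) (x : GL (Fin (2 * (2 * n))) F) (a : ℕ) : ℝ :=
  if hSign D x (D.l₁ + a) = 1 then 1 else -1

theorem realSign_mul_self (x : GL (Fin (2 * (2 * n))) F) (a : ℕ) :
    realSign D x a * realSign D x a = 1 := by
  rw [realSign]
  split_ifs <;> norm_num

theorem realSign_mul [CharZero F] {x : GL (Fin (2 * (2 * n))) F} {a b : ℕ}
    (ha : hSign D x (D.l₁ + a) = 1 ∨ hSign D x (D.l₁ + a) = -1)
    (hb : hSign D x (D.l₁ + b) = 1 ∨ hSign D x (D.l₁ + b) = -1) :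
    (hSign D x (D.l₁ + a) = hSign D x (D.l₁ + b) → realSign D x a * realSign D x b = 1) ∧
      (hSign D x (D.l₁ + a) ≠ hSign D x (D.l₁ + b) → realSign D x a * realSign D x b = -1) := by
  have h : (-1 : F) ≠ 1 := by norm_num
  simp only [realSign]
  rcases ha with ha | ha <;> rcases hb with hb | hb <;> rw [ha, hb] <;> simp [h, h.symm]

/-- Twice the number of agreements minus the number of terms is the sum of the products of signs. -/
theorem lamEntry_eq_sum [CharZero F] {x : GL (Fin (2 * (2 * n))) F}
    (hx : ∀ a ∈ Finset.Icc 1 D.l₂, hSign D x (D.l₁ + a) = 1 ∨ hSign D x (D.l₁ + a) = -1)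
    {a : ℕ} (ha : a ∈ Finset.Icc 1 D.l₂) :
    lamEntry D x a = ∑ b ∈ Finset.Icc a D.l₂, realSign D x a * realSign D x b := by
  have ha' := Finset.mem_Icc.1 ha
  have h1 : (D.l₂ : ℝ) + 1 - a = ∑ b ∈ Finset.Icc a D.l₂, 1 := by
    rw [Finset.sum_const, nsmul_one, Nat.card_Icc, Nat.cast_sub (by omega)]
    push_cast
    ring
  rw [lamEntry, h1, Finset.card_filter, Nat.cast_sum, Finset.mul_sum, ← Finset.sum_sub_distrib]
  refine Finset.sum_congr rfl fun b hb => ?_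
  have hb' := Finset.mem_Icc.1 hb
  have h2 := realSign_mul (hx a ha) (hx b (Finset.mem_Icc.2 ⟨by omega, hb'.2⟩))
  split_ifs with h
  · rw [h2.1 h]
    norm_num
  · rw [h2.2 h]
    norm_num

theorem lamEntry_last [CharZero F] {x : GL (Fin (2 * (2 * n))) F}
    (hx : ∀ a ∈ Finset.Icc 1 D.l₂, hSign D x (D.l₁ + a) = 1 ∨ hSign D x (D.l₁ + a) = -1)
    (h : 0 < D.l₂) : lamEntry D x D.l₂ = 1 := by
  rw [lamEntry_eq_sum hx (Finset.mem_Icc.2 ⟨h, le_rfl⟩), Finset.Icc_self, Finset.sum_singleton,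
    realSign_mul_self]

/-- Multiplying `∑_{b > a} s_{a+1} s_b` by `s_a s_{a+1}` gives `∑_{b > a} s_a s_b`, which leaves
only the term `s_a² = 1`. -/
theorem lamEntry_sub [CharZero F] {x : GL (Fin (2 * (2 * n))) F}
    (hx : ∀ a ∈ Finset.Icc 1 D.l₂, hSign D x (D.l₁ + a) = 1 ∨ hSign D x (D.l₁ + a) = -1)
    {a : ℕ} (ha : 1 ≤ a) (ha' : a < D.l₂) :
    lamEntry D x a - signProd D x (D.l₁ + a) * lamEntry D x (a + 1) = 1 := by
  have h₁ : a ∈ Finset.Icc 1 D.l₂ := Finset.mem_Icc.2 ⟨ha, ha'.le⟩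
  have h₂ : a + 1 ∈ Finset.Icc 1 D.l₂ := Finset.mem_Icc.2 ⟨by omega, ha'⟩
  have hs : signProd D x (D.l₁ + a) = realSign D x a * realSign D x (a + 1) := by
    have h := realSign_mul (hx a h₁) (hx _ h₂)
    rw [signProd, add_assoc]
    split_ifs with h'
    · rw [h.1 h']
    · rw [h.2 h']
  rw [lamEntry_eq_sum hx h₁, lamEntry_eq_sum hx h₂, hs, ← Finset.insert_Icc_add_one_left_eq_Icc ha'.le,
    Finset.sum_insert (by simp), realSign_mul_self, ← Finset.mul_sum, ← Finset.mul_sum]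
  linear_combination (-(realSign D x a * ∑ b ∈ Finset.Icc (a + 1) D.l₂, realSign D x b)) *
    realSign_mul_self (D := D) x (a + 1)

/-- The index shift converts the zero-based block index into the one-based numbering of the `h_j`;
the determinant is that of a block with a single position. -/
theorem hSign_siegel (ξ : GL (Fin (2 * n)) F) {i : Fin (2 * n)}
    (hi : ¬ D.M.block (lo i) < 2 * D.k + D.l₁) :
    hSign D (siegel ξ 0) (D.l₁ + (D.M.block (lo i) - (2 * D.k + D.l₁) + 1)) = ξ.val i i := by
  have h0 : D.M.block (lo i) < 2 * D.k + (D.l₁ + D.l₂) := block_lo_lt D.M rfl i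
  have hc : D.k + (D.l₁ + (D.M.block (lo i) - (2 * D.k + D.l₁) + 1) - 1) = D.L.block (lo i) := by
    rw [D.L_block_lo, if_neg (by omega)]
    omega
  rw [hSign, hc, det_diagBlock_siegel D.L rfl ξ _ (block_lo_lt D.L rfl i)]
  have : Subsingleton {j : Fin (2 * n) // D.L.block (lo j) = D.L.block (lo i)} := by
    have key : ∀ j : Fin (2 * n), D.L.block (lo j) = D.L.block (lo i) → j = i := fun j hj => by
      refine D.eq_of_blk_eq hi ?_
      rw [D.L_block_lo, D.L_block_lo] at hj
      split_ifs at hj <;> omega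
    exact ⟨fun a b => Subtype.ext ((key a.1 a.2).trans (key b.1 b.2).symm)⟩
  rw [det_eq_elem_of_subsingleton _ ⟨i, rfl⟩]
  rfl

theorem exists_block_eq (D : CuspidalType n) {a : ℕ} (ha : a ∈ Finset.Icc 1 D.l₂) :
    ∃ i : Fin (2 * n), D.M.block (lo i) = 2 * D.k + D.l₁ + (a - 1) := by
  have ha' := Finset.mem_Icc.1 ha
  obtain ⟨i, hi⟩ := surjective_blk D.M rfl ⟨2 * D.k + D.l₁ + (a - 1), by
    change _ < 2 * D.k + (D.l₁ + D.l₂)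
    omega⟩
  exact ⟨i, congrArg Fin.val hi⟩

theorem hSign_eq_one_or {ξ : GL (Fin (2 * n)) F} (hξξ : ξ * ξ = 1)
    (hσ : ∀ i j, ξ.val i j ≠ 0 → blk D.M rfl j = D.swap (blk D.M rfl i)) :
    ∀ a ∈ Finset.Icc 1 D.l₂, hSign D (siegel ξ 0) (D.l₁ + a) = 1 ∨
      hSign D (siegel ξ 0) (D.l₁ + a) = -1 := by
  intro a ha
  obtain ⟨i, hi⟩ := exists_block_eq D ha
  have ha' := Finset.mem_Icc.1 ha
  have hi' : ¬ D.M.block (lo i) < 2 * D.k + D.l₁ := by omega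
  have h1 := hSign_siegel ξ hi'
  rw [hi, show 2 * D.k + D.l₁ + (a - 1) - (2 * D.k + D.l₁) + 1 = a by omega] at h1
  rw [h1]
  exact diag_mul_self hξξ hσ hi'

open Classical in
theorem cuspidalSign_eq (ξ : GL (Fin (2 * n)) F) {i : Fin (2 * n)}
    (hi : ¬ D.M.block (lo i) < 2 * D.k + D.l₁) :
    (cuspidalSign D ξ i : ℝ) =
      realSign D (siegel ξ 0) (D.M.block (lo i) - (2 * D.k + D.l₁) + 1) := by
  rw [cuspidalSign, if_neg hi, realSign, hSign_siegel ξ hi]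
  split_ifs <;> simp

open Classical in
-- Where the sign is zero the formula reduces to `1/2`. On the blocks of size one the same-block
-- term is `s_a² / 2 = 1/2`, and with the leading `1/2` it makes up the full term `b = a` of `λ_a`.
theorem rhoVector_blk [CharZero F] {ξ : GL (Fin (2 * n)) F} (hξξ : ξ * ξ = 1)
    (hσ : ∀ i j, ξ.val i j ≠ 0 → blk D.M rfl j = D.swap (blk D.M rfl i)) (i : Fin (2 * n)) :
    rhoVector D (siegel ξ 0) (blk D.M rfl i) = 1 / 2 + cuspidalSign D ξ i *
      ∑ j, (cuspidalSign D ξ j : ℝ) * ((if D.L.block (lo i) < D.L.block (lo j) then 1 else 0) +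
        if D.L.block (lo i) = D.L.block (lo j) then 1 / 2 else 0) := by
  have h0 : ∀ j : Fin (2 * n), D.M.block (lo j) < 2 * D.k + (D.l₁ + D.l₂) :=
    fun j => block_lo_lt D.M rfl j
  rw [rhoVector]
  by_cases hi : D.M.block (lo i) < 2 * D.k + D.l₁
  · rw [if_pos (show (blk D.M rfl i).val < 2 * D.k + D.l₁ from hi), cuspidalSign, if_pos hi]
    simp
  rw [if_neg (show ¬ (blk D.M rfl i).val < 2 * D.k + D.l₁ from hi), cuspidalSign_eq ξ hi]
  change lamEntry D _ (D.M.block (lo i) - (2 * D.k + D.l₁) + 1) = _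
  set a := D.M.block (lo i) - (2 * D.k + D.l₁) + 1 with ha
  set x : GL (Fin (2 * (2 * n))) F := siegel ξ 0 with hx
  have haI : a ∈ Finset.Icc 1 D.l₂ := Finset.mem_Icc.2 ⟨by omega, by have := h0 i; omega⟩
  have hsum : ∑ j, (cuspidalSign D ξ j : ℝ) *
      ((if D.L.block (lo i) < D.L.block (lo j) then 1 else 0) +
        if D.L.block (lo i) = D.L.block (lo j) then 1 / 2 else 0) =
      ∑ b ∈ Finset.Icc a D.l₂, realSign D x b * (if b = a then 1 / 2 else 1) := by
    -- Earlier positions have coefficient zero; the remaining ones are singleton blocks, in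
    -- bijection with `a ≤ b ≤ l₂`.
    rw [← Finset.sum_subset (Finset.filter_subset
      (fun j => D.M.block (lo i) ≤ D.M.block (lo j)) Finset.univ)]
    · refine Finset.sum_nbij (fun j => D.M.block (lo j) - (2 * D.k + D.l₁) + 1) ?_ ?_ ?_ ?_
      · intro j hj
        have hj' := (Finset.mem_filter.1 hj).2
        have := h0 j
        exact Finset.mem_Icc.2 ⟨by omega, by omega⟩
      · intro j hj j' hj' hjj
        have h1 := (Finset.mem_filter.1 hj).2
        have h2 := (Finset.mem_filter.1 hj').2
        simp only at hjj
        exact D.eq_of_blk_eq (by omega) (by omega)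
      · intro b hb
        have hb' := Finset.mem_Icc.1 hb
        obtain ⟨j, hj⟩ := exists_block_eq D (a := b) (Finset.mem_Icc.2 ⟨by omega, hb'.2⟩)
        refine ⟨j, Finset.mem_filter.2 ⟨Finset.mem_univ _, by omega⟩, ?_⟩
        simp only
        omega
      · intro j hj
        have hj' := (Finset.mem_filter.1 hj).2
        rw [cuspidalSign_eq ξ (by omega)]
        congr 1
        rw [D.L_block_lo, D.L_block_lo, if_neg (show ¬ D.M.block (lo i) < 2 * D.k by omega),
          if_neg (show ¬ D.M.block (lo j) < 2 * D.k by omega)]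
        by_cases h1 : D.M.block (lo j) = D.M.block (lo i)
        · rw [h1, if_neg (lt_irrefl _), if_pos rfl, if_pos rfl, zero_add]
        · rw [if_pos (by omega), if_neg (by omega), if_neg (by omega), add_zero]
    · intro j _ hj
      have hj' : ¬ D.M.block (lo i) ≤ D.M.block (lo j) := fun h' =>
        hj (Finset.mem_filter.2 ⟨Finset.mem_univ _, h'⟩)
      rw [D.L_block_lo, D.L_block_lo, if_neg (show ¬ D.M.block (lo i) < 2 * D.k by omega),
        if_neg (by split_ifs <;> omega), if_neg (by split_ifs <;> omega), add_zero, mul_zero]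
  rw [hsum, lamEntry_eq_sum (hSign_eq_one_or hξξ hσ) haI, Finset.mul_sum]
  have h2 : ∑ b ∈ Finset.Icc a D.l₂, (if b = a then 1 / 2 else 0) = (1 / 2 : ℝ) := by
    rw [Finset.sum_ite_eq', if_pos (Finset.mem_Icc.2 ⟨le_rfl, (Finset.mem_Icc.1 haI).2⟩)]
  refine Eq.trans ?_ (congrArg (· + _) h2)
  rw [← Finset.sum_add_distrib]
  refine Finset.sum_congr rfl fun b _ => ?_
  by_cases hb : b = a
  · subst hb
    rw [if_pos rfl, if_pos rfl, ← mul_assoc, realSign_mul_self]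
    norm_num
  · rw [if_neg hb, if_neg hb, zero_add, mul_one]

theorem swap_of_lt (t : Fin D.M.k) (ht : t.val < 2 * D.k) :
    (D.swap t).val = if t.val % 2 = 0 then t.val + 1 else t.val - 1 := if_pos ht

theorem swap_of_ge (t : Fin D.M.k) (ht : ¬ t.val < 2 * D.k) : D.swap t = t := Fin.ext (if_neg ht)

theorem rhoVector_swap (x : GL (Fin (2 * (2 * n))) F) (t : Fin D.M.k) :
    rhoVector D x (D.swap t) = rhoVector D x t := by
  by_cases ht : t.val < 2 * D.k
  · have h := swap_of_lt t ht
    rw [rhoVector, rhoVector, if_pos (by split_ifs at h <;> omega), if_pos (by omega)]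
  · rw [swap_of_ge t ht]

theorem coord_eq {d : ℕ} (mu : Fin d → ℝ) (t : Fin d) (i : ℕ) (hi : i = t.val + 1) :
    coord mu i = mu t := by
  subst hi
  exact dif_pos t.2

/-- The explicit description of the affine subspace. -/
theorem mem_hypIntersection_iff [CharZero F] {x : GL (Fin (2 * (2 * n))) F}
    (hx : ∀ a ∈ Finset.Icc 1 D.l₂, hSign D x (D.l₁ + a) = 1 ∨ hSign D x (D.l₁ + a) = -1)
    (mu : Fin D.M.k → ℝ) :
    mu ∈ hypIntersection D x ↔
      ∀ t, mu (D.swap t) + mu t = rhoVector D x (D.swap t) + rhoVector D x t := by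
  have hlt : ∀ t : Fin D.M.k, t.val < 2 * D.k + (D.l₁ + D.l₂) := fun t => t.2
  simp only [hypIntersection, Set.mem_inter_iff, Set.mem_iInter, Finset.mem_Icc, Finset.mem_Ico,
    hypPair, hypHalf, hypLast, Set.mem_ofPred_eq]
  constructor
  · rintro ⟨⟨⟨h1, h2⟩, h3⟩, h4⟩ t
    rw [rhoVector_swap]
    by_cases ht : t.val < 2 * D.k
    · have hs := swap_of_lt t ht
      have h5 := h1 (t.val / 2 + 1) (by omega)
      rw [rhoVector, if_pos (by omega)]
      split_ifs at hs with hp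
      · rw [coord_eq mu t _ (by omega), coord_eq mu (D.swap t) _ (by omega)] at h5
        linarith
      · rw [coord_eq mu (D.swap t) _ (by omega), coord_eq mu t _ (by omega)] at h5
        linarith
    · rw [swap_of_ge t ht]
      suffices h : mu t = rhoVector D x t by rw [h]
      by_cases ht' : t.val < 2 * D.k + D.l₁
      · rw [rhoVector, if_pos ht', ← h2 (t.val + 1) (by omega), coord_eq mu t _ rfl]
      -- Downward induction from the last coordinate, which the hyperplane `μ = 1` fixes; each
      -- earlier hyperplane determines one more coordinate by the recursion that `λ` satisfies.
      · induction h : D.l₁ + D.l₂ + 2 * D.k - 1 - t.val generalizing t with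
        | zero =>
          have h5 := h4 (by have := hlt t; omega)
          have := hlt t
          rw [rhoVector, if_neg ht', show t.val - (2 * D.k + D.l₁) + 1 = D.l₂ by omega,
            lamEntry_last hx (by omega), ← h5, coord_eq mu t _ (by omega)]
        | succ m ih =>
          let t' : Fin D.M.k := ⟨t.val + 1, by change _ < 2 * D.k + (D.l₁ + D.l₂); omega⟩
          have ht'' : t'.val = t.val + 1 := rfl
          have h5 := ih t' (by omega) (by omega) (by omega)
          have h6 := h3 (t.val + 1 - 2 * D.k) (by omega)
          have h7 := lamEntry_sub hx (a := t.val - (2 * D.k + D.l₁) + 1) (by omega) (by omega)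
          rw [coord_eq mu t _ (by omega), coord_eq mu t' _ (by omega), h5, rhoVector,
            if_neg (by omega)] at h6
          rw [rhoVector, if_neg ht']
          rw [show D.l₁ + (t.val - (2 * D.k + D.l₁) + 1) = t.val + 1 - 2 * D.k by omega] at h7
          rw [show t'.val - (2 * D.k + D.l₁) + 1 = t.val - (2 * D.k + D.l₁) + 1 + 1 by
            omega] at h6
          linarith
  · intro h
    have heq : ∀ t : Fin D.M.k, ¬ t.val < 2 * D.k → mu t = rhoVector D x t := fun t ht => by
      have := h t
      rw [swap_of_ge t ht] at this
      linarith
    refine ⟨⟨⟨fun i hi => ?_, fun i hi => ?_⟩, fun j hj => ?_⟩, fun hl => ?_⟩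
    · let t : Fin D.M.k := ⟨2 * (i - 1), by change _ < 2 * D.k + (D.l₁ + D.l₂); omega⟩
      have ht : t.val = 2 * (i - 1) := rfl
      have hs := swap_of_lt t (by omega)
      rw [if_pos (by omega)] at hs
      have h5 := h t
      rw [rhoVector_swap, rhoVector, if_pos (by omega)] at h5
      rw [coord_eq mu t _ (by omega), coord_eq mu (D.swap t) _ (by omega)]
      linarith
    · let t : Fin D.M.k := ⟨i - 1, by change _ < 2 * D.k + (D.l₁ + D.l₂); omega⟩
      have ht : t.val = i - 1 := rfl
      rw [coord_eq mu t _ (by omega), heq t (by omega), rhoVector, if_pos (by omega)]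
    · let t : Fin D.M.k := ⟨2 * D.k + j - 1, by change _ < 2 * D.k + (D.l₁ + D.l₂); omega⟩
      have ht : t.val = 2 * D.k + j - 1 := rfl
      let t' : Fin D.M.k := ⟨2 * D.k + j, by change _ < 2 * D.k + (D.l₁ + D.l₂); omega⟩
      have ht' : t'.val = 2 * D.k + j := rfl
      have h7 := lamEntry_sub hx (a := j - D.l₁) (by omega) (by omega)
      rw [show D.l₁ + (j - D.l₁) = j by omega] at h7
      rw [coord_eq mu t _ (by omega), coord_eq mu t' _ (by omega), heq t (by omega),
        heq t' (by omega), rhoVector, if_neg (by omega), rhoVector, if_neg (by omega),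
        show t.val - (2 * D.k + D.l₁) + 1 = j - D.l₁ by omega,
        show t'.val - (2 * D.k + D.l₁) + 1 = j - D.l₁ + 1 by omega, h7]
    · let t : Fin D.M.k := ⟨2 * D.k + (D.l₁ + D.l₂) - 1, by
        change _ < 2 * D.k + (D.l₁ + D.l₂); omega⟩
      have ht : t.val = 2 * D.k + (D.l₁ + D.l₂) - 1 := rfl
      rw [coord_eq mu t _ (by omega), heq t (by omega), rhoVector, if_neg (by omega),
        show t.val - (2 * D.k + D.l₁) + 1 = D.l₂ by omega, lamEntry_last hx hl]

end Explicit

end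

end AdelicSp

/-! ### The main theorem -/

theorem mainTheorem10 (F : Type*) [Field F] [NumberField F] (n : ℕ)
    (D : AdelicSp.CuspidalType n) (x : Matrix.GeneralLinearGroup (Fin (2 * (2 * n))) F)
    (hx : AdelicSp.IsStandardCuspidal D x) :
    (∀ rho : Fin D.M.k → ℝ, AdelicSp.IsRho D.M x rho ↔ rho = AdelicSp.rhoVector D x) ∧
    (∀ rho : Fin D.M.k → ℝ, AdelicSp.IsRho D.M x rho →
      {mu : Fin D.M.k → ℝ | ∃ nu ∈ AdelicSp.eigenspace D.M x (-1), mu = rho + nu} =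
        AdelicSp.hypIntersection D x) := by
  classical
  obtain ⟨ξ, rfl, hξξ, hξ⟩ := hx.exists_siegel
  have hσ := hx.blk_eq_swap hξξ hξ
  have hξξ' : ξ.val * ξ.val = 1 := congrArg Units.val hξξ
  have hrho : ∀ rho : Fin D.M.k → ℝ, AdelicSp.IsRho D.M (AdelicSp.siegel ξ 0) rho ↔
      rho = AdelicSp.rhoVector D (AdelicSp.siegel ξ 0) :=
    AdelicSp.isRho_iff rfl ξ hξξ' D.swap hσ D.swap_swap (AdelicSp.surjective_blk D.M rfl)
      D.L_block_lt D.L_block_le D.L_block_eq_iff (AdelicSp.cuspidalSign D ξ) (hx.sum_diag hξξ hσ) _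
      (AdelicSp.rhoVector_swap _) (AdelicSp.rhoVector_blk hξξ hσ)
  refine ⟨hrho, fun rho h => ?_⟩
  rw [(hrho rho).1 h]
  ext mu
  rw [AdelicSp.mem_hypIntersection_iff (AdelicSp.hSign_eq_one_or hξξ hσ)]
  -- The `-1`-eigenspace consists of the vectors with `nu (swap t) = -nu t`. Hence `mu - rho` lies
  -- in it exactly when the sums of `mu` and of `rho` over `t` and `swap t` agree.
  have heig := fun nu => AdelicSp.mem_eigenspace_iff rfl ξ hξξ' D.swap hσ D.swap_swap
    (AdelicSp.surjective_blk D.M rfl) nu (-1)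
  constructor
  · rintro ⟨nu, hnu, rfl⟩ t
    have h1 := (heig nu).1 hnu t
    rw [Pi.add_apply, Pi.add_apply, h1]
    ring
  · intro hmu
    refine ⟨mu - AdelicSp.rhoVector D (AdelicSp.siegel ξ 0), (heig _).2 fun t => ?_, by abel⟩
    have h1 := hmu t
    rw [Pi.sub_apply, Pi.sub_apply]
    linarith
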